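/- Let $k\ge 1$ and $\alpha_1,\dots,\alpha_k,\beta_1,\dots,\beta_k>0$ with $\alpha_1\cdots\alpha_k=\beta_1\cdots\beta_k$ (the weights of the $2\times k$-periodic Aztec diamond), and put $$\Phi(z)=\frac{1}{(1-z^{-1})^k}\prod_{m=1}^k\begin{pmatrix}1&\alpha_m z^{-1}\\ \alpha_m^{-1}&1\end{pmatrix}\begin{pmatrix}1&\beta_m z^{-1}\\ \beta_m^{-1}&1\end{pmatrix},\qquad p(z)=\big((z-1)^k\operatorname{Tr}\Phi(z)\big)^2-4(z-1)^{2k}.$$ Then $p$ is a real polynomial; write $p=q^2p_0$ with $q$ monic and $p_0$ having only simple zeros, let $\deg p_0=2k'-1$ and let $0=x_0>x_1>\dots>x_{2(k'-1)}$ be the zeros of $p_0$. Let $\mathcal R$ be the compact Riemann surface $\{w^2=p_0(z)\}\cup\{\infty\}$, let $C_0^+\subset\mathcal R$ be the set of points with $z\in[0,\infty)$ together with the point at infinity, let $C_\ell^+$ ($1\le\ell\le k'-1$) be the set of points with $z\in[x_{2\ell},x_{2\ell-1}]$, and let $C^+=\bigcup_{\ell=0}^{k'-1}C_\ell^+$.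 For $(\chi,\eta)\in(-1,1)^2$ consider on $\mathcal R$ the multi-valued function $$F(z,w;\chi,\eta)=\tfrac k4(\eta+1)\log z-\tfrac k2\log(z-1)-\tfrac\chi2\log\rho(z,w),\qquad \rho(z,w)=\tfrac12\operatorname{Tr}\Phi(z)+\frac{q(z)w}{2(z-1)^k}.$$ A critical point of $F$ of order $n\ge1$ is a zero of order $n$ of the (single-valued) meromorphic differential $dF$. A point $(\chi,\eta)\in(-1,1)^2$ belongs to * $\mathcal G_F$ (frozen region) if $F$ has two distinct critical points in $C_0^+$; * $\mathcal G_R$ (rough region) if $F$ has a critical point in $\mathcal R\setminus C^+$; * $\mathcal G_S^{(\ell)}$ ($1\le \ell\le k'-1$) if $F$ has four distinct critical points in $C_\ell^+$, and $\mathcal G_S=\bigcup_{\ell=1}^{k'-1}\mathcal G_S^{(\ell)}$ (smooth region); * $\mathcal E_{FR}$ if $F$ has a critical point of order two in $C_0^+$; * $\mathcal E_{RS}^{(\ell)}$ ($1\le \ell\le k'-1$) if $F$ has a critical point of order at least two in $C_\ell^+$. Let $\overline{\mathcal E}_{FR}$ be $\mathcal E_{FR}$ together with the four points $(0,\pm1)$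 and $\left(\pm1,\frac1k\frac{p'(1)}{p(1)}-1\right)$. Say that a set $E\subset\mathbb R^2$ separates $A$ and $B$ if $\partial A\cap\partial B=E$, both $A$ and $B$ are disjoint from $E$, and no connected component of $\mathbb R^2\setminus E$ meets both $A$ and $B$. **Proposition.** 1. The boundary of $\mathcal G_R$ in $\mathbb R^2$ is $\overline{\mathcal E}_{FR}\cup\bigcup_{\ell=1}^{k'-1}\mathcal E_{RS}^{(\ell)}$. 2. $\overline{\mathcal E}_{FR}$ separates $\mathcal G_R$ and $\mathcal G_F$. 3. $\bigcup_{\ell=1}^{k'-1}\mathcal E_{RS}^{(\ell)}$ separates $\mathcal G_R$ and $\mathcal G_S$, and for each $\ell=1,\dots,k'-1$ the set $\mathcal E_{RS}^{(\ell)}$ separates $\mathcal G_R$ and $\mathcal G_S^{(\ell)}$. 4. Every $(\chi,\eta)\in(-1,1)^2$ belongs to exactly one of the sets $\mathcal G_F$, $\mathcal G_R$, $\mathcal G_S$, $\mathcal E_{FR}$, $\mathcal E_{RS}^{(1)},\dots,\mathcal E_{RS}^{(k'-1)}$. -/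

import Mathlib

open Polynomial

noncomputable section

namespace AztecDiamond

/-! ### The matrix symbol, the discriminant and its square-free part -/

/-- The matrix-valued symbol of the `2 × k`-periodic Aztec diamond,
`Φ(z) = (1 - z⁻¹)⁻ᵏ ∏ₘ [[1, αₘ z⁻¹], [αₘ⁻¹, 1]] [[1, βₘ z⁻¹], [βₘ⁻¹, 1]]` (ordered product). -/
def Phi {k : ℕ} (α β : Fin k → ℝ) (z : ℂ) : Matrix (Fin 2) (Fin 2) ℂ :=
  (1 / (1 - z⁻¹) ^ k) • (List.ofFn fun m : Fin k =>
    (!![1, (α m : ℂ) * z⁻¹; (α m : ℂ)⁻¹, 1] * !![1, (β m : ℂ) * z⁻¹; (β m : ℂ)⁻¹, 1] :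
      Matrix (Fin 2) (Fin 2) ℂ)).prod

/-- The polynomial matrix `(z - 1)ᵏ Φ(z)`, see `eval_polyPhi`. -/
def polyPhi {k : ℕ} (α β : Fin k → ℝ) : Matrix (Fin 2) (Fin 2) ℝ[X] :=
  (List.ofFn fun m : Fin k =>
    (!![X + C (α m / β m), C (α m + β m);
        C ((α m)⁻¹ + (β m)⁻¹) * X, X + C (β m / α m)] : Matrix (Fin 2) (Fin 2) ℝ[X])).prod

/-- The discriminant `p(z) = ((z - 1)ᵏ Tr Φ(z))² - 4 (z - 1)²ᵏ`. -/
def p {k : ℕ} (α β : Fin k → ℝ) : ℝ[X] :=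
  (polyPhi α β).trace ^ 2 - 4 * (X - 1) ^ (2 * k)

/-- The monic polynomial `q` in the decomposition `p = q² p₀` in which `p₀` has simple zeros: a
zero of `p` of multiplicity `n` is a zero of `q` of multiplicity `⌊n / 2⌋`. -/
def q {k : ℕ} (α β : Fin k → ℝ) : ℝ[X] :=
  ∏ r ∈ (p α β).roots.toFinset, (X - C r) ^ ((p α β).rootMultiplicity r / 2)

/-- The polynomial `p₀ = p / q²`, see `q_sq_mul_p0`. -/
def p0 {k : ℕ} (α β : Fin k → ℝ) : ℝ[X] := p α β /ₘ (q α β) ^ 2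

/-- The integer `k'`, given by `deg p₀ = 2 k' - 1`. -/
def kPrime {k : ℕ} (α β : Fin k → ℝ) : ℕ := ((p0 α β).natDegree + 1) / 2

/-- The zeros `x₀ > x₁ > ⋯ > x_{2(k'-1)}` of `p₀`, in decreasing order. -/
def x {k : ℕ} (α β : Fin k → ℝ) (l : ℕ) : ℝ :=
  ((p0 α β).roots.sort (· ≥ ·)).getD l 0

/-! ### The compact Riemann surface and its real ovals -/

/-- The affine curve `w² = p₀(z)`. -/
abbrev AffineCurve {k : ℕ} (α β : Fin k → ℝ) : Type :=
  {y : ℂ × ℂ // y.2 ^ 2 = aeval y.1 (p0 α β)}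

/-- The compact Riemann surface: the affine curve `w² = p₀(z)` with one point added at infinity
(one point, since `p₀` has odd degree). -/
abbrev Surface {k : ℕ} (α β : Fin k → ℝ) : Type := OnePoint (AffineCurve α β)

/-- The real ovals `C_ℓ⁺`: `C₀⁺` lies over `[0, ∞]`, and `C_ℓ⁺` lies over `[x_{2ℓ}, x_{2ℓ-1}]`
for `1 ≤ ℓ ≤ k' - 1`. -/
def oval {k : ℕ} (α β : Fin k → ℝ) (l : ℕ) : Set (Surface α β) :=
  if l = 0 then
    {y | y = OnePoint.infty ∨
      ∃ a : AffineCurve α β, y = (a : Surface α β) ∧ ∃ t : ℝ, 0 ≤ t ∧ a.1.1 = (t : ℂ)}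
  else
    {y | ∃ a : AffineCurve α β, y = (a : Surface α β) ∧
      ∃ t ∈ Set.Icc (x α β (2 * l)) (x α β (2 * l - 1)), a.1.1 = (t : ℂ)}

/-- `C⁺`, the union of the ovals `C_ℓ⁺` for `0 ≤ ℓ ≤ k' - 1`. -/
def ovals {k : ℕ} (α β : Fin k → ℝ) : Set (Surface α β) :=
  ⋃ l ∈ Set.Icc 0 (kPrime α β - 1), oval α β l

/-- The function `z` in a local coordinate `s` centred at the point `y` of the surface:
`z = s⁻²` at infinity, `z = x + s²` at a branch point `(x, 0)`, and `z = z₀ + s` at every other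
point `(z₀, w₀)`. -/
def locZ {k : ℕ} (α β : Fin k → ℝ) : Surface α β → ℂ → ℂ
  | none => fun s => (s ^ 2)⁻¹
  | some a => if a.1.2 = 0 then fun s => a.1.1 + s ^ 2 else fun s => a.1.1 + s

/-- The function `w` in the same local coordinate `s` as in `locZ`. It is the holomorphic
(at infinity meromorphic) branch of the square root of `p₀(z)` through the given point; `s` is
determined up to sign at infinity and at a branch point, and either choice is a coordinate. -/
def locW {k : ℕ} (α β : Fin k → ℝ) : Surface α β → ℂ → ℂ
  | none => fun s =>
      s⁻¹ ^ (p0 α β).natDegree * (aeval (s ^ 2) (p0 α β).reverse) ^ (1 / 2 : ℂ)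
  | some a =>
      if a.1.2 = 0 then fun s =>
        s * (aeval a.1.1 (derivative (p0 α β))) ^ (1 / 2 : ℂ) *
          (aeval (a.1.1 + s ^ 2) (p0 α β) /
            (aeval a.1.1 (derivative (p0 α β)) * s ^ 2)) ^ (1 / 2 : ℂ)
      else fun s =>
        a.1.2 * (aeval (a.1.1 + s) (p0 α β) / a.1.2 ^ 2) ^ (1 / 2 : ℂ)

/-! ### The action function and its critical points -/

/-- The meromorphic function `ρ(z, w) = ½ Tr Φ(z) + q(z) w / (2 (z - 1)ᵏ)` on the surface. -/
def rho {k : ℕ} (α β : Fin k → ℝ) (z w : ℂ) : ℂ :=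
  1 / 2 * (Phi α β z).trace + aeval z (q α β) * w / (2 * (z - 1) ^ k)

/-- The derivative, in the local coordinate at `y`, of the multi-valued function
`F = (k/4) (η + 1) log z - (k/2) log (z - 1) - (χ/2) log ρ(z, w)`, where `P = (χ, η)`. Different
branches of the logarithms have the same derivative, so `dF` is a meromorphic differential. -/
def dF {k : ℕ} (α β : Fin k → ℝ) (P : ℝ × ℝ) (y : Surface α β) (s : ℂ) : ℂ :=
  (k : ℂ) / 4 * ((P.2 : ℂ) + 1) * logDeriv (locZ α β y) s
    - (k : ℂ) / 2 * logDeriv (fun t => locZ α β y t - 1) s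
    - (P.1 : ℂ) / 2 * logDeriv (fun t => rho α β (locZ α β y t) (locW α β y t)) s

/-- The order of vanishing of `dF` at the point `y` (negative at a pole). The point is a critical
point of order `n ≥ 1` of `F` if this order is `n`. -/
def critOrder {k : ℕ} (α β : Fin k → ℝ) (P : ℝ × ℝ) (y : Surface α β) : WithTop ℤ :=
  meromorphicOrderAt (dF α β P y) 0

/-- The set of critical points of `F( · ; χ, η)` on the surface, `P = (χ, η)`. -/
def critPoints {k : ℕ} (α β : Fin k → ℝ) (P : ℝ × ℝ) : Set (Surface α β) :=
  {y | 1 ≤ critOrder α β P y}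

/-! ### The regions and the arctic curves -/

/-- The open square `(-1, 1)²` of the global coordinates `(χ, η)`. -/
def square : Set (ℝ × ℝ) := Set.Ioo (-1) 1 ×ˢ Set.Ioo (-1) 1

/-- The frozen region `𝒢_F`: two distinct critical points in `C₀⁺`. -/
def frozen {k : ℕ} (α β : Fin k → ℝ) : Set (ℝ × ℝ) :=
  {P | P ∈ square ∧ 2 ≤ (critPoints α β P ∩ oval α β 0).encard}

/-- The rough region `𝒢_R`: there are critical points outside `C⁺`. -/
def rough {k : ℕ} (α β : Fin k → ℝ) : Set (ℝ × ℝ) :=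
  {P | P ∈ square ∧ (critPoints α β P \ ovals α β).Nonempty}

/-- The part of the smooth region where four distinct critical points lie in the given `C_ℓ⁺`. -/
def smoothPart {k : ℕ} (α β : Fin k → ℝ) (l : ℕ) : Set (ℝ × ℝ) :=
  {P | P ∈ square ∧ 4 ≤ (critPoints α β P ∩ oval α β l).encard}

/-- The smooth region `𝒢_S`: four distinct critical points in some `C_ℓ⁺`, `1 ≤ ℓ ≤ k' - 1`. -/
def smooth {k : ℕ} (α β : Fin k → ℝ) : Set (ℝ × ℝ) :=
  ⋃ l ∈ Set.Icc 1 (kPrime α β - 1), smoothPart α β l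

/-- `ℰ_FR` inside the open square: there is a critical point of order two in `C₀⁺`. -/
def frozenRough {k : ℕ} (α β : Fin k → ℝ) : Set (ℝ × ℝ) :=
  {P | P ∈ square ∧ ∃ y ∈ oval α β 0, critOrder α β P y = 2}

/-- `ℰ_RS^(ℓ)`: there is a critical point of order at least two in `C_ℓ⁺`. -/
def roughSmooth {k : ℕ} (α β : Fin k → ℝ) (l : ℕ) : Set (ℝ × ℝ) :=
  {P | P ∈ square ∧ ∃ y ∈ oval α β l, 2 ≤ critOrder α β P y}

/-- The closed curve `ℰ_FR`: the set `frozenRough` together with the four points where it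
touches the boundary of the square, `(0, ± 1)` and `(± 1, p'(1) / (k p(1)) - 1)`. -/
def frozenRoughCurve {k : ℕ} (α β : Fin k → ℝ) : Set (ℝ × ℝ) :=
  frozenRough α β ∪
    {(0, 1), (0, -1),
      (1, 1 / (k : ℝ) * ((derivative (p α β)).eval 1 / (p α β).eval 1) - 1),
      (-1, 1 / (k : ℝ) * ((derivative (p α β)).eval 1 / (p α β).eval 1) - 1)}

/-- Labels of the sets that make up the phase diagram. -/
inductive Phase (n : ℕ) : Type
  | frozen : Phase n
  | rough : Phase n
  | smooth : Phase n
  | frozenRough : Phase n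
  | roughSmooth (l : Set.Icc 1 n) : Phase n

/-- The set of points of the open square with the given label. -/
def phaseSet {k : ℕ} (α β : Fin k → ℝ) : Phase (kPrime α β - 1) → Set (ℝ × ℝ)
  | .frozen => frozen α β
  | .rough => rough α β
  | .smooth => smooth α β
  | .frozenRough => frozenRough α β
  | .roughSmooth l => roughSmooth α β l.1

/-- `E` separates the regions `A` and `B` in the plane: `E` is their common boundary, and points
of `A` and of `B` never lie in the same connected component of the complement of `E`. -/
def Separates (E A B : Set (ℝ × ℝ)) : Prop :=
  frontier A ∩ frontier B = E ∧ A ⊆ Eᶜ ∧ B ⊆ Eᶜ ∧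
    ∀ a ∈ A, ∀ b ∈ B, b ∉ connectedComponentIn Eᶜ a

/-! ### Consistency of the definitions -/

theorem eval_polyPhi {k : ℕ} (α β : Fin k → ℝ) (hα : ∀ m, 0 < α m) (hβ : ∀ m, 0 < β m)
    {z : ℂ} (h0 : z ≠ 0) (h1 : z ≠ 1) :
    (polyPhi α β).map (aeval z : ℝ[X] →ₐ[ℝ] ℂ) = (z - 1) ^ k • Phi α β z := by
  have hz : 1 - z⁻¹ ≠ 0 := by
    intro h
    apply h1
    field_simp at h
    linear_combination h
  have e1 : (z - 1) ^ k * (1 / (1 - z⁻¹) ^ k) = z ^ k := by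
    have : z - 1 = z * (1 - z⁻¹) := by field_simp
    rw [this, mul_pow]
    field_simp
  rw [Phi, smul_smul, e1]
  have key : ∀ L : List (Fin k),
      ((L.map fun m => (!![X + C (α m / β m), C (α m + β m);
        C ((α m)⁻¹ + (β m)⁻¹) * X, X + C (β m / α m)] : Matrix (Fin 2) (Fin 2) ℝ[X])).prod).map
          (aeval z : ℝ[X] →ₐ[ℝ] ℂ) =
      z ^ L.length • (L.map fun m => (!![1, (α m : ℂ) * z⁻¹; (α m : ℂ)⁻¹, 1] *
        !![1, (β m : ℂ) * z⁻¹; (β m : ℂ)⁻¹, 1] : Matrix (Fin 2) (Fin 2) ℂ)).prod := by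
    intro L
    induction L with
    | nil => simp
    | cons m L ih =>
      have ha : (α m : ℂ) ≠ 0 := by exact_mod_cast (hα m).ne'
      have hb : (β m : ℂ) ≠ 0 := by exact_mod_cast (hβ m).ne'
      have hm : (!![X + C (α m / β m), C (α m + β m);
          C ((α m)⁻¹ + (β m)⁻¹) * X, X + C (β m / α m)] : Matrix (Fin 2) (Fin 2) ℝ[X]).map
            (aeval z : ℝ[X] →ₐ[ℝ] ℂ) =
          z • (!![1, (α m : ℂ) * z⁻¹; (α m : ℂ)⁻¹, 1] *
            !![1, (β m : ℂ) * z⁻¹; (β m : ℂ)⁻¹, 1] : Matrix (Fin 2) (Fin 2) ℂ) := by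
        ext i j
        fin_cases i <;> fin_cases j <;> simp <;> field_simp <;> ring
      rw [List.map_cons, List.map_cons, List.prod_cons, List.prod_cons, Matrix.map_mul, ih, hm,
        List.length_cons, pow_succ', smul_mul_smul_comm]
  have := key (List.finRange k)
  simpa only [polyPhi, List.ofFn_eq_map, List.length_finRange] using this

theorem q_monic {k : ℕ} (α β : Fin k → ℝ) : (q α β).Monic :=
  monic_prod_of_monic _ _ fun r _ => (monic_X_sub_C r).pow _

theorem q_sq_mul_p0 {k : ℕ} (α β : Fin k → ℝ) : q α β ^ 2 * p0 α β = p α β := by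
  have hd : q α β ^ 2 ∣ p α β := by
    rw [q, ← Finset.prod_pow]
    refine dvd_trans (Finset.prod_dvd_prod_of_dvd _
      (fun r => (X - C r) ^ (p α β).rootMultiplicity r) fun r _ => ?_) ?_
    · rw [← pow_mul]
      exact pow_dvd_pow _ (Nat.div_mul_le_self _ 2)
    · rw [← prod_multiset_root_eq_finset_root]
      exact prod_multiset_X_sub_C_dvd _
  have h := modByMonic_add_div (p α β) (q α β ^ 2)
  rwa [(modByMonic_eq_zero_iff_dvd ((q_monic α β).pow 2)).2 hd, zero_add] at h

/-- The local coordinates parametrize the surface. -/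
theorem locW_sq {k : ℕ} (α β : Fin k → ℝ) (y : Surface α β) {s : ℂ} (hs : s ≠ 0)
    (hy : ∀ a : AffineCurve α β, y = (a : Surface α β) → a.1.2 = 0 →
      aeval a.1.1 (derivative (p0 α β)) ≠ 0) :
    locW α β y s ^ 2 = aeval (locZ α β y s) (p0 α β) := by
  have hh : ∀ u : ℂ, (u ^ (1 / 2 : ℂ)) ^ 2 = u := by
    intro u
    rw [← Complex.cpow_nat_mul]
    norm_num
  rcases y with _ | a
  · simp only [locW, locZ, mul_pow, hh]
    have h2 : (s ^ 2) ≠ 0 := pow_ne_zero 2 hs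
    let _ := invertibleOfNonzero (inv_ne_zero h2)
    have := Polynomial.eval₂_reverse_mul_pow (algebraMap ℝ ℂ) (s ^ 2)⁻¹ (p0 α β)
    simp only [invOf_eq_inv, inv_inv] at this
    rw [aeval_def, aeval_def, ← this]
    rw [mul_comm, ← pow_mul, mul_comm _ 2, pow_mul, inv_pow]
  · by_cases h : a.1.2 = 0
    · have := hy a rfl h
      simp only [locW, locZ, h, if_true, mul_pow, hh]
      field_simp
    · simp only [locW, locZ, h, if_false, mul_pow, hh]
      field_simp

end AztecDiamond

end

/-! Write T = (z - 1)ᵏ Tr Φ, so that p = T² - 4(z - 1)²ᵏ, and let g = k' - 1. Since (T + qw)(T - qw)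
= 4(z - 1)²ᵏ, differentiating the equation of the curve gives d log ρ = n₀ dz / ((z - 1) w) with a
polynomial n₀ = (T'(z - 1) - kT)/q, and hence dF = (k((η - 1)z - (η + 1)) w - 2χ z n₀) dz / (4 z (z
- 1) w). Multiplying the numerator by its conjugate under w ↦ -w shows that the critical points lie
over the zeros of the real polynomial `crit` = k²((η - 1)z - (η + 1))² p₁ - 4χ² z n₀², where p₀ = z
p₁. Its degree is 2g + 2.

Two facts about the curve carry everything. The zeros of p are real and nonpositive (`p_root_real`):
at any other zero the product of the layers would have an eigenvector whose eigenvalue has modulus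
|z - 1|ᵏ, whereas each layer enlarges a suitable Hermitian form by more than the corresponding
factor. And n₀ has exactly one zero in each of the g gaps [x_{2l}, x_{2l-1}] (`num_zero_of_gap`): ρ²
equals 1 at both ends, so Rolle applies, and deg n₀ ≤ g. From here on only the data collected in
`GapModel` matter.

Since n₀ changes sign across a gap while w vanishes at its ends, each of the two sheets over each
gap carries a zero of the numerator. So every gap holds at least two zeros of `crit`, and only two
zeros are free. They can lie on the positive half line (frozen, or its edge if they coincide), in
one of the gaps (smooth, or its edge), or elsewhere (rough). The same count, applied to another
polynomial of this shape, shows that the function `slope` = 2z n₀/(k(z - 1)√p₀) is injective on each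
gap (`slope_injOn`).

Over a gap the critical equation becomes η - (z + 1)/(z - 1) ∓ χ · slope = 0. For χ ≠ 0, on one
sheet it is strictly increasing in z and has a single simple zero. On the other it runs from
positive to negative values, and the smooth region consists of the points where a change from
negative to positive occurs in between (`alternating`). This condition is open. The set `inner` of
points with four zeros of `crit` in the gap is closed, because the zeros then range over a compact
set; the difference of the two is the inner curve. For fixed z and fixed sheet the equation is a
line in the (χ, η)-plane. Moving along it towards χ = 0 from a point with a higher-order zero leads
into the smooth region, moving away from χ = 0 leads out of `inner`; this shows that the curve is in
both boundaries.

The outer curve is simpler: χ enters `crit` only through -4χ² z n₀², so on the positive half line a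
larger |χ| makes the polynomial smaller. On the boundary of the square it takes negative values
there except at the four exceptional points. The separation statements then follow from explicit
covers of the complement of the curves by two disjoint open sets. -/

namespace AztecDiamond

/-! ### The trace polynomial -/

/-- One factor of the product `polyPhi`. -/
noncomputable def layer (a b : ℝ) : Matrix (Fin 2) (Fin 2) ℝ[X] :=
  !![X + C (a / b), C (a + b); C (a⁻¹ + b⁻¹) * X, X + C (b / a)]

/-- Degree, sign and boundary data of a product of `n` layers. -/
structure LayerShape (n : ℕ) (c : ℝ) (M : Matrix (Fin 2) (Fin 2) ℝ[X]) : Prop where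
  natDegree_le : ∀ i j, (M i j).natDegree ≤ n
  coeff_nonneg : ∀ i j m, 0 ≤ (M i j).coeff m
  top00 : (M 0 0).coeff n = 1
  top01 : (M 0 1).coeff n = 0
  top11 : (M 1 1).coeff n = 1
  bot00 : (M 0 0).coeff 0 = c
  bot10 : (M 1 0).coeff 0 = 0
  bot11 : (M 1 1).coeff 0 = c⁻¹
  det_eq : M.det = (X - 1) ^ (2 * n)

theorem layerShape_one : LayerShape 0 1 1 where
  natDegree_le i j := by fin_cases i <;> fin_cases j <;> simp
  coeff_nonneg i j m := by
    fin_cases i <;> fin_cases j <;> simp [coeff_one] <;> split_ifs <;> norm_num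
  top00 := by simp
  top01 := by simp
  top11 := by simp
  bot00 := by simp
  bot10 := by simp
  bot11 := by simp
  det_eq := by simp

theorem coeff_nonneg_mul {f g : ℝ[X]} (hf : ∀ m, 0 ≤ f.coeff m) (hg : ∀ m, 0 ≤ g.coeff m)
    (m : ℕ) : 0 ≤ (f * g).coeff m := by
  rw [coeff_mul]
  exact Finset.sum_nonneg fun x _ => mul_nonneg (hf _) (hg _)

theorem layer_coeff_nonneg {a b : ℝ} (ha : 0 < a) (hb : 0 < b) (i j : Fin 2) (m : ℕ) :
    0 ≤ (layer a b i j).coeff m := by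
  have hX : ∀ m, 0 ≤ (X : ℝ[X]).coeff m := fun m => by
    rw [coeff_X]; split_ifs <;> norm_num
  have hC : ∀ x : ℝ, 0 ≤ x → ∀ m, 0 ≤ (C x).coeff m := fun x hx m => by
    rw [coeff_C]; split_ifs <;> simp [hx]
  fin_cases i <;> fin_cases j <;> simp only [layer, Fin.zero_eta, Fin.mk_one, Matrix.of_apply,
    Matrix.cons_val', Matrix.cons_val_zero, Matrix.cons_val_one, Matrix.cons_val_fin_one]
  · rw [coeff_add]; exact add_nonneg (hX _) (hC _ (by positivity) _)
  · exact hC _ (by positivity) _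
  · exact coeff_nonneg_mul (hC _ (by positivity)) hX _
  · rw [coeff_add]; exact add_nonneg (hX _) (hC _ (by positivity) _)

theorem layer_det {a b : ℝ} (ha : 0 < a) (hb : 0 < b) : (layer a b).det = (X - 1) ^ 2 := by
  rw [layer, Matrix.det_fin_two_of]
  have h1 : C (a / b) * C (b / a) = (1 : ℝ[X]) := by
    rw [← C_mul, ← C_1]; congr 1; field_simp
  have h2 : C (a + b) * C (a⁻¹ + b⁻¹) = C (a / b) + C (b / a) + (2 : ℝ[X]) := by
    rw [← C_mul, ← C_add, show (2 : ℝ[X]) = C 2 from rfl, ← C_add]; congr 1; field_simp; ring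
  linear_combination h1 - X * h2

theorem LayerShape.cons {n : ℕ} {c : ℝ} {M : Matrix (Fin 2) (Fin 2) ℝ[X]} (h : LayerShape n c M)
    {a b : ℝ} (ha : 0 < a) (hb : 0 < b) : LayerShape (n + 1) (a / b * c) (layer a b * M) := by
  have e0 : ∀ j, (layer a b * M) 0 j = X * M 0 j + C (a / b) * M 0 j + C (a + b) * M 1 j := by
    intro j; simp [layer, Matrix.mul_apply, Fin.sum_univ_two]; ring
  have e1 : ∀ j, (layer a b * M) 1 j =
      X * (C (a⁻¹ + b⁻¹) * M 0 j) + X * M 1 j + C (b / a) * M 1 j := by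
    intro j; simp [layer, Matrix.mul_apply, Fin.sum_univ_two]; ring
  have z : ∀ i j, (M i j).coeff (n + 1) = 0 := fun i j =>
    coeff_eq_zero_of_natDegree_lt (Nat.lt_succ_of_le (h.natDegree_le i j))
  refine ⟨?_, ?_, ?_, ?_, ?_, ?_, ?_, ?_, ?_⟩
  · intro i j
    rw [natDegree_le_iff_coeff_eq_zero]
    intro N hN
    obtain ⟨N, rfl⟩ : ∃ N', N = N' + 1 := ⟨N - 1, by omega⟩
    have w : ∀ i j, (M i j).coeff N = 0 := fun i j =>
      coeff_eq_zero_of_natDegree_lt (lt_of_le_of_lt (h.natDegree_le i j) (by omega))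
    have w' : ∀ i j, (M i j).coeff (N + 1) = 0 := fun i j =>
      coeff_eq_zero_of_natDegree_lt (lt_of_le_of_lt (h.natDegree_le i j) (by omega))
    fin_cases i
    · simp only [Fin.zero_eta, e0, coeff_add, coeff_X_mul, coeff_C_mul, w, w']; simp
    · simp only [Fin.mk_one, e1, coeff_add, coeff_X_mul, coeff_C_mul, w, w']; simp
  · intro i j m
    rw [Matrix.mul_apply, finsetSum_coeff]
    exact Finset.sum_nonneg fun x _ =>
      coeff_nonneg_mul (layer_coeff_nonneg ha hb _ _) (h.coeff_nonneg _ _) _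
  · simp only [e0, coeff_add, coeff_X_mul, coeff_C_mul, z, h.top00]; simp
  · simp only [e0, coeff_add, coeff_X_mul, coeff_C_mul, z, h.top01]; simp
  · simp only [e1, coeff_add, coeff_X_mul, coeff_C_mul, z, h.top01, h.top11]; simp
  · simp only [e0, coeff_add, coeff_X_mul_zero, coeff_C_mul, h.bot00, h.bot10]; simp
  · simp only [e1, coeff_add, coeff_X_mul_zero, coeff_C_mul, h.bot10]; simp
  · simp only [e1, coeff_add, coeff_X_mul_zero, coeff_C_mul, h.bot11]; simp [mul_comm]
  · rw [Matrix.det_mul, layer_det ha hb, h.det_eq, ← pow_add]; ring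

theorem layerShape_list {ι : Type*} (a b : ι → ℝ) (ha : ∀ i, 0 < a i) (hb : ∀ i, 0 < b i)
    (L : List ι) : LayerShape L.length (L.map fun i => a i / b i).prod
      (L.map fun i => layer (a i) (b i)).prod := by
  induction L with
  | nil => simpa using layerShape_one
  | cons i L ih => simpa using ih.cons (ha i) (hb i)

section
variable {k : ℕ} (α β : Fin k → ℝ)

theorem polyPhi_eq : polyPhi α β =
    ((List.finRange k).map fun m => layer (α m) (β m)).prod := by
  rw [polyPhi, List.ofFn_eq_map]; rfl

theorem polyPhi_shape (hα : ∀ m, 0 < α m) (hβ : ∀ m, 0 < β m) (hαβ : ∏ m, α m = ∏ m, β m) :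
    LayerShape k 1 (polyPhi α β) := by
  have h := layerShape_list α β hα hβ (List.finRange k)
  rw [← polyPhi_eq, List.length_finRange] at h
  convert h
  rw [← List.ofFn_eq_map, List.prod_ofFn, Finset.prod_div_distrib, hαβ, div_self]
  exact (Finset.prod_pos fun m _ => hβ m).ne'

/-- The polynomial `(z - 1)ᵏ Tr Φ(z)`. -/
noncomputable def tr : ℝ[X] := (polyPhi α β).trace

theorem tr_eq : tr α β = polyPhi α β 0 0 + polyPhi α β 1 1 := by
  rw [tr, Matrix.trace_fin_two]

theorem p_eq : p α β = tr α β ^ 2 - 4 * (X - 1) ^ (2 * k) := rfl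

end

section
variable {k : ℕ} {α β : Fin k → ℝ}

theorem tr_coeff_nonneg (h : LayerShape k 1 (polyPhi α β)) (m : ℕ) : 0 ≤ (tr α β).coeff m := by
  rw [tr_eq, coeff_add]; exact add_nonneg (h.coeff_nonneg _ _ _) (h.coeff_nonneg _ _ _)

theorem tr_natDegree_le (h : LayerShape k 1 (polyPhi α β)) : (tr α β).natDegree ≤ k := by
  rw [tr_eq]; exact natDegree_add_le_of_degree_le (h.natDegree_le _ _) (h.natDegree_le _ _)

theorem tr_coeff_top (h : LayerShape k 1 (polyPhi α β)) : (tr α β).coeff k = 2 := by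
  rw [tr_eq, coeff_add, h.top00, h.top11]; norm_num

theorem tr_coeff_zero (h : LayerShape k 1 (polyPhi α β)) : (tr α β).coeff 0 = 2 := by
  rw [tr_eq, coeff_add, h.bot00, h.bot11]; norm_num

theorem tr_eval_eq_sum (h : LayerShape k 1 (polyPhi α β)) (t : ℝ) :
    (tr α β).eval t = ∑ i ∈ Finset.range (k + 1), (tr α β).coeff i * t ^ i :=
  eval_eq_sum_range' (Nat.lt_succ_of_le (tr_natDegree_le h)) t

theorem tr_deriv_one (h : LayerShape k 1 (polyPhi α β)) :
    (derivative (tr α β)).eval 1 = ∑ i ∈ Finset.range (k + 1), (tr α β).coeff i * i := by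
  have := Polynomial.as_sum_range' (tr α β) (k + 1) (Nat.lt_succ_of_le (tr_natDegree_le h))
  conv_lhs => rw [this]
  simp [derivative_monomial, eval_finsetSum]

theorem tr_one_pos (h : LayerShape k 1 (polyPhi α β)) : 0 < (tr α β).eval 1 := by
  rw [tr_eval_eq_sum h, Finset.sum_range_succ, tr_coeff_top h]
  have : 0 ≤ ∑ i ∈ Finset.range k, (tr α β).coeff i * (1 : ℝ) ^ i :=
    Finset.sum_nonneg fun i _ => by simpa using tr_coeff_nonneg h i
  simp only [one_pow, mul_one] at *
  linarith

theorem tr_deriv_one_pos (hk : 1 ≤ k) (h : LayerShape k 1 (polyPhi α β)) :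
    0 < (derivative (tr α β)).eval 1 := by
  rw [tr_deriv_one h, Finset.sum_range_succ, tr_coeff_top h]
  have : 0 ≤ ∑ i ∈ Finset.range k, (tr α β).coeff i * (i : ℝ) :=
    Finset.sum_nonneg fun i _ => mul_nonneg (tr_coeff_nonneg h i) (Nat.cast_nonneg _)
  have : (1 : ℝ) ≤ k := by exact_mod_cast hk
  linarith

theorem tr_deriv_one_lt (hk : 1 ≤ k) (h : LayerShape k 1 (polyPhi α β)) :
    (derivative (tr α β)).eval 1 < k * (tr α β).eval 1 := by
  rw [tr_deriv_one h, tr_eval_eq_sum h, Finset.mul_sum]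
  refine Finset.sum_lt_sum (fun i hi => ?_) ⟨0, by simp, ?_⟩
  · rw [one_pow, mul_one, mul_comm]
    refine mul_le_mul_of_nonneg_right ?_ (tr_coeff_nonneg h i)
    exact_mod_cast Nat.lt_succ_iff.1 (Finset.mem_range.1 hi)
  · rw [tr_coeff_zero h]
    have : (1 : ℝ) ≤ k := by exact_mod_cast hk
    simp; linarith

/-- p = (T - 2(z - 1)ᵏ)(T + 2(z - 1)ᵏ). Both T and 2(z - 1)ᵏ have leading coefficient 2, so the
first factor drops to degree k - 1; its top coefficient is T_{k-1} + 2k, positive because T has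
nonnegative coefficients. The second factor has leading coefficient 4. -/
theorem p_natDegree_leadingCoeff (hk : 1 ≤ k) (h : LayerShape k 1 (polyPhi α β)) :
    (p α β).natDegree = 2 * k - 1 ∧ 0 < (p α β).leadingCoeff := by
  obtain ⟨n, rfl⟩ : ∃ n, k = n + 1 := ⟨k - 1, by omega⟩
  -- split off the leading term of the trace
  set R := tr α β - 2 * (X - 1) ^ (n + 1) with hR
  have hdeg1 : ((X - 1 : ℝ[X]) ^ (n + 1)).natDegree = n + 1 := by
    rw [← C_1, natDegree_pow, natDegree_X_sub_C, mul_one]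
  have hmon : ((X - 1 : ℝ[X]) ^ (n + 1)).Monic := by
    rw [← C_1]; exact (monic_X_sub_C 1).pow _
  have hc1 : ((X - 1 : ℝ[X]) ^ (n + 1)).coeff (n + 1) = 1 := by
    have := hmon.coeff_natDegree; rwa [hdeg1] at this
  have two : (2 : ℝ[X]) = C 2 := rfl
  have hcn : ((X - 1 : ℝ[X]) ^ (n + 1)).coeff n = -(n + 1 : ℝ) := by
    rw [sub_eq_add_neg, ← C_1, ← C_neg, coeff_X_add_C_pow]
    simp
  have hRdeg : R.natDegree ≤ n := by
    rw [natDegree_le_iff_coeff_eq_zero]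
    intro N hN
    rw [hR, coeff_sub, two, coeff_C_mul]
    rcases Nat.lt_or_eq_of_le (Nat.succ_le_of_lt hN) with h1 | h1
    · rw [coeff_eq_zero_of_natDegree_lt (lt_of_le_of_lt (tr_natDegree_le h) h1),
        coeff_eq_zero_of_natDegree_lt (by rw [hdeg1]; exact h1)]; simp
    · rw [← h1]; change _ - 2 * ((X - 1 : ℝ[X]) ^ (n + 1)).coeff (n + 1) = 0
      rw [hc1]; have := tr_coeff_top h; rw [show n.succ = n + 1 from rfl, this]; norm_num
  have hRn : 0 < R.coeff n := by
    rw [hR, coeff_sub, two, coeff_C_mul, hcn]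
    have := tr_coeff_nonneg h n
    have : (0 : ℝ) ≤ n := Nat.cast_nonneg _
    linarith
  set S := R + 4 * (X - 1) ^ (n + 1) with hS
  have hp : p α β = R * S := by rw [p_eq, hS, hR]; ring
  have hRd : R.natDegree = n := le_antisymm hRdeg (le_natDegree_of_ne_zero hRn.ne')
  have four : (4 : ℝ[X]) = C 4 := rfl
  have hS1 : S.coeff (n + 1) = 4 := by
    rw [hS, coeff_add, four, coeff_C_mul, hc1,
      coeff_eq_zero_of_natDegree_lt (by omega : R.natDegree < n + 1)]; norm_num
  have hSdeg : S.natDegree ≤ n + 1 := by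
    rw [hS, four]
    refine natDegree_add_le_of_degree_le (by omega) ?_
    exact (natDegree_C_mul_le _ _).trans hdeg1.le
  have hSd : S.natDegree = n + 1 :=
    le_antisymm hSdeg (le_natDegree_of_ne_zero (by rw [hS1]; norm_num))
  have hR0 : R ≠ 0 := fun h0 => by rw [h0] at hRn; simp at hRn
  have hS0 : S ≠ 0 := fun h0 => by rw [h0] at hS1; simp at hS1
  rw [hp]
  refine ⟨by rw [natDegree_mul hR0 hS0, hRd, hSd]; omega, ?_⟩
  rw [leadingCoeff_mul, leadingCoeff, leadingCoeff, hRd, hSd, hS1]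
  positivity

theorem p_eval_one (hk : 1 ≤ k) :
    (p α β).eval 1 = (tr α β).eval 1 ^ 2 := by
  simp [p_eq, zero_pow (by omega : 2 * k ≠ 0)]

theorem p_deriv_eval_one (hk : 1 ≤ k) :
    (derivative (p α β)).eval 1 = 2 * (tr α β).eval 1 * (derivative (tr α β)).eval 1 := by
  rw [p_eq]
  simp [derivative_pow, zero_pow (by omega : 2 * k - 1 ≠ 0)]

/-- T(0) = 2 gives p(0) = 0, and T'(0) ≥ 0 gives p'(0) = 4T'(0) + 8k > 0. -/
theorem p_rootMultiplicity_zero (hk : 1 ≤ k) (h : LayerShape k 1 (polyPhi α β)) :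
    (p α β).rootMultiplicity 0 = 1 := by
  have hne : p α β ≠ 0 := fun h0 => by
    have := (p_natDegree_leadingCoeff hk h).2; rw [h0] at this; simp at this
  have hT0 : (tr α β).eval 0 = 2 := by rw [← coeff_zero_eq_eval_zero, tr_coeff_zero h]
  have hT1 : 0 ≤ (derivative (tr α β)).eval 0 := by
    rw [← coeff_zero_eq_eval_zero, coeff_derivative]
    simpa using tr_coeff_nonneg h 1
  have h0 : (p α β).IsRoot 0 := by
    simp [p_eq, IsRoot, hT0, pow_mul]; norm_num
  have h1 : ¬ (derivative (p α β)).IsRoot 0 := by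
    have e : ((-1 : ℝ)) ^ (2 * k - 1) = -1 := Odd.neg_one_pow ⟨k - 1, by omega⟩
    have : (1 : ℝ) ≤ k := by exact_mod_cast hk
    simp only [p_eq, IsRoot, derivative_sub, derivative_pow, derivative_mul, eval_sub, eval_mul,
      eval_pow, hT0]
    simp [e]
    nlinarith
  have h2 := (one_lt_rootMultiplicity_iff_isRoot hne (t := 0)).not.2 (fun hh => h1 hh.2)
  have h3 := (rootMultiplicity_pos hne).2 h0
  omega

end

/-! ### Reality of the zeros of the discriminant -/

/-- The Hermitian form `Im (conj u₂ · u₁)`. -/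
noncomputable def herm (u : Fin 2 → ℂ) : ℝ := ((starRingEnd ℂ) (u 1) * u 0).im

/-- A layer with one weight, in the coordinate `t` with `z = -t²`. -/
noncomputable def rot (t : ℂ) (a : ℝ) (u : Fin 2 → ℂ) : Fin 2 → ℂ :=
  ![t * u 0 - a * u 1, u 0 / a + t * u 1]

theorem herm_rot (t : ℂ) {a : ℝ} (ha : 0 < a) (u : Fin 2 → ℂ) :
    herm (rot t a u) = (1 + Complex.normSq t) * herm u +
      t.im * (Complex.normSq (u 0) / a + a * Complex.normSq (u 1)) := by
  have h1 : u 0 / (a : ℂ) = ((a⁻¹ : ℝ) : ℂ) * u 0 := by push_cast; field_simp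
  simp only [herm, rot, Matrix.cons_val_zero, Matrix.cons_val_one, h1, Complex.normSq_apply,
    Complex.mul_im, Complex.mul_re, Complex.add_re, Complex.add_im, Complex.conj_re,
    Complex.conj_im, Complex.sub_re, Complex.sub_im, Complex.ofReal_re, Complex.ofReal_im]
  field_simp
  ring

theorem two_abs_herm_le {a : ℝ} (ha : 0 < a) (u : Fin 2 → ℂ) :
    2 * |herm u| ≤ Complex.normSq (u 0) / a + a * Complex.normSq (u 1) := by
  have h1 : |herm u| ≤ ‖u 1‖ * ‖u 0‖ := by
    refine (Complex.abs_im_le_norm _).trans ?_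
    rw [norm_mul, RCLike.norm_conj]
  rw [← Complex.sq_norm, ← Complex.sq_norm]
  have h2 : ‖u 0‖ ^ 2 / a + a * ‖u 1‖ ^ 2 - 2 * (‖u 1‖ * ‖u 0‖) =
      (‖u 0‖ - a * ‖u 1‖) ^ 2 / a := by
    field_simp; ring
  have : 0 ≤ (‖u 0‖ - a * ‖u 1‖) ^ 2 / a := by positivity
  linarith

/-- |t² + 1|² = |t - i|² |t + i|², and 1 + |t|² ∓ 2 Im t are the two factors; the smaller one lies
below their geometric mean. -/
theorem norm_lt_of_im_pos {t : ℂ} (ht : 0 < t.im) (h1 : t ^ 2 + 1 ≠ 0) :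
    |1 + Complex.normSq t - 2 * t.im| < ‖t ^ 2 + 1‖ := by
  have e : ‖t ^ 2 + 1‖ ^ 2 =
      (1 + Complex.normSq t - 2 * t.im) * (1 + Complex.normSq t + 2 * t.im) := by
    rw [Complex.sq_norm, Complex.normSq_apply, Complex.normSq_apply, pow_two]
    simp only [Complex.add_re, Complex.add_im, Complex.mul_re, Complex.mul_im, Complex.one_re,
      Complex.one_im]
    ring
  have h2 : 0 < ‖t ^ 2 + 1‖ := norm_pos_iff.2 h1
  have h3 : 0 < 1 + Complex.normSq t + 2 * t.im := by
    have := Complex.normSq_nonneg t; linarith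
  have h4 : 0 < 1 + Complex.normSq t - 2 * t.im := by
    by_contra hc
    nlinarith [sq_nonneg ‖t ^ 2 + 1‖, pow_pos h2 2]
  rw [abs_of_pos h4]
  refine lt_of_pow_lt_pow_left₀ 2 h2.le ?_
  rw [e]
  nlinarith

theorem norm_le_one_add_normSq (t : ℂ) : ‖t ^ 2 + 1‖ ≤ 1 + Complex.normSq t := by
  refine (norm_add_le _ _).trans ?_
  rw [norm_pow, Complex.sq_norm, norm_one, add_comm]

/-- For a nonnegative form the coefficient 1 + |t|² in `herm_rot` already suffices. For a negative
one the extra term, bounded by `two_abs_herm_le`, lowers the coefficient to 1 + |t|² - 2 Im t, which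
is smaller than |t² + 1|. -/
theorem herm_rot_ge {t : ℂ} (ht : 0 < t.im) (h1 : t ^ 2 + 1 ≠ 0) {a : ℝ} (ha : 0 < a)
    (u : Fin 2 → ℂ) : ‖t ^ 2 + 1‖ * herm u ≤ herm (rot t a u) := by
  rw [herm_rot t ha]
  have h2 := two_abs_herm_le ha u
  have h3 := (abs_lt.1 (norm_lt_of_im_pos ht h1)).2
  have h4 := norm_le_one_add_normSq t
  have h5 := mul_le_mul_of_nonneg_left h2 ht.le
  rcases le_total 0 (herm u) with h | h
  · have := mul_le_mul_of_nonneg_right h4 h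
    have : 0 ≤ t.im * (2 * |herm u|) := by positivity
    linarith
  · rw [abs_of_nonpos h] at h5
    nlinarith [mul_le_mul_of_nonpos_right h3.le h]

theorem herm_rot_gt {t : ℂ} (ht : 0 < t.im) (h1 : t ^ 2 + 1 ≠ 0) {a : ℝ} (ha : 0 < a)
    {u : Fin 2 → ℂ} (hu : u ≠ 0) : ‖t ^ 2 + 1‖ * herm u < herm (rot t a u) := by
  rw [herm_rot t ha]
  have h2 := two_abs_herm_le ha u
  have h3 := (abs_lt.1 (norm_lt_of_im_pos ht h1)).2
  have h4 := norm_le_one_add_normSq t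
  have h6 : 0 < Complex.normSq (u 0) / a + a * Complex.normSq (u 1) := by
    have h0 := Complex.normSq_nonneg (u 0)
    have h1 := Complex.normSq_nonneg (u 1)
    by_cases h : u 0 = 0
    · have : u 1 ≠ 0 := fun h' => hu (by ext i; fin_cases i <;> simp [h, h'])
      have := Complex.normSq_pos.2 this
      positivity
    · have := Complex.normSq_pos.2 h
      positivity
  rcases le_or_gt 0 (herm u) with h | h
  · have := mul_le_mul_of_nonneg_right h4 h
    have : 0 < t.im * (Complex.normSq (u 0) / a + a * Complex.normSq (u 1)) := by positivity
    linarith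
  · have h5 := mul_le_mul_of_nonneg_left h2 ht.le
    rw [abs_of_neg h] at h5
    nlinarith [mul_lt_mul_of_neg_right h3 h]

/-- Passing to the coordinate in which `herm` is monotone. -/
noncomputable def twist (t : ℂ) (v : Fin 2 → ℂ) : Fin 2 → ℂ := ![t * v 0, v 1]

/-- At z = -t², conjugation by diag(t, 1) splits a layer, up to sign, into two one-weight factors of
determinant t² + 1, to each of which `herm_rot_ge` applies. -/
theorem twist_layer {t : ℂ} {a b : ℝ} (ha : 0 < a) (hb : 0 < b)
    (v : Fin 2 → ℂ) :
    twist t (((layer a b).map (aeval (-t ^ 2) : ℝ[X] →ₐ[ℝ] ℂ)).mulVec v) =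
      -rot t a (rot t b (twist t v)) := by
  have ha' : (a : ℂ) ≠ 0 := by exact_mod_cast ha.ne'
  have hb' : (b : ℂ) ≠ 0 := by exact_mod_cast hb.ne'
  ext i
  fin_cases i
  · simp [twist, rot, layer, Matrix.mulVec, dotProduct, Fin.sum_univ_two]
    field_simp; ring
  · simp [twist, rot, layer, Matrix.mulVec, dotProduct, Fin.sum_univ_two]
    field_simp; ring

theorem herm_neg (u : Fin 2 → ℂ) : herm (-u) = herm u := by simp [herm]

theorem herm_smul (c : ℂ) (u : Fin 2 → ℂ) : herm (c • u) = Complex.normSq c * herm u := by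
  simp [herm, Complex.normSq_apply]; ring

/-- Strictness comes from the innermost layer, which acts on the given nonzero vector. The outer
layers need only the weak inequality, so nothing has to be known about the intermediate vectors. -/
theorem herm_list {t : ℂ} (ht : 0 < t.im) (h1 : t ^ 2 + 1 ≠ 0) {ι : Type*} (a b : ι → ℝ)
    (ha : ∀ i, 0 < a i) (hb : ∀ i, 0 < b i) (v : Fin 2 → ℂ) (L : List ι) :
    (‖t ^ 2 + 1‖ ^ 2) ^ L.length * herm (twist t v) ≤
      herm (twist t ((((L.map fun i => layer (a i) (b i)).prod).map
        (aeval (-t ^ 2) : ℝ[X] →ₐ[ℝ] ℂ)).mulVec v)) ∧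
    (twist t v ≠ 0 → L ≠ [] → (‖t ^ 2 + 1‖ ^ 2) ^ L.length * herm (twist t v) <
      herm (twist t ((((L.map fun i => layer (a i) (b i)).prod).map
        (aeval (-t ^ 2) : ℝ[X] →ₐ[ℝ] ℂ)).mulVec v))) := by
  have hn : 0 < ‖t ^ 2 + 1‖ := norm_pos_iff.2 h1
  induction L with
  | nil => simp
  | cons i L ih =>
    rw [List.map_cons, List.prod_cons, Matrix.map_mul, ← Matrix.mulVec_mulVec,
      twist_layer (ha i) (hb i), herm_neg, List.length_cons, pow_succ']
    set w := twist t ((((L.map fun i => layer (a i) (b i)).prod).map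
        (aeval (-t ^ 2) : ℝ[X] →ₐ[ℝ] ℂ)).mulVec v) with hw
    have e1 : ‖t ^ 2 + 1‖ ^ 2 * herm w ≤ herm (rot t (a i) (rot t (b i) w)) := by
      refine le_trans ?_ (herm_rot_ge ht h1 (ha i) _)
      rw [pow_two, mul_assoc]
      exact mul_le_mul_of_nonneg_left (herm_rot_ge ht h1 (hb i) _) hn.le
    refine ⟨?_, fun hv _ => ?_⟩
    · refine le_trans ?_ e1
      rw [mul_assoc]
      exact mul_le_mul_of_nonneg_left ih.1 (by positivity)
    · by_cases hL : L = []
      · have hwv : w = twist t v := by rw [hw, hL]; simp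
        rw [hL, hwv, List.length_nil, pow_zero, mul_one]
        refine lt_of_lt_of_le ?_ (herm_rot_ge ht h1 (ha i) _)
        rw [pow_two, mul_assoc]
        exact mul_lt_mul_of_pos_left (herm_rot_gt ht h1 (hb i) hv) hn
      · refine lt_of_lt_of_le ?_ e1
        rw [mul_assoc]
        exact mul_lt_mul_of_pos_left (ih.2 hv hL) (by positivity)

section
variable {k : ℕ} {α β : Fin k → ℝ}

/-- The discriminant has only real non-positive zeros. -/
theorem p_root_real (hk : 1 ≤ k) (hα : ∀ m, 0 < α m) (hβ : ∀ m, 0 < β m)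
    (h : LayerShape k 1 (polyPhi α β)) {z : ℂ} (hz : aeval z (p α β) = 0) :
    ∃ x : ℝ, x ≤ 0 ∧ z = x := by
  by_contra hcon
  have hz1 : z ≠ 1 := by
    rintro rfl
    have e : aeval (1 : ℂ) (p α β) = (((p α β).eval 1 : ℝ) : ℂ) := by
      rw [← Complex.ofReal_one, ← Complex.coe_algebraMap, aeval_algebraMap_apply]; simp
    rw [e, p_eval_one hk] at hz
    have := tr_one_pos h
    norm_cast at hz
    exact (pow_pos this 2).ne' hz
  -- A real square root of -z would make z real and nonpositive; otherwise one of the two roots lies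
  -- in the upper half plane.
  obtain ⟨t, ht, rfl⟩ : ∃ t : ℂ, 0 < t.im ∧ z = -t ^ 2 := by
    obtain ⟨s, hs⟩ : ∃ s : ℂ, -z = s ^ 2 := by
      obtain ⟨s, hs⟩ := IsAlgClosed.exists_pow_nat_eq (-z) (n := 2) (by norm_num)
      exact ⟨s, hs.symm⟩
    have hzs : z = -s ^ 2 := by rw [← hs, neg_neg]
    rcases lt_trichotomy s.im 0 with h0 | h0 | h0
    · exact ⟨-s, by simpa using h0, by rw [hzs]; ring⟩
    · refine (hcon ⟨-s.re ^ 2, by nlinarith [sq_nonneg s.re], ?_⟩).elim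
      rw [hzs]
      conv_lhs => rw [← Complex.re_add_im s, h0]
      push_cast; ring
    · exact ⟨s, h0, hzs⟩
  have h1 : t ^ 2 + 1 ≠ 0 := fun h0 => hz1 (by linear_combination -h0)
  have ht0 : t ≠ 0 := by rintro rfl; simp at ht
  set M := (polyPhi α β).map (aeval (-t ^ 2) : ℝ[X] →ₐ[ℝ] ℂ) with hM
  have hdet : M.det = (-(t ^ 2 + 1)) ^ (2 * k) := by
    have := congrArg (aeval (-t ^ 2) : ℝ[X] →ₐ[ℝ] ℂ) h.det_eq
    rw [AlgHom.map_det] at this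
    rw [hM, ← AlgHom.mapMatrix_apply, this]
    simp; ring
  have htr : M.trace = aeval (-t ^ 2) (tr α β) := by
    rw [tr_eq, Matrix.trace_fin_two, hM]; simp
  have hsq : M.trace ^ 2 = 4 * ((-(t ^ 2 + 1)) ^ k) ^ 2 := by
    rw [p_eq] at hz
    simp only [map_sub, map_mul, map_pow, ← htr, aeval_X, map_one] at hz
    have h4 : aeval (-t ^ 2) (4 : ℝ[X]) = (4 : ℂ) := map_ofNat _ 4
    rw [h4] at hz
    rw [← pow_mul, mul_comm k 2]
    linear_combination hz
  -- an eigenvalue of modulus `|z - 1|ᵏ`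
  obtain ⟨d, hd, hdn⟩ : ∃ d : ℂ, M.trace = 2 * d ∧ d ^ 2 = ((-(t ^ 2 + 1)) ^ k) ^ 2 :=
    ⟨M.trace / 2, by ring, by rw [div_pow, hsq]; ring⟩
  -- At a zero of p the squared trace is four times the determinant, so half the trace is a double
  -- eigenvalue.
  have hsing : (M - d • 1).det = 0 := by
    rw [Matrix.det_fin_two] at hdet ⊢
    rw [Matrix.trace_fin_two] at hd
    simp
    rw [mul_comm 2 k, pow_mul, ← hdn] at hdet
    linear_combination hdet - d * hd
  obtain ⟨v, hv, hMv⟩ := Matrix.exists_mulVec_eq_zero_iff.2 hsing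
  have hev : M.mulVec v = d • v := by
    rw [Matrix.sub_mulVec, Matrix.smul_mulVec, Matrix.one_mulVec, sub_eq_zero] at hMv
    exact hMv
  have htw : twist t v ≠ 0 := by
    intro h0
    apply hv
    have e0 := congrFun h0 0
    have e1 := congrFun h0 1
    simp [twist, ht0] at e0 e1
    ext i; fin_cases i <;> simp [e0, e1]
  -- On an eigenvector the form is multiplied by exactly |d|² = |t² + 1|²ᵏ, against the strict
  -- inequality.
  have key := (herm_list ht h1 α β hα hβ v (List.finRange k)).2 htw (by
    rw [Ne, ← List.length_eq_zero_iff, List.length_finRange]; omega)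
  rw [← polyPhi_eq, ← hM, hev, List.length_finRange] at key
  have e2 : twist t (d • v) = d • twist t v := by
    ext i; fin_cases i <;> simp [twist]; ring
  have e3 : Complex.normSq d = (‖t ^ 2 + 1‖ ^ 2) ^ k := by
    have := congrArg norm hdn
    rw [norm_pow, norm_pow, norm_pow, norm_neg, Complex.sq_norm] at this
    rw [this, ← pow_mul, ← pow_mul, mul_comm]
  rw [e2, herm_smul, e3] at key
  exact lt_irrefl _ key

end

/-! ### Gaps and the reduced data of the curve -/

/-- Disjoint intervals `[lo l, hi l]`, `1 ≤ l ≤ g`, in the negative half line, ordered from right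
to left, and a positive number: the data of `p₁ = p₀ / z`. -/
structure GapData where
  g : ℕ
  lo : ℕ → ℝ
  hi : ℕ → ℝ
  lead : ℝ
  lead_pos : 0 < lead
  lo_lt_hi : ∀ l ∈ Finset.Icc 1 g, lo l < hi l
  hi_neg : ∀ l ∈ Finset.Icc 1 g, hi l < 0
  disj : ∀ l ∈ Finset.Icc 1 g, ∀ j ∈ Finset.Icc 1 g, l < j → hi j < lo l

namespace GapData
variable (D : GapData)

/-- The polynomial `p₁ = p₀ / z`. -/
noncomputable def p1 : ℝ[X] :=
  C D.lead * ∏ l ∈ Finset.Icc 1 D.g, ((X - C (D.lo l)) * (X - C (D.hi l)))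

theorem p1_eval (t : ℝ) :
    D.p1.eval t = D.lead * ∏ l ∈ Finset.Icc 1 D.g, ((t - D.lo l) * (t - D.hi l)) := by
  simp [p1, eval_prod]

theorem p1_natDegree : D.p1.natDegree = 2 * D.g := by
  rw [p1, natDegree_C_mul D.lead_pos.ne', natDegree_prod_of_monic]
  · simp [Finset.sum_congr rfl fun l _ =>
      (natDegree_mul (X_sub_C_ne_zero (D.lo l)) (X_sub_C_ne_zero (D.hi l)))]
    ring
  · exact fun l _ => (monic_X_sub_C _).mul (monic_X_sub_C _)

theorem p1_leadingCoeff : D.p1.leadingCoeff = D.lead := by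
  rw [p1, leadingCoeff_mul, leadingCoeff_C, Monic.leadingCoeff, mul_one]
  exact monic_prod_of_monic _ _ fun l _ => (monic_X_sub_C _).mul (monic_X_sub_C _)

theorem p1_ne_zero : D.p1 ≠ 0 := fun h => by
  have := D.p1_leadingCoeff; rw [h, leadingCoeff_zero] at this; exact D.lead_pos.ne this

theorem gap_sep {l j : ℕ} (hl : l ∈ Finset.Icc 1 D.g) (hj : j ∈ Finset.Icc 1 D.g) (h : l ≠ j)
    {t : ℝ} (ht : t ∈ Set.Icc (D.lo l) (D.hi l)) : t ∉ Set.Icc (D.lo j) (D.hi j) := by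
  intro h'
  rcases lt_or_gt_of_ne h with h1 | h1
  · have := D.disj l hl j hj h1; linarith [ht.1, h'.2]
  · have := D.disj j hj l hl h1; linarith [ht.2, h'.1]

theorem factor_pos {l : ℕ} (hl : l ∈ Finset.Icc 1 D.g) {t : ℝ}
    (ht : t ∉ Set.Icc (D.lo l) (D.hi l)) : 0 < (t - D.lo l) * (t - D.hi l) := by
  have := D.lo_lt_hi l hl
  rw [Set.mem_Icc, not_and_or, not_le, not_le] at ht
  rcases ht with h | h
  · nlinarith
  · nlinarith

theorem p1_pos {t : ℝ} (ht : ∀ l ∈ Finset.Icc 1 D.g, t ∉ Set.Icc (D.lo l) (D.hi l)) :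
    0 < D.p1.eval t := by
  rw [p1_eval]
  exact mul_pos D.lead_pos (Finset.prod_pos fun l hl => D.factor_pos hl (ht l hl))

theorem p1_pos_of_nonneg {t : ℝ} (ht : 0 ≤ t) : 0 < D.p1.eval t :=
  D.p1_pos fun l hl h => by linarith [D.hi_neg l hl, h.2]

theorem p1_neg {l : ℕ} (hl : l ∈ Finset.Icc 1 D.g) {t : ℝ}
    (ht : t ∈ Set.Ioo (D.lo l) (D.hi l)) : D.p1.eval t < 0 := by
  rw [p1_eval, ← Finset.mul_prod_erase _ _ hl]
  refine mul_neg_of_pos_of_neg D.lead_pos (mul_neg_of_neg_of_pos ?_ ?_)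
  · exact mul_neg_of_pos_of_neg (sub_pos.2 ht.1) (sub_neg.2 ht.2)
  · exact Finset.prod_pos fun j hj => D.factor_pos (Finset.mem_of_mem_erase hj)
      (D.gap_sep hl (Finset.mem_of_mem_erase hj) (Finset.ne_of_mem_erase hj).symm
        (Set.Ioo_subset_Icc_self ht))

theorem p1_lo {l : ℕ} (hl : l ∈ Finset.Icc 1 D.g) : D.p1.eval (D.lo l) = 0 := by
  rw [p1_eval, Finset.prod_eq_zero hl (by simp), mul_zero]

theorem p1_hi {l : ℕ} (hl : l ∈ Finset.Icc 1 D.g) : D.p1.eval (D.hi l) = 0 := by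
  rw [p1_eval, Finset.prod_eq_zero hl (by simp), mul_zero]

end GapData

/-- The reduced data of the critical point equation: the polynomial `p₁`, the polynomial `n₀` with
one zero in each gap, and the tangency point `estar` on the vertical sides of the square. -/
structure GapModel extends GapData where
  κ : ℝ
  κ_pos : 0 < κ
  nlead : ℝ
  nlead_ne : nlead ≠ 0
  c : ℕ → ℝ
  c_mem : ∀ l ∈ Finset.Icc 1 g, c l ∈ Set.Ioo (lo l) (hi l)
  estar : ℝ
  estar_mem : estar ∈ Set.Ioo (-1 : ℝ) 1
  at_one : κ ^ 2 * toGapData.p1.eval 1 =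
    (C nlead * ∏ l ∈ Finset.Icc 1 g, (X - C (c l))).eval 1 ^ 2
  deriv_one : (derivative ((C κ * (C (estar - 1) * X - C (estar + 1))) ^ 2 * toGapData.p1
    - C 4 * X * (C nlead * ∏ l ∈ Finset.Icc 1 g, (X - C (c l))) ^ 2)).eval 1 = 0

namespace GapModel
variable (M : GapModel)

/-- The polynomial `n₀`. -/
noncomputable def n0 : ℝ[X] := C M.nlead * ∏ l ∈ Finset.Icc 1 M.g, (X - C (M.c l))

theorem n0_eval (t : ℝ) : M.n0.eval t = M.nlead * ∏ l ∈ Finset.Icc 1 M.g, (t - M.c l) := by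
  simp [n0, eval_prod]

theorem n0_natDegree : M.n0.natDegree = M.g := by
  rw [n0, natDegree_C_mul M.nlead_ne, natDegree_prod_of_monic]
  · simp
  · exact fun l _ => monic_X_sub_C _

theorem n0_ne_zero_eval {t : ℝ} (ht : ∀ l ∈ Finset.Icc 1 M.g, t ∉ Set.Ioo (M.lo l) (M.hi l)) :
    M.n0.eval t ≠ 0 := by
  rw [n0_eval]
  refine mul_ne_zero M.nlead_ne (Finset.prod_ne_zero_iff.2 fun l hl h => ht l hl ?_)
  rw [sub_eq_zero.1 h]; exact M.c_mem l hl

theorem n0_eval_nonneg_ne {t : ℝ} (ht : 0 ≤ t) : M.n0.eval t ≠ 0 :=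
  M.n0_ne_zero_eval fun l hl h => by linarith [M.hi_neg l hl, h.2]

theorem n0_eq_zero_iff {l : ℕ} (hl : l ∈ Finset.Icc 1 M.g) {t : ℝ}
    (ht : t ∈ Set.Icc (M.lo l) (M.hi l)) : M.n0.eval t = 0 ↔ t = M.c l := by
  rw [n0_eval, mul_eq_zero, or_iff_right M.nlead_ne, Finset.prod_eq_zero_iff]
  constructor
  · rintro ⟨j, hj, h⟩
    by_cases hlj : l = j
    · rw [hlj]; exact sub_eq_zero.1 h
    · refine (M.gap_sep hl hj hlj ht ?_).elim
      rw [sub_eq_zero.1 h]; exact Set.Ioo_subset_Icc_self (M.c_mem j hj)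
  · rintro rfl; exact ⟨l, hl, sub_self _⟩

/-- Only the factor belonging to `c l` changes sign between the two ends; the other zeros lie in
gaps entirely to one side. -/
theorem n0_ends {l : ℕ} (hl : l ∈ Finset.Icc 1 M.g) :
    M.n0.eval (M.lo l) * M.n0.eval (M.hi l) < 0 := by
  have e : M.n0.eval (M.lo l) * M.n0.eval (M.hi l) =
      M.nlead ^ 2 * ∏ j ∈ Finset.Icc 1 M.g, ((M.lo l - M.c j) * (M.hi l - M.c j)) := by
    rw [n0_eval, n0_eval, Finset.prod_mul_distrib]; ring
  rw [e, ← Finset.mul_prod_erase _ _ hl]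
  have h1 := M.c_mem l hl
  have h0 : 0 < M.nlead ^ 2 := by have := M.nlead_ne; positivity
  refine mul_neg_of_pos_of_neg h0 (mul_neg_of_neg_of_pos ?_ (Finset.prod_pos fun j hj => ?_))
  · exact mul_neg_of_neg_of_pos (sub_neg.2 h1.1) (sub_pos.2 h1.2)
  · have hj' := Finset.mem_of_mem_erase hj
    have h2 := M.c_mem j hj'
    have h3 := M.lo_lt_hi l hl
    rcases lt_or_gt_of_ne (Finset.ne_of_mem_erase hj) with h | h
    · have := M.disj j hj' l hl h
      exact mul_pos_of_neg_of_neg (by linarith [h2.1]) (by linarith [h2.1])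
    · have := M.disj l hl j hj' h
      exact mul_pos (by linarith [h2.2]) (by linarith [h2.2])

end GapModel

/-! ### The square-free part of the discriminant -/

section
variable {k : ℕ} {α β : Fin k → ℝ}

theorem p_ne_zero (hk : 1 ≤ k) (h : LayerShape k 1 (polyPhi α β)) : p α β ≠ 0 := fun h0 => by
  have := (p_natDegree_leadingCoeff hk h).2; rw [h0] at this; simp at this

theorem p_splits (hk : 1 ≤ k) (hα : ∀ m, 0 < α m) (hβ : ∀ m, 0 < β m)
    (h : LayerShape k 1 (polyPhi α β)) : (p α β).Splits := by
  refine Splits.of_splits_map_of_injective (i := algebraMap ℝ ℂ) (algebraMap ℝ ℂ).injective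
    (IsAlgClosed.splits _) fun z hz => ?_
  obtain ⟨x, -, hx⟩ := p_root_real hk hα hβ h (z := z) (by
    have := (mem_roots'.1 hz).2; rwa [IsRoot, eval_map_algebraMap] at this)
  exact ⟨x, hx.symm⟩

theorem p0_ne_zero (hk : 1 ≤ k) (h : LayerShape k 1 (polyPhi α β)) : p0 α β ≠ 0 := fun h0 =>
  p_ne_zero hk h (by rw [← q_sq_mul_p0, h0, mul_zero])

theorem p0_dvd_p : p0 α β ∣ p α β := ⟨q α β ^ 2, by rw [← q_sq_mul_p0]; ring⟩

theorem p0_splits (hk : 1 ≤ k) (hα : ∀ m, 0 < α m) (hβ : ∀ m, 0 < β m)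
    (h : LayerShape k 1 (polyPhi α β)) : (p0 α β).Splits :=
  (p_splits hk hα hβ h).of_dvd (p_ne_zero hk h) p0_dvd_p

theorem le_rootMultiplicity_q (r : ℝ) :
    (p α β).rootMultiplicity r / 2 ≤ (q α β).rootMultiplicity r := by
  by_cases hr : r ∈ (p α β).roots.toFinset
  · rw [le_rootMultiplicity_iff (q_monic α β).ne_zero, q]
    exact Finset.dvd_prod_of_mem (fun r => (X - C r) ^ ((p α β).rootMultiplicity r / 2)) hr
  · rw [Multiset.mem_toFinset, ← Multiset.count_eq_zero, count_roots] at hr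
    simp [hr]

theorem rootMultiplicity_p (hk : 1 ≤ k) (h : LayerShape k 1 (polyPhi α β)) (r : ℝ) :
    (p α β).rootMultiplicity r =
      2 * (q α β).rootMultiplicity r + (p0 α β).rootMultiplicity r := by
  have hne := p_ne_zero hk h
  have e : p α β = q α β * (q α β * p0 α β) := by rw [← q_sq_mul_p0]; ring
  have hne' : q α β * p0 α β ≠ 0 := right_ne_zero_of_mul (e ▸ hne)
  conv_lhs => rw [e]
  rw [rootMultiplicity_mul (e ▸ hne), rootMultiplicity_mul hne']
  ring

/-- Removing q² from a zero of multiplicity n leaves at most n - 2⌊n/2⌋ ≤ 1. -/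
theorem p0_roots_nodup (hk : 1 ≤ k) (h : LayerShape k 1 (polyPhi α β)) :
    (p0 α β).roots.Nodup := by
  rw [Multiset.nodup_iff_count_le_one]
  intro r
  rw [count_roots]
  have := rootMultiplicity_p hk h r
  have := le_rootMultiplicity_q (α := α) (β := β) r
  omega

theorem zero_mem_p0_roots (hk : 1 ≤ k) (h : LayerShape k 1 (polyPhi α β)) :
    (0 : ℝ) ∈ (p0 α β).roots := by
  rw [← Multiset.count_pos, count_roots]
  have := rootMultiplicity_p hk h 0
  have := p_rootMultiplicity_zero hk h
  omega

theorem p0_root_nonpos (hk : 1 ≤ k) (hα : ∀ m, 0 < α m) (hβ : ∀ m, 0 < β m)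
    (h : LayerShape k 1 (polyPhi α β)) {r : ℝ} (hr : r ∈ (p0 α β).roots) : r ≤ 0 := by
  have h1 : (p α β).eval r = 0 := by
    rw [← q_sq_mul_p0, eval_mul, (mem_roots'.1 hr).2, mul_zero]
  obtain ⟨x, hx, e⟩ := p_root_real hk hα hβ h (z := r) (by
    rw [← Complex.coe_algebraMap, aeval_algebraMap_apply]; simp [h1])
  rw [Complex.ofReal_inj.1 e]; exact hx

theorem p_natDegree_eq (hk : 1 ≤ k) (h : LayerShape k 1 (polyPhi α β)) :
    2 * (q α β).natDegree + (p0 α β).natDegree = 2 * k - 1 := by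
  rw [← (p_natDegree_leadingCoeff hk h).1, ← q_sq_mul_p0,
    natDegree_mul (pow_ne_zero _ (q_monic α β).ne_zero) (p0_ne_zero hk h), natDegree_pow]

theorem p0_natDegree (hk : 1 ≤ k) (h : LayerShape k 1 (polyPhi α β)) :
    (p0 α β).natDegree = 2 * (kPrime α β - 1) + 1 := by
  have := p_natDegree_eq hk h
  rw [kPrime]; omega

theorem p0_leadingCoeff_pos (hk : 1 ≤ k) (h : LayerShape k 1 (polyPhi α β)) :
    0 < (p0 α β).leadingCoeff := by
  have := (p_natDegree_leadingCoeff hk h).2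
  rwa [← q_sq_mul_p0, leadingCoeff_mul, ((q_monic α β).pow 2).leadingCoeff, one_mul] at this

/-- The sorted list of zeros of `p₀`. -/
noncomputable def rootList (α β : Fin k → ℝ) : List ℝ := (p0 α β).roots.sort (· ≥ ·)

theorem x_eq (l : ℕ) : x α β l = (rootList α β).getD l 0 := rfl

theorem rootList_coe : (rootList α β : Multiset ℝ) = (p0 α β).roots := Multiset.sort_eq _ _

theorem rootList_length (hk : 1 ≤ k) (hα : ∀ m, 0 < α m) (hβ : ∀ m, 0 < β m)
    (h : LayerShape k 1 (polyPhi α β)) :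
    (rootList α β).length = 2 * (kPrime α β - 1) + 1 := by
  rw [← p0_natDegree hk h, (p0_splits hk hα hβ h).natDegree_eq_card_roots, ← rootList_coe]; rfl

theorem rootList_pairwise (hk : 1 ≤ k) (h : LayerShape k 1 (polyPhi α β)) :
    (rootList α β).Pairwise (· > ·) := by
  have h1 : (rootList α β).Pairwise (· ≥ ·) := Multiset.pairwise_sort _ _
  have h2 : (rootList α β).Nodup := by
    rw [← Multiset.coe_nodup, rootList_coe]; exact p0_roots_nodup hk h
  exact (h1.and h2).imp fun hab => lt_of_le_of_ne hab.1 (Ne.symm hab.2)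

theorem x_lt (hk : 1 ≤ k) (hα : ∀ m, 0 < α m) (hβ : ∀ m, 0 < β m)
    (h : LayerShape k 1 (polyPhi α β)) {i j : ℕ} (hij : i < j) (hj : j ≤ 2 * (kPrime α β - 1)) :
    x α β j < x α β i := by
  have hl := rootList_length hk hα hβ h
  rw [x_eq, x_eq, List.getD_eq_getElem _ _ (by omega), List.getD_eq_getElem _ _ (by omega)]
  exact List.pairwise_iff_getElem.1 (rootList_pairwise hk h) i j (by omega) (by omega) hij

theorem x_mem_roots (hk : 1 ≤ k) (hα : ∀ m, 0 < α m) (hβ : ∀ m, 0 < β m)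
    (h : LayerShape k 1 (polyPhi α β)) {j : ℕ} (hj : j ≤ 2 * (kPrime α β - 1)) :
    x α β j ∈ (p0 α β).roots := by
  have hl := rootList_length hk hα hβ h
  rw [x_eq, List.getD_eq_getElem _ _ (by omega), ← rootList_coe]
  exact List.getElem_mem _

theorem x_zero (hk : 1 ≤ k) (hα : ∀ m, 0 < α m) (hβ : ∀ m, 0 < β m)
    (h : LayerShape k 1 (polyPhi α β)) : x α β 0 = 0 := by
  have hl := rootList_length hk hα hβ h
  have h0 : (0 : ℝ) ∈ rootList α β := by
    rw [← Multiset.mem_coe, rootList_coe]; exact zero_mem_p0_roots hk h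
  obtain ⟨i, hi, e⟩ := List.mem_iff_getElem.1 h0
  have e' : x α β i = 0 := by rw [x_eq, List.getD_eq_getElem _ _ hi, e]
  rcases Nat.eq_zero_or_pos i with rfl | hpos
  · exact e'
  · have := x_lt hk hα hβ h hpos (by omega)
    have := p0_root_nonpos hk hα hβ h (x_mem_roots hk hα hβ h (j := 0) (by omega))
    linarith

theorem p0_eq_prod (hk : 1 ≤ k) (hα : ∀ m, 0 < α m) (hβ : ∀ m, 0 < β m)
    (h : LayerShape k 1 (polyPhi α β)) : p0 α β = X * (C (p0 α β).leadingCoeff *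
      ∏ l ∈ Finset.Icc 1 (kPrime α β - 1), ((X - C (x α β (2 * l))) *
        (X - C (x α β (2 * l - 1))))) := by
  have e1 : ((p0 α β).roots.map fun r => X - C r).prod =
      ∏ j ∈ Finset.range (2 * (kPrime α β - 1) + 1), (X - C (x α β j)) := by
    rw [← rootList_coe, Multiset.map_coe, Multiset.prod_coe, ← rootList_length hk hα hβ h,
      Finset.prod_range, ← List.prod_ofFn]
    congr 1
    rw [← List.ofFn_getElem (xs := (rootList α β).map _)]
    apply List.ext_getElem
    · simp
    · intro i h1 h2
      simp at h1
      simp [x_eq]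
  have e2 : ∀ g : ℕ, ∏ j ∈ Finset.range (2 * g + 1), (X - C (x α β j)) = (X - C (x α β 0)) *
      ∏ l ∈ Finset.Icc 1 g, ((X - C (x α β (2 * l))) * (X - C (x α β (2 * l - 1)))) := by
    intro g
    induction g with
    | zero => simp
    | succ g ih =>
      rw [show 2 * (g + 1) + 1 = (2 * g + 1) + 1 + 1 by ring, Finset.prod_range_succ,
        Finset.prod_range_succ, ih, Finset.prod_Icc_succ_top (by omega)]
      rw [show 2 * (g + 1) - 1 = 2 * g + 1 by omega, show 2 * (g + 1) = 2 * g + 1 + 1 by ring]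
      ring
  conv_lhs => rw [(p0_splits hk hα hβ h).eq_prod_roots, e1, e2, x_zero hk hα hβ h]
  rw [C_0]; ring

/-- The gaps between the zeros of `p₀`. -/
noncomputable def gapData (hk : 1 ≤ k) (hα : ∀ m, 0 < α m) (hβ : ∀ m, 0 < β m)
    (h : LayerShape k 1 (polyPhi α β)) : GapData where
  g := kPrime α β - 1
  lo l := x α β (2 * l)
  hi l := x α β (2 * l - 1)
  lead := (p0 α β).leadingCoeff
  lead_pos := p0_leadingCoeff_pos hk h
  lo_lt_hi l hl := by
    rw [Finset.mem_Icc] at hl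
    exact x_lt hk hα hβ h (by omega) (by omega)
  hi_neg l hl := by
    rw [Finset.mem_Icc] at hl
    rw [← x_zero hk hα hβ h]
    exact x_lt hk hα hβ h (by omega) (by omega)
  disj l hl j hj hlj := by
    rw [Finset.mem_Icc] at hl hj
    exact x_lt hk hα hβ h (by omega) (by omega)

theorem p0_eq_X_mul (hk : 1 ≤ k) (hα : ∀ m, 0 < α m) (hβ : ∀ m, 0 < β m)
    (h : LayerShape k 1 (polyPhi α β)) : p0 α β = X * (gapData hk hα hβ h).p1 :=
  p0_eq_prod hk hα hβ h

/-! ### The numerator of the logarithmic derivative of `ρ` -/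

/-- The polynomial `T' (z - 1) - k T`. -/
noncomputable def trNum (α β : Fin k → ℝ) : ℝ[X] :=
  derivative (tr α β) * (X - 1) - C (k : ℝ) * tr α β

/-- The coefficient of zᵏ is k T_k - k T_k = 0. -/
theorem trNum_natDegree_le (hk : 1 ≤ k) (h : LayerShape k 1 (polyPhi α β)) :
    (trNum α β).natDegree ≤ k - 1 := by
  rw [natDegree_le_iff_coeff_eq_zero]
  intro N hN
  obtain ⟨j, rfl⟩ : ∃ j, N = j + 1 := ⟨N - 1, by omega⟩
  have z : ∀ m, k < m → (tr α β).coeff m = 0 := fun m hm =>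
    coeff_eq_zero_of_natDegree_lt (lt_of_le_of_lt (tr_natDegree_le h) hm)
  rw [trNum, mul_sub, mul_one, coeff_sub, coeff_sub, coeff_mul_X, coeff_C_mul, coeff_derivative,
    coeff_derivative, z (j + 1 + 1) (by omega)]
  rcases Nat.lt_or_eq_of_le (show k ≤ j + 1 by omega) with h1 | h1
  · rw [z _ h1]; ring
  · have : (k : ℝ) = j + 1 := by rw [h1]; push_cast; ring
    rw [this]; ring

theorem trNum_eval_one : (trNum α β).eval 1 = -k * (tr α β).eval 1 := by
  simp [trNum]

/-- The operator f ↦ f'(z - 1) - m f is differentiation of f/(z - 1)ᵐ, up to a power of z - 1. For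
constant f here it annihilates the multiples of (z - 1)ᵐ, so the powers of z - 1 in p drop out. -/
theorem pow_mul_sub (m : ℕ) (f : ℝ[X]) :
    derivative (f * (X - 1) ^ m) * (X - 1) - C (m : ℝ) * (f * (X - 1) ^ m) =
      derivative f * (X - 1) * (X - 1) ^ m := by
  rcases m with _ | m
  · simp
  · simp [derivative_mul, derivative_pow]; ring

theorem dvd_num_of_pow_dvd {f : ℝ[X]} {r : ℝ} {n : ℕ} (c : ℝ) (hf : (X - C r) ^ n ∣ f) :
    (X - C r) ^ (n - 1) ∣ derivative f * (X - 1) - C c * f := by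
  refine dvd_sub (Dvd.dvd.mul_right ?_ _) (Dvd.dvd.mul_left ?_ _)
  · obtain ⟨g, rfl⟩ := hf
    rw [derivative_mul, derivative_pow]
    refine dvd_add ?_ ?_
    · simp only [derivative_sub, derivative_X, derivative_C, sub_zero, mul_one]
      exact Dvd.dvd.mul_right (Dvd.dvd.mul_left dvd_rfl _) _
    · exact Dvd.dvd.mul_right (pow_dvd_pow _ (Nat.sub_le _ _)) _
  · exact (pow_dvd_pow _ (Nat.sub_le _ _)).trans hf

/-- With U, V = T ∓ 2(z - 1)ᵏ one has p = UV, and T'(z - 1) - kT is unchanged when T is replaced by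
U or V. At a zero r ≠ 1 of p only one of U, V vanishes, since V - U = 4(z - 1)ᵏ. That one carries
the full multiplicity n, and differentiation keeps n - 1 ≥ ⌊n/2⌋. -/
theorem q_dvd_trNum (hk : 1 ≤ k) (h : LayerShape k 1 (polyPhi α β)) :
    q α β ∣ trNum α β := by
  refine Finset.prod_dvd_of_coprime (fun r _ s _ hrs => ?_) fun r hr => ?_
  · exact IsCoprime.pow (pairwise_coprime_X_sub_C Function.injective_id hrs)
  rw [Multiset.mem_toFinset] at hr
  have hr0 : (p α β).eval r = 0 := (mem_roots'.1 hr).2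
  have hr1 : r ≠ 1 := by
    rintro rfl
    rw [p_eval_one hk] at hr0
    exact (pow_pos (tr_one_pos h) 2).ne' hr0
  set n := (p α β).rootMultiplicity r with hn
  have hpos : 0 < n := (rootMultiplicity_pos (p_ne_zero hk h)).2 (mem_roots'.1 hr).2
  set U := tr α β - 2 * (X - 1) ^ k with hU
  set V := tr α β + 2 * (X - 1) ^ k with hV
  have hp : p α β = U * V := by rw [p_eq, hU, hV]; ring
  have hdvd : (X - C r) ^ n ∣ U * V := hp ▸ pow_rootMultiplicity_dvd _ _
  have e0 : derivative (2 * (X - 1) ^ k) * (X - 1) - C (k : ℝ) * (2 * (X - 1) ^ k) =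
      (0 : ℝ[X]) := by
    rw [pow_mul_sub]; simp
  have eU : trNum α β = derivative U * (X - 1) - C (k : ℝ) * U := by
    rw [hU, trNum, derivative_sub]; linear_combination e0
  have eV : trNum α β = derivative V * (X - 1) - C (k : ℝ) * V := by
    rw [hV, trNum, derivative_add]; linear_combination -e0
  have hle : n / 2 ≤ n - 1 := by omega
  refine (pow_dvd_pow _ hle).trans ?_
  have cop : ∀ W : ℝ[X], W.eval r ≠ 0 → IsCoprime ((X - C r) ^ n) W := fun W hW =>
    IsCoprime.pow_left (((irreducible_X_sub_C r).coprime_iff_not_dvd).2 fun hd =>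
      hW (dvd_iff_isRoot.1 hd))
  by_cases h1 : U.eval r = 0
  · have h2 : V.eval r ≠ 0 := by
      intro h2
      have : (V - U).eval r = 0 := by rw [eval_sub, h1, h2, sub_zero]
      rw [hV, hU] at this
      simp at this
      exact sub_ne_zero.2 hr1 this.1
    rw [eU]
    exact dvd_num_of_pow_dvd _ ((cop V h2).dvd_of_dvd_mul_right hdvd)
  · rw [eV]
    exact dvd_num_of_pow_dvd _ ((cop U h1).dvd_of_dvd_mul_left hdvd)

/-- The polynomial `n₀ = (T' (z - 1) - k T) / q`. -/
noncomputable def num (α β : Fin k → ℝ) : ℝ[X] := trNum α β /ₘ q α β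

theorem q_mul_num (hk : 1 ≤ k) (h : LayerShape k 1 (polyPhi α β)) :
    q α β * num α β = trNum α β := by
  have h' := modByMonic_add_div (trNum α β) (q α β)
  rwa [(modByMonic_eq_zero_iff_dvd (q_monic α β)).2 (q_dvd_trNum hk h), zero_add] at h'

theorem num_ne_zero (hk : 1 ≤ k) (h : LayerShape k 1 (polyPhi α β)) : num α β ≠ 0 := by
  intro h0
  have h1 := q_mul_num hk h
  rw [h0, mul_zero] at h1
  have h2 := trNum_eval_one (α := α) (β := β)
  rw [← h1, eval_zero] at h2
  have := tr_one_pos h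
  have : (1 : ℝ) ≤ k := by exact_mod_cast hk
  nlinarith

theorem num_natDegree_le (hk : 1 ≤ k) (h : LayerShape k 1 (polyPhi α β)) :
    (num α β).natDegree ≤ kPrime α β - 1 := by
  have h1 := trNum_natDegree_le hk h
  rw [← q_mul_num hk h, natDegree_mul (q_monic α β).ne_zero (num_ne_zero hk h)] at h1
  have := p_natDegree_eq hk h
  have := p0_natDegree hk h
  omega

/-- After multiplication by q this reads (z - 1)p' - 2kp = 2T(T'(z - 1) - kT). Together with w² = p₀
it yields the logarithmic derivative n₀/((z - 1)w) of ρ. -/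
theorem num_identity (hk : 1 ≤ k) (h : LayerShape k 1 (polyPhi α β)) :
    (X - 1) * (2 * derivative (q α β) * p0 α β + q α β * derivative (p0 α β)) -
      2 * C (k : ℝ) * q α β * p0 α β = 2 * tr α β * num α β := by
  apply mul_left_cancel₀ (q_monic α β).ne_zero
  have hC2 : (C 2 : ℝ[X]) = 2 := rfl
  have e1 : derivative (p α β) = 2 * q α β * derivative (q α β) * p0 α β +
      q α β ^ 2 * derivative (p0 α β) := by
    rw [← q_sq_mul_p0, derivative_mul, derivative_pow]; simp [hC2]
  have e2 := pow_mul_sub (2 * k) (4 : ℝ[X])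
  have e3 : derivative (p α β) = 2 * tr α β * derivative (tr α β) -
      derivative (4 * (X - 1) ^ (2 * k)) := by
    rw [p_eq, derivative_sub, derivative_pow]; simp [hC2]
  have e4 := q_mul_num hk h
  have e5 := q_sq_mul_p0 α β
  have e6 := p_eq α β
  have e7 : C ((2 * k : ℕ) : ℝ) = 2 * C (k : ℝ) := by simp [hC2]
  rw [e7] at e2
  simp only [derivative_ofNat, zero_mul] at e2
  rw [trNum] at e4
  linear_combination (X - 1) * (e3 - e1) - e2 - 2 * C (k : ℝ) * (e5 + e6) - 2 * tr α β * e4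
  

/-- The polynomial `n₀` has a zero in each gap. -/
theorem num_zero_of_gap (hk : 1 ≤ k) (h : LayerShape k 1 (polyPhi α β)) {u v : ℝ} (huv : u < v)
    (hv : v < 0) (hu0 : (p0 α β).eval u = 0) (hv0 : (p0 α β).eval v = 0)
    (hpos : ∀ t ∈ Set.Ioo u v, 0 < (p0 α β).eval t) :
    ∃ c ∈ Set.Ioo u v, (num α β).eval c = 0 := by
  -- This is ρ² on one sheet, with logarithmic derivative 2n₀/((t - 1)w). At a branch point ρ = ±1,
  -- and squaring removes the unknown sign, so Rolle's theorem applies.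
  set f : ℝ → ℝ := fun t => ((tr α β).eval t + (q α β).eval t * √((p0 α β).eval t)) ^ 2 /
    (4 * (t - 1) ^ (2 * k)) with hf
  have hne : ∀ t, t ≤ v → 4 * (t - 1) ^ (2 * k) ≠ 0 := fun t ht =>
    mul_ne_zero (by norm_num) (pow_ne_zero _ (by linarith))
  have hsq : ∀ t, (tr α β).eval t ^ 2 - ((q α β).eval t ^ 2 * (p0 α β).eval t) =
      4 * (t - 1) ^ (2 * k) := fun t => by
    have := congrArg (eval t) (q_sq_mul_p0 α β)
    rw [p_eq] at this
    simp at this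
    linear_combination -this
  have hend : ∀ t, t ≤ v → (p0 α β).eval t = 0 → f t = 1 := fun t ht h0 => by
    have h1 := hsq t
    rw [h0, mul_zero, sub_zero] at h1
    simp only [hf]
    rw [h0, Real.sqrt_zero, mul_zero, add_zero, h1, div_self (hne t ht)]
  have hcont : ContinuousOn f (Set.Icc u v) := by
    refine ContinuousOn.div ?_ ?_ fun t ht => hne t ht.2
    · fun_prop
    · fun_prop
  have hder : ∀ t ∈ Set.Ioo u v, HasDerivAt f (2 * f t * (num α β).eval t /
      ((t - 1) * √((p0 α β).eval t))) t := by
    intro t ht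
    have hp := hpos t ht
    set w := √((p0 α β).eval t) with hw
    have hw0 : 0 < w := Real.sqrt_pos.2 hp
    have hww : w ^ 2 = (p0 α β).eval t := Real.sq_sqrt hp.le
    have ht1 : t - 1 ≠ 0 := by linarith [ht.2]
    have d0 := ((p0 α β).hasDerivAt t).sqrt hp.ne'
    have d1 := ((((tr α β).hasDerivAt t).add (((q α β).hasDerivAt t).mul d0)).pow 2).div
      ((((hasDerivAt_id t).sub_const 1).pow (2 * k)).const_mul 4) (hne t ht.2.le)
    refine d1.congr_deriv ?_
    simp only [Pi.add_apply, Pi.mul_apply, Pi.pow_apply, id, ← hw, hf]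
    obtain ⟨n, rfl⟩ : ∃ n, k = n + 1 := ⟨k - 1, by omega⟩
    have I1 := congrArg (eval t) (num_identity hk h)
    have I2 := congrArg (eval t) (q_mul_num hk h)
    simp [trNum] at I1 I2
    rw [← hww] at I1
    have e : 2 * (n + 1) - 1 = 2 * n + 1 := by omega
    rw [e]
    have e' : (t - 1) ^ (2 * (n + 1)) = (t - 1) ^ (2 * n + 1) * (t - 1) := by
      rw [← pow_succ]; rfl
    rw [e']
    push_cast
    field_simp
    set A := (tr α β).eval t
    set A' := (derivative (tr α β)).eval t
    set B := (q α β).eval t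
    set B' := (derivative (q α β)).eval t
    set N := (num α β).eval t
    set E := (derivative (p0 α β)).eval t
    linear_combination (A + B * w) * I1 - 2 * (A + B * w) * w * I2
  obtain ⟨c, hc, h0⟩ := exists_hasDerivAt_eq_zero huv hcont
    ((hend u huv.le hu0).trans (hend v le_rfl hv0).symm) hder
  refine ⟨c, hc, ?_⟩
  have hp := hpos c hc
  have hw0 : 0 < √((p0 α β).eval c) := Real.sqrt_pos.2 hp
  have hc1 : c - 1 ≠ 0 := by linarith [hc.2]
  have hfc : f c ≠ 0 := by
    simp only [hf]
    refine div_ne_zero (pow_ne_zero _ fun h1 => ?_) (hne c hc.2.le)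
    have h2 := hsq c
    have h3 : (q α β).eval c ^ 2 * (p0 α β).eval c = (tr α β).eval c ^ 2 := by
      rw [← Real.sq_sqrt hp.le, eq_neg_of_add_eq_zero_left h1]; ring
    rw [h3, sub_self] at h2
    exact hne c hc.2.le h2.symm
  rw [div_eq_zero_iff, or_iff_left (mul_ne_zero hc1 hw0.ne')] at h0
  simpa [hfc] using h0

end

/-! ### Assembling the reduced data -/

section
variable {k : ℕ} {α β : Fin k → ℝ}

theorem eq_C_mul_prod_of_roots {f : ℝ[X]} (hf : f ≠ 0) {g : ℕ} (hdeg : f.natDegree ≤ g)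
    {c : ℕ → ℝ} (hc : Set.InjOn c (Finset.Icc 1 g)) (h0 : ∀ l ∈ Finset.Icc 1 g, f.eval (c l) = 0) :
    ∃ d : ℝ, d ≠ 0 ∧ f = C d * ∏ l ∈ Finset.Icc 1 g, (X - C (c l)) := by
  have hdvd : ∏ l ∈ Finset.Icc 1 g, (X - C (c l)) ∣ f :=
    Finset.prod_dvd_of_coprime (fun i hi j hj hij => isCoprime_X_sub_C_of_isUnit_sub
      (sub_ne_zero.2 fun h => hij (hc hi hj h)).isUnit) fun l hl => dvd_iff_isRoot.2 (h0 l hl)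
  obtain ⟨r, hr⟩ := hdvd
  have hmon : (∏ l ∈ Finset.Icc 1 g, (X - C (c l))).Monic :=
    monic_prod_of_monic _ _ fun l _ => monic_X_sub_C _
  have hd : (∏ l ∈ Finset.Icc 1 g, (X - C (c l))).natDegree = g := by
    rw [natDegree_prod_of_monic _ _ fun l _ => monic_X_sub_C _]; simp
  have hr0 : r ≠ 0 := by rintro rfl; exact hf (by rw [hr, mul_zero])
  have hrd : r.natDegree = 0 := by
    rw [hr, natDegree_mul hmon.ne_zero hr0, hd] at hdeg; omega
  rw [eq_C_of_natDegree_eq_zero hrd] at hr hr0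
  exact ⟨r.coeff 0, fun h => hr0 (by rw [h, C_0]), by rw [hr]; ring⟩

/-- The abscissa of the two points on the vertical sides of the square. -/
noncomputable def tangency (α β : Fin k → ℝ) : ℝ :=
  1 / (k : ℝ) * ((derivative (p α β)).eval 1 / (p α β).eval 1) - 1

theorem tangency_eq (hk : 1 ≤ k) (h : LayerShape k 1 (polyPhi α β)) :
    tangency α β = 2 * (derivative (tr α β)).eval 1 / (k * (tr α β).eval 1) - 1 := by
  have := tr_one_pos h
  have : (1 : ℝ) ≤ k := by exact_mod_cast hk
  rw [tangency, p_eval_one hk, p_deriv_eval_one hk]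
  field_simp

theorem tangency_mem (hk : 1 ≤ k) (h : LayerShape k 1 (polyPhi α β)) :
    tangency α β ∈ Set.Ioo (-1 : ℝ) 1 := by
  have h1 := tr_one_pos h
  have h2 : (1 : ℝ) ≤ k := by exact_mod_cast hk
  have h3 := tr_deriv_one_pos hk h
  have h4 := tr_deriv_one_lt hk h
  have h5 : 0 < (k : ℝ) * (tr α β).eval 1 := by positivity
  rw [tangency_eq hk h]
  constructor
  · have : 0 < 2 * (derivative (tr α β)).eval 1 / (k * (tr α β).eval 1) := by positivity
    linarith
  · have : 2 * (derivative (tr α β)).eval 1 / (k * (tr α β).eval 1) < 2 := by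
      rw [div_lt_iff₀ h5]; linarith
    linarith

/-- At z = 1 one has q n₀ = -kT and q² p₀ = T². The identity says that z = 1 solves the critical
equation when χ = ±1. -/
theorem eval_one_identity (hk : 1 ≤ k) (h : LayerShape k 1 (polyPhi α β)) {p1 : ℝ[X]}
    (hp : p0 α β = X * p1) : (k : ℝ) ^ 2 * p1.eval 1 = (num α β).eval 1 ^ 2 := by
  have e1 := congrArg (eval 1) (q_mul_num hk h)
  have e2 := congrArg (eval 1) (q_sq_mul_p0 α β)
  rw [trNum_eval_one, eval_mul] at e1
  rw [hp, p_eval_one hk] at e2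
  simp at e2
  have hq : (q α β).eval 1 ≠ 0 := by
    intro h0
    rw [h0] at e2
    exact (pow_pos (tr_one_pos h) 2).ne' (by rw [← e2]; ring)
  apply mul_left_cancel₀ (pow_ne_zero 2 hq)
  linear_combination (k : ℝ) ^ 2 * e2 - ((q α β).eval 1 * (num α β).eval 1 -
    k * (tr α β).eval 1) * e1

/-- The polynomial is the critical equation for χ² = 1 and η = `tangency`, so the claim is that its
zero at 1 is double. Multiplying by z q², which does not vanish at 1, turns it into an expression in
p and T whose derivative at 1 is known. -/
theorem deriv_one_identity (hk : 1 ≤ k) (h : LayerShape k 1 (polyPhi α β)) {p1 : ℝ[X]}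
    (hp : p0 α β = X * p1) :
    (derivative ((C (k : ℝ) * (C (tangency α β - 1) * X - C (tangency α β + 1))) ^ 2 * p1
      - C 4 * X * (num α β) ^ 2)).eval 1 = 0 := by
  set e := tangency α β with he
  set A : ℝ[X] := C (k : ℝ) * (C (e - 1) * X - C (e + 1)) with hA
  set G := A ^ 2 * p1 - C 4 * X * (num α β) ^ 2 with hG
  have hT := tr_one_pos h
  have hk1 : (1 : ℝ) ≤ k := by exact_mod_cast hk
  have hq : (q α β).eval 1 ≠ 0 := by
    intro h0
    have e2 := congrArg (eval 1) (q_sq_mul_p0 α β)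
    rw [p_eval_one hk] at e2
    simp [h0] at e2
    exact (pow_pos hT 2).ne' e2.symm
  have hmul : X * (q α β) ^ 2 * G = A ^ 2 * p α β - C 4 * X ^ 2 * (trNum α β) ^ 2 := by
    rw [hG, ← q_mul_num hk h, ← q_sq_mul_p0, hp]; ring
  have hG1 : G.eval 1 = 0 := by
    have := eval_one_identity hk h hp
    simp [hG, hA]
    linear_combination 4 * this
  have hd := congrArg (fun f => (derivative f).eval 1) hmul
  simp only [derivative_mul, derivative_sub, derivative_pow, derivative_X, derivative_C,
    eval_add, eval_mul, eval_sub, eval_pow, eval_X, eval_C, hG1, p_eval_one hk,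
    p_deriv_eval_one hk, hA, trNum, derivative_one, eval_one] at hd
  simp at hd
  have hE : (e + 1) * (k * (tr α β).eval 1) = 2 * (derivative (tr α β)).eval 1 := by
    rw [he, tangency_eq hk h]; field_simp; ring
  have : (q α β).eval 1 ^ 2 * (derivative G).eval 1 = 0 := by
    rw [hd]
    linear_combination (-4 * (k : ℝ) * (tr α β).eval 1) * hE
  exact (mul_eq_zero.1 this).resolve_left (pow_ne_zero 2 hq)

theorem exists_gapModel (hk : 1 ≤ k) (hα : ∀ m, 0 < α m) (hβ : ∀ m, 0 < β m)
    (h : LayerShape k 1 (polyPhi α β)) : ∃ M : GapModel,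
      M.g = kPrime α β - 1 ∧ M.lo = (fun l => x α β (2 * l)) ∧
      M.hi = (fun l => x α β (2 * l - 1)) ∧ M.κ = k ∧ M.estar = tangency α β ∧
      p0 α β = X * M.p1 ∧ num α β = M.n0 := by
  set D := gapData hk hα hβ h with hD
  have hp : p0 α β = X * D.p1 := p0_eq_X_mul hk hα hβ h
  have hz : ∀ l ∈ Finset.Icc 1 D.g, ∃ c ∈ Set.Ioo (D.lo l) (D.hi l), (num α β).eval c = 0 := by
    intro l hl
    refine num_zero_of_gap hk h (D.lo_lt_hi l hl) (D.hi_neg l hl) ?_ ?_ fun t ht => ?_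
    · rw [hp, eval_mul, D.p1_lo hl, mul_zero]
    · rw [hp, eval_mul, D.p1_hi hl, mul_zero]
    · rw [hp, eval_mul, eval_X]
      exact mul_pos_of_neg_of_neg (ht.2.trans (D.hi_neg l hl)) (D.p1_neg hl ht)
  choose! c hc hc0 using hz
  -- The degree of n₀ is at most the number of gaps, so the zeros found in the gaps are all of its
  -- zeros, and they are simple.
  obtain ⟨d, hd, hnum⟩ := eq_C_mul_prod_of_roots (num_ne_zero hk h) (num_natDegree_le hk h)
    (c := c) (fun i hi j hj hij => by
      by_contra hne
      exact D.gap_sep hi hj hne (Set.Ioo_subset_Icc_self (hc i hi))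
        (hij ▸ Set.Ioo_subset_Icc_self (hc j hj))) (fun l hl => hc0 l hl)
  refine ⟨{ D with
    κ := k
    κ_pos := by exact_mod_cast hk
    nlead := d
    nlead_ne := hd
    c := c
    c_mem := hc
    estar := tangency α β
    estar_mem := tangency_mem hk h
    at_one := ?_
    deriv_one := ?_ }, rfl, rfl, rfl, rfl, rfl, hp, hnum⟩
  · have := eval_one_identity hk h hp
    rw [hnum] at this; exact this
  · have := deriv_one_identity hk h hp
    rw [hnum] at this; exact this

end

/-! ### Counting complex zeros of real polynomials -/

open Classical in
/-- The number of complex zeros, with multiplicity, of a real polynomial in a set. -/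
noncomputable def cnt (f : ℝ[X]) (I : Set ℂ) : ℕ :=
  (f.map (algebraMap ℝ ℂ)).roots.countP (· ∈ I)

theorem map_ne_zero_of_ne {f : ℝ[X]} (hf : f ≠ 0) : f.map (algebraMap ℝ ℂ) ≠ 0 :=
  (Polynomial.map_ne_zero_iff (algebraMap ℝ ℂ).injective).2 hf

theorem card_roots_map (f : ℝ[X]) : (f.map (algebraMap ℝ ℂ)).roots.card = f.natDegree := by
  rw [← (IsAlgClosed.splits _).natDegree_eq_card_roots,
    natDegree_map_eq_of_injective (algebraMap ℝ ℂ).injective]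

theorem count_ofReal (f : ℝ[X]) (t : ℝ) :
    (f.map (algebraMap ℝ ℂ)).roots.count (t : ℂ) = f.rootMultiplicity t := by
  rw [count_roots, eq_rootMultiplicity_map (algebraMap ℝ ℂ).injective t]; rfl

theorem eval_map_ofReal (f : ℝ[X]) (t : ℝ) :
    (f.map (algebraMap ℝ ℂ)).eval (t : ℂ) = ((f.eval t : ℝ) : ℂ) := by
  rw [← Complex.coe_algebraMap, eval_map_algebraMap, aeval_algebraMap_apply]; simp

theorem sum_rootMultiplicity_le_cnt (f : ℝ[X]) {I : Set ℂ} (S : Finset ℝ)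
    (hS : ∀ t ∈ S, (t : ℂ) ∈ I) : ∑ t ∈ S, f.rootMultiplicity t ≤ cnt f I := by
  classical
  set R := (f.map (algebraMap ℝ ℂ)).roots with hR
  have h1 : ∀ t ∈ S, f.rootMultiplicity t = (R.filter (· ∈ I)).count (t : ℂ) := fun t ht => by
    rw [Multiset.count_filter_of_pos (hS t ht), hR, count_ofReal]
  have h2 : cnt f I = (R.filter (· ∈ I)).card := by
    rw [cnt, Multiset.countP_eq_card_filter]
  rw [h2, Finset.sum_congr rfl h1, ← Multiset.toFinset_sum_count_eq,
    ← Finset.sum_image (s := S) (g := fun t : ℝ => (t : ℂ)) (f := fun z => (R.filter (· ∈ I)).count z)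
      (fun a _ b _ h => Complex.ofReal_injective h)]
  refine Finset.sum_le_sum_of_ne_zero fun z _ hz => ?_
  rw [Multiset.mem_toFinset]
  exact Multiset.count_ne_zero.1 hz

theorem cnt_le_sum_rootMultiplicity (f : ℝ[X]) {I : Set ℂ} (S : Finset ℝ)
    (hS : ∀ z ∈ I, (f.map (algebraMap ℝ ℂ)).eval z = 0 → ∃ t ∈ S, z = t) :
    cnt f I ≤ ∑ t ∈ S, f.rootMultiplicity t := by
  classical
  set R := (f.map (algebraMap ℝ ℂ)).roots with hR
  have h2 : cnt f I = (R.filter (· ∈ I)).card := by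
    rw [cnt, Multiset.countP_eq_card_filter]
  have h3 : ∑ z ∈ S.image (fun t : ℝ => (t : ℂ)), (R.filter (· ∈ I)).count z =
      (R.filter (· ∈ I)).card := by
    refine Multiset.sum_count_eq_card fun z hz => ?_
    rw [Multiset.mem_filter] at hz
    obtain ⟨t, ht, rfl⟩ := hS z hz.2 (mem_roots'.1 hz.1).2
    exact Finset.mem_image_of_mem _ ht
  rw [h2, ← h3, Finset.sum_image fun a _ b _ h => Complex.ofReal_injective h]
  refine Finset.sum_le_sum fun t _ => ?_
  rw [← count_ofReal]
  exact Multiset.count_le_of_le _ (Multiset.filter_le _ _)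

theorem one_le_rootMultiplicity {f : ℝ[X]} (hf : f ≠ 0) {t : ℝ} (h : f.eval t = 0) :
    1 ≤ f.rootMultiplicity t := (rootMultiplicity_pos hf).2 h

theorem two_le_rootMultiplicity {f : ℝ[X]} (hf : f ≠ 0) {t : ℝ} (h : f.eval t = 0)
    (h' : (derivative f).eval t = 0) : 2 ≤ f.rootMultiplicity t :=
  (one_lt_rootMultiplicity_iff_isRoot hf).2 ⟨h, h'⟩

theorem two_le_of_nonneg {f : ℝ[X]} (hf : f ≠ 0) {t : ℝ} (h : f.eval t = 0)
    (hn : ∀ᶠ s in nhds t, 0 ≤ f.eval s) : 2 ≤ f.rootMultiplicity t := by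
  refine two_le_rootMultiplicity hf h ?_
  have : IsLocalMin (fun s => f.eval s) t := hn.mono fun s hs => by simpa [h] using hs
  exact this.hasDerivAt_eq_zero (f.hasDerivAt t)

theorem exists_root_gt {f : ℝ[X]} (hd : 0 < f.natDegree) (hl : 0 < f.leadingCoeff) {t : ℝ}
    (ht : f.eval t < 0) : ∃ r, t < r ∧ f.eval r = 0 := by
  have h1 := f.tendsto_atTop_of_leadingCoeff_nonneg (natDegree_pos_iff_degree_pos.1 hd) hl.le
  obtain ⟨s, hs, hts⟩ := ((h1.eventually_gt_atTop 0).and (Filter.eventually_gt_atTop t)).exists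
  obtain ⟨r, hr, h0⟩ := intermediate_value_Ioo hts.le f.continuous.continuousOn ⟨ht, hs⟩
  exact ⟨r, hr.1, h0⟩

namespace GapData
variable (D : GapData)

/-- The gap `[lo l, hi l]` in the complex plane. -/
def gapC (l : ℕ) : Set ℂ := {z | ∃ t ∈ Set.Icc (D.lo l) (D.hi l), z = (t : ℝ)}

/-- The positive half line in the complex plane. -/
def posC : Set ℂ := {z | ∃ t : ℝ, 0 < t ∧ z = t}

/-- The complement of the gaps and of the positive half line. -/
def restC : Set ℂ := {z | z ∉ posC ∧ ∀ l ∈ Finset.Icc 1 D.g, z ∉ D.gapC l}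

theorem ofReal_mem_gapC {l : ℕ} {t : ℝ} : (t : ℂ) ∈ D.gapC l ↔ t ∈ Set.Icc (D.lo l) (D.hi l) := by
  constructor
  · rintro ⟨s, hs, h⟩; rwa [Complex.ofReal_inj.1 h]
  · exact fun h => ⟨t, h, rfl⟩

theorem ofReal_mem_posC {t : ℝ} : (t : ℂ) ∈ posC ↔ 0 < t := by
  constructor
  · rintro ⟨s, hs, h⟩; rwa [Complex.ofReal_inj.1 h]
  · exact fun h => ⟨t, h, rfl⟩

theorem gapC_disjoint {l j : ℕ} (hl : l ∈ Finset.Icc 1 D.g) (hj : j ∈ Finset.Icc 1 D.g)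
    (h : l ≠ j) {z : ℂ} (hz : z ∈ D.gapC l) : z ∉ D.gapC j := by
  obtain ⟨t, ht, rfl⟩ := hz
  rw [ofReal_mem_gapC]
  exact D.gap_sep hl hj h ht

theorem gapC_posC {l : ℕ} (hl : l ∈ Finset.Icc 1 D.g) {z : ℂ} (hz : z ∈ D.gapC l) :
    z ∉ posC := by
  obtain ⟨t, ht, rfl⟩ := hz
  rw [ofReal_mem_posC, not_lt]
  exact ht.2.trans (D.hi_neg l hl).le

/-- The zeros are distributed over the gaps, the positive half line and the rest. -/
theorem cnt_total (f : ℝ[X]) :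
    cnt f D.restC + cnt f posC + ∑ l ∈ Finset.Icc 1 D.g, cnt f (D.gapC l) = f.natDegree := by
  classical
  rw [← card_roots_map]
  simp only [cnt]
  induction (f.map (algebraMap ℝ ℂ)).roots using Multiset.induction with
  | empty => simp
  | cons z s ih =>
    simp only [Multiset.countP_cons, Multiset.card_cons, Finset.sum_add_distrib]
    have key : (if z ∈ D.restC then 1 else 0) + (if z ∈ posC then 1 else 0) +
        ∑ l ∈ Finset.Icc 1 D.g, (if z ∈ D.gapC l then 1 else 0) = 1 := by
      by_cases hp : z ∈ posC
      · have h1 : z ∉ D.restC := fun h => h.1 hp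
        rw [Finset.sum_eq_zero fun l hl => if_neg fun h => D.gapC_posC hl h hp]
        simp [h1, hp]
      · by_cases hg : ∃ l ∈ Finset.Icc 1 D.g, z ∈ D.gapC l
        · obtain ⟨l, hl, hz⟩ := hg
          have h1 : z ∉ D.restC := fun h => h.2 l hl hz
          rw [Finset.sum_eq_single_of_mem l hl fun j hj hjl =>
            if_neg (D.gapC_disjoint hl hj hjl.symm hz)]
          simp [h1, hp, hz]
        · push Not at hg
          have h1 : z ∈ D.restC := ⟨hp, hg⟩
          rw [Finset.sum_eq_zero fun l hl => if_neg (hg l hl)]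
          simp [h1, hp]
    omega

end GapData

/-! ### Zeros forced in every gap -/

namespace GapModel
variable (M : GapModel)

/-- The polynomial `A² p₁ - 4 χ² z n₀²`. -/
noncomputable def quad (A : ℝ[X]) (χ : ℝ) : ℝ[X] :=
  A ^ 2 * M.p1 - C (4 * χ ^ 2) * X * M.n0 ^ 2

theorem quad_eval (A : ℝ[X]) (χ t : ℝ) : (M.quad A χ).eval t =
    A.eval t ^ 2 * M.p1.eval t - 4 * χ ^ 2 * t * M.n0.eval t ^ 2 := by
  simp [quad]

theorem quad_degree {A : ℝ[X]} (hA : A.natDegree = 1) (χ : ℝ) :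
    (M.quad A χ).natDegree = 2 * M.g + 2 ∧
      (M.quad A χ).leadingCoeff = A.leadingCoeff ^ 2 * M.lead := by
  have hA0 : A ≠ 0 := by rintro rfl; simp at hA
  have h1 : (A ^ 2 * M.p1).natDegree = 2 * M.g + 2 := by
    rw [natDegree_mul (pow_ne_zero _ hA0) M.p1_ne_zero, natDegree_pow, hA, M.p1_natDegree]; ring
  have h2 : (C (4 * χ ^ 2) * X * M.n0 ^ 2).natDegree < (A ^ 2 * M.p1).natDegree := by
    rw [h1]
    have e1 : (C (4 * χ ^ 2) * X : ℝ[X]).natDegree ≤ 1 := (natDegree_C_mul_le _ _).trans natDegree_X_le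
    have e2 : (M.n0 ^ 2).natDegree ≤ 2 * M.g := by
      rw [natDegree_pow, M.n0_natDegree]
    have := natDegree_mul_le (p := (C (4 * χ ^ 2) * X : ℝ[X])) (q := M.n0 ^ 2)
    omega
  refine ⟨by rw [quad, natDegree_sub_eq_left_of_natDegree_lt h2, h1], ?_⟩
  rw [quad, leadingCoeff_sub_of_degree_lt (degree_lt_degree h2), leadingCoeff_mul,
    leadingCoeff_pow, M.p1_leadingCoeff]

/-- Both sheets over a gap carry a solution of `A w = s · 2 z n₀`. -/
theorem sheet_zero (A : ℝ[X]) {s : ℝ} (hs : s ≠ 0) {l : ℕ} (hl : l ∈ Finset.Icc 1 M.g) :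
    ∃ z ∈ Set.Ioo (M.lo l) (M.hi l),
      A.eval z * √(z * M.p1.eval z) = s * (2 * z * M.n0.eval z) := by
  set f : ℝ → ℝ := fun z => A.eval z * √(z * M.p1.eval z) - s * (2 * z * M.n0.eval z) with hf
  have hc : ContinuousOn f (Set.Icc (M.lo l) (M.hi l)) := by
    apply Continuous.continuousOn; fun_prop
  have hlt := M.lo_lt_hi l hl
  have hn := M.hi_neg l hl
  have e1 : f (M.lo l) = -(s * (2 * M.lo l * M.n0.eval (M.lo l))) := by
    simp [hf, M.p1_lo hl]
  have e2 : f (M.hi l) = -(s * (2 * M.hi l * M.n0.eval (M.hi l))) := by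
    simp [hf, M.p1_hi hl]
  -- The square root vanishes at both ends, which leaves the term with n₀; `n0_ends` gives it
  -- opposite signs there.
  have hprod : f (M.lo l) * f (M.hi l) < 0 := by
    have h1 : 0 < 4 * s ^ 2 * (M.lo l * M.hi l) := by
      have := mul_pos_of_neg_of_neg (hlt.trans hn) hn
      positivity
    have := mul_neg_of_pos_of_neg h1 (M.n0_ends hl)
    rw [e1, e2]; nlinarith
  have h0 : ∃ z ∈ Set.Ioo (M.lo l) (M.hi l), f z = 0 := by
    rcases lt_or_ge (f (M.lo l)) 0 with h | h
    · have h' : 0 < f (M.hi l) := by by_contra hh; nlinarith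
      exact intermediate_value_Ioo hlt.le hc ⟨h, h'⟩
    · have h2 : 0 < f (M.lo l) := lt_of_le_of_ne h fun h0 => by rw [← h0] at hprod; simp at hprod
      have h' : f (M.hi l) < 0 := by by_contra hh; nlinarith
      exact intermediate_value_Ioo' hlt.le hc ⟨h', h2⟩
  obtain ⟨z, hz, h⟩ := h0
  exact ⟨z, hz, sub_eq_zero.1 h⟩

theorem gap_neg {l : ℕ} (hl : l ∈ Finset.Icc 1 M.g) {z : ℝ}
    (hz : z ∈ Set.Icc (M.lo l) (M.hi l)) : z < 0 := hz.2.trans_lt (M.hi_neg l hl)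

theorem rad_pos {l : ℕ} (hl : l ∈ Finset.Icc 1 M.g) {z : ℝ}
    (hz : z ∈ Set.Ioo (M.lo l) (M.hi l)) : 0 < z * M.p1.eval z :=
  mul_pos_of_neg_of_neg (M.gap_neg hl (Set.Ioo_subset_Icc_self hz)) (M.p1_neg hl hz)

theorem quad_eval_zero_of_sheet {A : ℝ[X]} {χ s : ℝ} (hs : s ^ 2 = χ ^ 2) {l : ℕ}
    (hl : l ∈ Finset.Icc 1 M.g) {z : ℝ} (hz : z ∈ Set.Ioo (M.lo l) (M.hi l))
    (h : A.eval z * √(z * M.p1.eval z) = s * (2 * z * M.n0.eval z)) :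
    (M.quad A χ).eval z = 0 := by
  have h0 := M.gap_neg hl (Set.Ioo_subset_Icc_self hz)
  have h1 := Real.sq_sqrt (M.rad_pos hl hz).le
  rw [quad_eval]
  apply mul_left_cancel₀ h0.ne
  rw [mul_zero]
  have h2 : (A.eval z * √(z * M.p1.eval z)) ^ 2 = (s * (2 * z * M.n0.eval z)) ^ 2 := by rw [h]
  rw [mul_pow, h1, mul_pow, hs] at h2
  linear_combination h2

/-- Each sheet contributes a zero. If both lie over the same point, then A and n₀ vanish there and
the zero of the polynomial is double. -/
theorem two_le_quad_cnt_of_ne {A : ℝ[X]} {χ : ℝ} (hχ : χ ≠ 0) (hne : M.quad A χ ≠ 0) {l : ℕ}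
    (hl : l ∈ Finset.Icc 1 M.g) : 2 ≤ cnt (M.quad A χ) (M.gapC l) := by
  obtain ⟨z, hz, h⟩ := M.sheet_zero A hχ hl
  obtain ⟨y, hy, h'⟩ := M.sheet_zero A (neg_ne_zero.2 hχ) hl
  have r1 := M.quad_eval_zero_of_sheet rfl hl hz h
  have r2 := M.quad_eval_zero_of_sheet (neg_sq χ) hl hy h'
  have hzI := (M.ofReal_mem_gapC).2 (Set.Ioo_subset_Icc_self hz)
  have hyI := (M.ofReal_mem_gapC).2 (Set.Ioo_subset_Icc_self hy)
  by_cases hzy : z = y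
  · subst hzy
    have hz0 := M.gap_neg hl (Set.Ioo_subset_Icc_self hz)
    have hw := Real.sqrt_pos.2 (M.rad_pos hl hz)
    have hn : M.n0.eval z = 0 := by
      have : χ * (2 * z * M.n0.eval z) = 0 := by linarith
      simpa [hχ, hz0.ne] using this
    have hA : A.eval z = 0 := by
      rw [hn, mul_zero, mul_zero] at h
      exact (mul_eq_zero.1 h).resolve_right hw.ne'
    have hm : 2 ≤ (M.quad A χ).rootMultiplicity z := by
      refine two_le_rootMultiplicity hne r1 ?_
      simp [quad, derivative_pow, hn, hA]
    have := sum_rootMultiplicity_le_cnt (M.quad A χ) (I := M.gapC l) {z} (by simpa using hzI)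
    simp at this; omega
  · have := sum_rootMultiplicity_le_cnt (M.quad A χ) (I := M.gapC l) {z, y} (by
      simp [hzI, hyI])
    rw [Finset.sum_pair hzy] at this
    have := one_le_rootMultiplicity hne r1
    have := one_le_rootMultiplicity hne r2
    omega

/-- For χ = 0 the sheets give no separate zeros of n₀ type; the two ends of the gap, zeros of p₁,
take their place. -/
theorem two_le_quad_cnt {A : ℝ[X]} {χ : ℝ} (hne : M.quad A χ ≠ 0) {l : ℕ}
    (hl : l ∈ Finset.Icc 1 M.g) : 2 ≤ cnt (M.quad A χ) (M.gapC l) := by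
  by_cases hχ : χ = 0
  · have hlt := M.lo_lt_hi l hl
    have := sum_rootMultiplicity_le_cnt (M.quad A χ) (I := M.gapC l) {M.lo l, M.hi l} (by
      simp [M.ofReal_mem_gapC, hlt.le])
    rw [Finset.sum_pair hlt.ne] at this
    have := one_le_rootMultiplicity hne (t := M.lo l) (by
      rw [quad_eval, M.p1_lo hl, hχ]; ring)
    have := one_le_rootMultiplicity hne (t := M.hi l) (by
      rw [quad_eval, M.p1_hi hl, hχ]; ring)
    omega
  · exact M.two_le_quad_cnt_of_ne hχ hne hl

/-- Of the 2g + 2 zeros, 2g are spent on the gaps. This bound and the next two say where the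
remaining two can be. -/
theorem cnt_bound_zero {f : ℝ[X]} (hd : f.natDegree = 2 * M.g + 2)
    (h2 : ∀ l ∈ Finset.Icc 1 M.g, 2 ≤ cnt f (M.gapC l)) :
    cnt f M.restC + cnt f GapData.posC ≤ 2 := by
  have h := M.cnt_total f
  have h1 : ∑ _l ∈ Finset.Icc 1 M.g, 2 ≤ ∑ l ∈ Finset.Icc 1 M.g, cnt f (M.gapC l) :=
    Finset.sum_le_sum h2
  rw [Finset.sum_const, Nat.card_Icc, smul_eq_mul] at h1
  omega

theorem cnt_bound_one {f : ℝ[X]} (hd : f.natDegree = 2 * M.g + 2)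
    (h2 : ∀ l ∈ Finset.Icc 1 M.g, 2 ≤ cnt f (M.gapC l)) {l : ℕ} (hl : l ∈ Finset.Icc 1 M.g) :
    cnt f M.restC + cnt f GapData.posC + cnt f (M.gapC l) ≤ 4 := by
  have h := M.cnt_total f
  rw [← Finset.add_sum_erase _ _ hl] at h
  have h1 : ∑ _j ∈ (Finset.Icc 1 M.g).erase l, 2 ≤
      ∑ j ∈ (Finset.Icc 1 M.g).erase l, cnt f (M.gapC j) :=
    Finset.sum_le_sum fun j hj => h2 j (Finset.mem_of_mem_erase hj)
  rw [Finset.sum_const, Finset.card_erase_of_mem hl, Nat.card_Icc, smul_eq_mul] at h1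
  have := Finset.mem_Icc.1 hl
  omega

theorem cnt_bound_two {f : ℝ[X]} (hd : f.natDegree = 2 * M.g + 2)
    (h2 : ∀ l ∈ Finset.Icc 1 M.g, 2 ≤ cnt f (M.gapC l)) {l j : ℕ} (hl : l ∈ Finset.Icc 1 M.g)
    (hj : j ∈ Finset.Icc 1 M.g) (hlj : l ≠ j) :
    cnt f (M.gapC l) + cnt f (M.gapC j) ≤ 6 := by
  have h := M.cnt_total f
  have hj' : j ∈ (Finset.Icc 1 M.g).erase l := Finset.mem_erase.2 ⟨hlj.symm, hj⟩
  rw [← Finset.add_sum_erase _ _ hl, ← Finset.add_sum_erase _ _ hj'] at h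
  have h1 : ∑ _i ∈ ((Finset.Icc 1 M.g).erase l).erase j, 2 ≤
      ∑ i ∈ ((Finset.Icc 1 M.g).erase l).erase j, cnt f (M.gapC i) :=
    Finset.sum_le_sum fun i hi =>
      h2 i (Finset.mem_of_mem_erase (Finset.mem_of_mem_erase hi))
  rw [Finset.sum_const, Finset.card_erase_of_mem hj', Finset.card_erase_of_mem hl, Nat.card_Icc,
    smul_eq_mul] at h1
  have := Finset.mem_Icc.1 hl
  have := Finset.mem_Icc.1 hj
  omega

end GapModel

/-! ### Orders of vanishing on the two sheets -/

theorem analyticOrderAt_aeval {f : ℝ[X]} (hf : f ≠ 0) (z : ℂ) :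
    analyticOrderAt (fun s : ℂ => aeval (z + s) f) 0 =
      ((f.map (algebraMap ℝ ℂ)).rootMultiplicity z : ℕ) := by
  have hA : AnalyticAt ℂ (fun s : ℂ => aeval (z + s) f) 0 :=
    AnalyticAt.aeval_polynomial (by fun_prop) f
  rw [hA.analyticOrderAt_eq_natCast]
  obtain ⟨g, hg, hnd⟩ := exists_eq_pow_rootMultiplicity_mul_and_not_dvd _ (map_ne_zero_of_ne hf) z
  refine ⟨fun s => g.eval (z + s), ?_, ?_, ?_⟩
  · have : AnalyticAt ℂ (fun s : ℂ => aeval (z + s) g) 0 :=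
      AnalyticAt.aeval_polynomial (by fun_prop) g
    simpa using this
  · simpa [dvd_iff_isRoot] using hnd
  · refine Filter.Eventually.of_forall fun s => ?_
    show aeval (z + s) f = _
    rw [← eval_map_algebraMap, congrArg (eval (z + s)) hg]
    simp

theorem hasDerivAt_aeval_add (f : ℝ[X]) (z : ℂ) :
    HasDerivAt (fun s : ℂ => aeval (z + s) f) (aeval z (derivative f)) 0 := by
  have h := (f.hasDerivAt_aeval (z + 0)).comp (0 : ℂ) ((hasDerivAt_id (0 : ℂ)).const_add z)
  simpa [Function.comp_def] using h

/-- The branch of the square root of `f` through `(z, w)`. -/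
noncomputable def branch (f : ℝ[X]) (z w s : ℂ) : ℂ :=
  w * (aeval (z + s) f / w ^ 2) ^ (1 / 2 : ℂ)

theorem cpow_half_sq (u : ℂ) : (u ^ (1 / 2 : ℂ)) ^ 2 = u := by
  rw [← Complex.cpow_nat_mul]; norm_num

section branch
variable {f : ℝ[X]} {z w : ℂ}

theorem branch_zero (hw : w ≠ 0) (h : w ^ 2 = aeval z f) : branch f z w 0 = w := by
  rw [branch, add_zero, ← h, div_self (pow_ne_zero 2 hw), Complex.one_cpow, mul_one]

theorem branch_sq (hw : w ≠ 0) (s : ℂ) : branch f z w s ^ 2 = aeval (z + s) f := by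
  rw [branch, mul_pow, cpow_half_sq]; field_simp

theorem branch_neg (s : ℂ) : branch f z (-w) s = -branch f z w s := by
  rw [branch, branch, neg_sq, neg_mul]

theorem branch_analyticAt (hw : w ≠ 0) (h : w ^ 2 = aeval z f) :
    AnalyticAt ℂ (branch f z w) 0 := by
  have h1 : AnalyticAt ℂ (fun s : ℂ => aeval (z + s) f / w ^ 2) 0 :=
    (AnalyticAt.aeval_polynomial (by fun_prop) f).div_const
  refine AnalyticAt.mul analyticAt_const (h1.cpow analyticAt_const ?_)
  rw [add_zero, ← h, div_self (pow_ne_zero 2 hw)]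
  exact Complex.one_mem_slitPlane

theorem branch_hasDerivAt (hw : w ≠ 0) (h : w ^ 2 = aeval z f) :
    HasDerivAt (branch f z w) (aeval z (derivative f) / (2 * w)) 0 := by
  have h1 := (branch_analyticAt hw h).differentiableAt.hasDerivAt
  have h2 := h1.pow 2
  have h3 : (branch f z w) ^ 2 = fun s => aeval (z + s) f := funext fun s => branch_sq hw s
  rw [h3] at h2
  have h4 := h2.unique (hasDerivAt_aeval_add f z)
  rw [branch_zero hw h] at h4
  refine h1.congr_deriv ?_
  rw [← h4]; field_simp; simp

end branch

namespace GapModel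
variable (M : GapModel)

/-- The polynomial `κ ((η - 1) z - (η + 1))`. -/
noncomputable def lin (η : ℝ) : ℝ[X] := C M.κ * (C (η - 1) * X - C (η + 1))

/-- The polynomial whose zeros are the projections of the critical points. -/
noncomputable def crit (P : ℝ × ℝ) : ℝ[X] := M.quad (M.lin P.2) P.1

theorem lin_eval (η t : ℝ) : (M.lin η).eval t = M.κ * ((η - 1) * t - (η + 1)) := by
  simp [lin]

theorem crit_eval (P : ℝ × ℝ) (t : ℝ) : (M.crit P).eval t =
    (M.κ * ((P.2 - 1) * t - (P.2 + 1))) ^ 2 * M.p1.eval t -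
      4 * P.1 ^ 2 * t * M.n0.eval t ^ 2 := by
  rw [crit, quad_eval, lin_eval]

/-- The numerator `a w - χ b` of `dF` near the point `(z, w)`. -/
noncomputable def psi (P : ℝ × ℝ) (z w s : ℂ) : ℂ :=
  aeval (z + s) (M.lin P.2) * branch (X * M.p1) z w s -
    P.1 * (2 * (z + s) * aeval (z + s) M.n0)

/-- The order of vanishing of the numerator of `dF` at the point `(z, w)`. -/
noncomputable def ord (P : ℝ × ℝ) (z w : ℂ) : ℕ := analyticOrderNatAt (M.psi P z w) 0

/-- The product over both sheets is -(lin² w² - 4χ² z² n₀²), and w² = z p₁ brings out the factor z.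
-/
theorem psi_mul_psi_neg (P : ℝ × ℝ) {z w : ℂ} (hw : w ≠ 0) : M.psi P z w * M.psi P z (-w) =
    (fun s => -(z + s)) * fun s => aeval (z + s) (M.crit P) := by
  funext s
  have h2 := branch_sq (f := X * M.p1) (z := z) hw s
  simp only [Pi.mul_apply, psi, branch_neg, crit, quad]
  simp only [map_sub, map_mul, map_pow, aeval_X, aeval_C] at h2 ⊢
  simp only [Complex.coe_algebraMap]
  push_cast
  linear_combination (-(aeval (z + s) (M.lin P.2)) ^ 2) * h2

section ord
variable {P : ℝ × ℝ} {z w : ℂ} (hw : w ≠ 0) (h : w ^ 2 = aeval z (X * M.p1))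
include hw h

theorem psi_analyticAt : AnalyticAt ℂ (M.psi P z w) 0 := by
  refine AnalyticAt.sub (AnalyticAt.mul (AnalyticAt.aeval_polynomial (by fun_prop) _)
    (branch_analyticAt hw h)) (AnalyticAt.mul analyticAt_const (AnalyticAt.mul (by fun_prop)
    (AnalyticAt.aeval_polynomial (by fun_prop) _)))

theorem z_ne_zero : z ≠ 0 := by
  rintro rfl; simp at h; exact hw h

theorem psi_zero : M.psi P z w 0 =
    aeval z (M.lin P.2) * w - P.1 * (2 * z * aeval z M.n0) := by
  rw [psi, branch_zero hw h, add_zero]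

theorem order_add_order (hne : M.crit P ≠ 0) :
    analyticOrderAt (M.psi P z w) 0 + analyticOrderAt (M.psi P z (-w)) 0 =
      (((M.crit P).map (algebraMap ℝ ℂ)).rootMultiplicity z : ℕ) := by
  have hw' : -w ≠ 0 := neg_ne_zero.2 hw
  have h' : (-w) ^ 2 = aeval z (X * M.p1) := by rw [neg_sq, h]
  have e : analyticOrderAt (fun s : ℂ => -(z + s)) 0 = 0 := by
    rw [AnalyticAt.analyticOrderAt_eq_zero (by fun_prop)]
    simpa using M.z_ne_zero hw h
  rw [← analyticOrderAt_mul (M.psi_analyticAt hw h) (M.psi_analyticAt hw' h'),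
    M.psi_mul_psi_neg P hw, analyticOrderAt_mul (by fun_prop)
      (AnalyticAt.aeval_polynomial (by fun_prop) _), e, zero_add, analyticOrderAt_aeval hne]

/-- An infinite order would be recorded as 0 by `analyticOrderNatAt`; it is excluded because the
orders on the two sheets have a finite sum. -/
theorem coe_ord (hne : M.crit P ≠ 0) :
    ((M.ord P z w : ℕ) : ℕ∞) = analyticOrderAt (M.psi P z w) 0 := by
  refine Nat.cast_analyticOrderNatAt fun ht => ?_
  have := M.order_add_order hw h hne
  rw [ht, top_add] at this
  exact ENat.natCast_ne_top _ this.symm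

/-- The orders on the two sheets add up to the multiplicity of the zero of `crit`. -/
theorem ord_add_ord (hne : M.crit P ≠ 0) : M.ord P z w + M.ord P z (-w) =
    ((M.crit P).map (algebraMap ℝ ℂ)).rootMultiplicity z := by
  have hw' : -w ≠ 0 := neg_ne_zero.2 hw
  have h' : (-w) ^ 2 = aeval z (X * M.p1) := by rw [neg_sq, h]
  have := M.order_add_order hw h hne
  rw [← M.coe_ord hw h hne, ← M.coe_ord hw' h' hne] at this
  exact_mod_cast this

theorem one_le_ord_iff (hne : M.crit P ≠ 0) : 1 ≤ M.ord P z w ↔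
    aeval z (M.lin P.2) * w = P.1 * (2 * z * aeval z M.n0) := by
  rw [Nat.one_le_iff_ne_zero, ← Nat.cast_ne_zero (R := ℕ∞), M.coe_ord hw h hne,
    (M.psi_analyticAt hw h).analyticOrderAt_ne_zero, M.psi_zero hw h, sub_eq_zero]

theorem two_le_ord_iff (hne : M.crit P ≠ 0) : 2 ≤ M.ord P z w ↔
    aeval z (M.lin P.2) * w = P.1 * (2 * z * aeval z M.n0) ∧
    aeval z (derivative (M.lin P.2)) * w +
      aeval z (M.lin P.2) * (aeval z (derivative (X * M.p1)) / (2 * w)) =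
      P.1 * (2 * aeval z M.n0 + 2 * z * aeval z (derivative M.n0)) := by
  have hA := M.psi_analyticAt (P := P) hw h
  have hd : HasDerivAt (M.psi P z w) (aeval z (derivative (M.lin P.2)) * w +
      aeval z (M.lin P.2) * (aeval z (derivative (X * M.p1)) / (2 * w)) -
      P.1 * (2 * aeval z M.n0 + 2 * z * aeval z (derivative M.n0))) 0 := by
    have h1 := (hasDerivAt_aeval_add (M.lin P.2) z).mul (branch_hasDerivAt hw h)
    have h2 := ((((hasDerivAt_id (0 : ℂ)).const_add z).const_mul 2).mul
      (hasDerivAt_aeval_add M.n0 z)).const_mul (P.1 : ℂ)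
    have h3 := h1.sub h2
    refine h3.congr_deriv ?_
    simp [branch_zero hw h]
  by_cases h0 : aeval z (M.lin P.2) * w = P.1 * (2 * z * aeval z M.n0)
  · have e0 : M.psi P z w 0 = 0 := by rw [M.psi_zero hw h, h0, sub_self]
    have e1 := hA.analyticOrderAt_deriv_add_one
    rw [e0] at e1
    simp only [sub_zero] at e1
    rw [show (fun x => M.psi P z w x) = M.psi P z w from rfl, ← M.coe_ord hw h hne] at e1
    have e2 : 2 ≤ M.ord P z w ↔ analyticOrderAt (deriv (M.psi P z w)) 0 ≠ 0 := by
      cases hE : analyticOrderAt (deriv (M.psi P z w)) 0 with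
      | top => rw [hE] at e1; exact absurd e1 (by simp)
      | coe n =>
        rw [hE] at e1
        have e3 : n + 1 = M.ord P z w := by exact_mod_cast e1
        have e4 : ((n : ℕ∞) ≠ 0) ↔ n ≠ 0 := by simp
        rw [e4]; omega
    rw [e2, hA.deriv.analyticOrderAt_ne_zero, hd.deriv, sub_eq_zero]
    simp [h0]
  · have : ¬ 1 ≤ M.ord P z w := by rw [M.one_le_ord_iff hw h hne]; exact h0
    constructor
    · intro h2; omega
    · intro h2; exact absurd h2.1 h0

end ord
end GapModel

/-! ### The critical point equation on the two sheets over a gap -/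

theorem aeval_ofReal (f : ℝ[X]) (t : ℝ) : aeval (t : ℂ) f = ((f.eval t : ℝ) : ℂ) := by
  rw [← eval_map_ofReal, eval_map_algebraMap]

namespace GapModel
variable (M : GapModel)

theorem lin_degree {η : ℝ} (hη : η ≠ 1) :
    (M.lin η).natDegree = 1 ∧ (M.lin η).leadingCoeff = M.κ * (η - 1) := by
  have h1 : η - 1 ≠ 0 := sub_ne_zero.2 hη
  have e : M.lin η = C (M.κ * (η - 1)) * X + C (-(M.κ * (η + 1))) := by
    simp only [lin, map_mul, map_neg]; ring
  have h2 : M.κ * (η - 1) ≠ 0 := mul_ne_zero M.κ_pos.ne' h1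
  rw [e]
  exact ⟨natDegree_linear h2, leadingCoeff_linear h2⟩

theorem crit_degree {P : ℝ × ℝ} (h : P.2 ≠ 1) : (M.crit P).natDegree = 2 * M.g + 2 ∧
    (M.crit P).leadingCoeff = (M.κ * (P.2 - 1)) ^ 2 * M.lead := by
  have h1 := M.lin_degree h
  have h2 := M.quad_degree h1.1 P.1
  rw [h1.2] at h2; exact h2

theorem crit_ne_zero {P : ℝ × ℝ} (h : P.2 ≠ 1) : M.crit P ≠ 0 := fun h0 => by
  have := (M.crit_degree h).1; rw [h0, natDegree_zero] at this; omega

theorem crit_leadingCoeff_pos {P : ℝ × ℝ} (h : P.2 ≠ 1) : 0 < (M.crit P).leadingCoeff := by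
  rw [(M.crit_degree h).2]
  have := mul_ne_zero M.κ_pos.ne' (sub_ne_zero.2 h)
  have := M.lead_pos
  positivity

/-- The coordinate `(z + 1) / (z - 1)`. -/
noncomputable def mob (z : ℝ) : ℝ := (z + 1) / (z - 1)

theorem mob_lt {a b : ℝ} (hab : a < b) (hb : b < 1) : mob b < mob a := by
  rw [mob, mob, ← neg_div_neg_eq (a + 1), ← neg_div_neg_eq (b + 1),
    div_lt_div_iff₀ (by linarith) (by linarith)]
  nlinarith

theorem mob_mem {z : ℝ} (hz : z < 0) : mob z ∈ Set.Ioo (-1 : ℝ) 1 := by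
  rw [mob]
  constructor
  · rw [lt_div_iff_of_neg (by linarith)]; linarith
  · rw [div_lt_iff_of_neg (by linarith)]; linarith

theorem mob_hasDerivAt {z : ℝ} (hz : z ≠ 1) : HasDerivAt mob (-2 / (z - 1) ^ 2) z := by
  have h1 : z - 1 ≠ 0 := sub_ne_zero.2 hz
  refine (((hasDerivAt_id z).add_const 1).div ((hasDerivAt_id z).sub_const 1) h1).congr_deriv ?_
  simp only [id]; ring

/-- The meromorphic function `z (log ρ)' · 2 / κ` on the sheet `w > 0`. -/
noncomputable def slope (z : ℝ) : ℝ :=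
  2 * z * M.n0.eval z / (M.κ * (z - 1) * √(z * M.p1.eval z))

/-- The critical point equation on the sheet with sign `σ`. -/
noncomputable def sheet (P : ℝ × ℝ) (σ z : ℝ) : ℝ := P.2 - mob z - σ * P.1 * M.slope z

section gap
variable {l : ℕ} (hl : l ∈ Finset.Icc 1 M.g) {z : ℝ} (hz : z ∈ Set.Ioo (M.lo l) (M.hi l))
include hl hz

theorem lt_zero : z < 0 := M.gap_neg hl (Set.Ioo_subset_Icc_self hz)

theorem root_pos : 0 < √(z * M.p1.eval z) := Real.sqrt_pos.2 (M.rad_pos hl hz)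

theorem denom_ne : M.κ * (z - 1) * √(z * M.p1.eval z) ≠ 0 := by
  have := M.lt_zero hl hz
  exact mul_ne_zero (mul_ne_zero M.κ_pos.ne' (by linarith)) (M.root_pos hl hz).ne'

/-- Division by κ(z - 1)w makes the critical equation affine in η and in χ with the coefficient of η
equal to 1. The parameters sharing a given zero on a given sheet therefore form a line. -/
theorem denom_mul_sheet (P : ℝ × ℝ) (σ : ℝ) :
    M.κ * (z - 1) * √(z * M.p1.eval z) * M.sheet P σ z =
      (M.lin P.2).eval z * √(z * M.p1.eval z) - σ * P.1 * (2 * z * M.n0.eval z) := by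
  have h1 := M.denom_ne hl hz
  have h2 : z - 1 ≠ 0 := by have := M.lt_zero hl hz; linarith
  rw [lin_eval, sheet, slope, mob]
  have hw := (M.root_pos hl hz).ne'
  have hk := M.κ_pos.ne'
  field_simp
  ring

theorem sheet_eq_zero_iff (P : ℝ × ℝ) (σ : ℝ) : M.sheet P σ z = 0 ↔
    (M.lin P.2).eval z * √(z * M.p1.eval z) = σ * P.1 * (2 * z * M.n0.eval z) := by
  rw [← sub_eq_zero (a := _ * _), ← M.denom_mul_sheet hl hz, mul_eq_zero,
    or_iff_right (M.denom_ne hl hz)]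

theorem slope_differentiableAt : DifferentiableAt ℝ M.slope z := by
  have h0 := (M.rad_pos hl hz).ne'
  have h1 := M.denom_ne hl hz
  unfold slope
  refine DifferentiableAt.div (by fun_prop) ?_ h1
  refine DifferentiableAt.mul (by fun_prop) (DifferentiableAt.sqrt (by fun_prop) h0)

theorem sheet_hasDerivAt (P : ℝ × ℝ) (σ : ℝ) :
    HasDerivAt (M.sheet P σ) (2 / (z - 1) ^ 2 - σ * P.1 * deriv M.slope z) z := by
  have h1 : z ≠ 1 := by have := M.lt_zero hl hz; linarith
  have := ((mob_hasDerivAt h1).const_sub P.2).sub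
    ((M.slope_differentiableAt hl hz).hasDerivAt.const_mul (σ * P.1))
  refine this.congr_deriv ?_
  ring

theorem lift_ne {σ : ℝ} (hσ : σ = 1 ∨ σ = -1) :
    ((σ * √(z * M.p1.eval z) : ℝ) : ℂ) ≠ 0 := by
  have := (M.root_pos hl hz).ne'
  have : σ ≠ 0 := by rcases hσ with rfl | rfl <;> norm_num
  norm_cast
  positivity

theorem lift_sq {σ : ℝ} (hσ : σ = 1 ∨ σ = -1) :
    ((σ * √(z * M.p1.eval z) : ℝ) : ℂ) ^ 2 = aeval (z : ℂ) (X * M.p1) := by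
  have h1 := Real.sq_sqrt (M.rad_pos hl hz).le
  rw [aeval_ofReal]
  norm_cast
  rw [mul_pow, h1]
  rcases hσ with rfl | rfl <;> simp

theorem one_le_ord_sheet {P : ℝ × ℝ} (hP : P.2 ≠ 1) {σ : ℝ} (hσ : σ = 1 ∨ σ = -1) :
    1 ≤ M.ord P z ((σ * √(z * M.p1.eval z) : ℝ) : ℂ) ↔ M.sheet P σ z = 0 := by
  rw [M.one_le_ord_iff (M.lift_ne hl hz hσ) (M.lift_sq hl hz hσ) (M.crit_ne_zero hP),
    M.sheet_eq_zero_iff hl hz, aeval_ofReal, aeval_ofReal]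
  norm_cast
  rcases hσ with rfl | rfl
  · simp
  · constructor <;> intro h <;> linarith

/-- The numerator of dF and `sheet` differ by a nonvanishing factor, so at a common zero their
derivatives vanish together. -/
theorem two_le_ord_sheet {P : ℝ × ℝ} (hP : P.2 ≠ 1) {σ : ℝ} (hσ : σ = 1 ∨ σ = -1) :
    2 ≤ M.ord P z ((σ * √(z * M.p1.eval z) : ℝ) : ℂ) ↔
      M.sheet P σ z = 0 ∧ 2 / (z - 1) ^ 2 - σ * P.1 * deriv M.slope z = 0 := by
  rw [M.two_le_ord_iff (M.lift_ne hl hz hσ) (M.lift_sq hl hz hσ) (M.crit_ne_zero hP),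
    ← M.one_le_ord_iff (M.lift_ne hl hz hσ) (M.lift_sq hl hz hσ) (M.crit_ne_zero hP),
    M.one_le_ord_sheet hl hz hP hσ]
  refine and_congr_right fun h0 => ?_
  have hrad := M.rad_pos hl hz
  set w := √(z * M.p1.eval z) with hw
  have hw0 : 0 < w := M.root_pos hl hz
  -- the real numerator and its derivative
  have e1 : HasDerivAt (fun t => (M.lin P.2).eval t * √(t * M.p1.eval t) -
      σ * P.1 * (2 * t * M.n0.eval t)) ((derivative (M.lin P.2)).eval z * w +
        (M.lin P.2).eval z * ((derivative (X * M.p1)).eval z / (2 * w)) -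
        σ * P.1 * (2 * M.n0.eval z + 2 * z * (derivative M.n0).eval z)) z := by
    have hp : HasDerivAt (fun t => t * M.p1.eval t) ((derivative (X * M.p1)).eval z) z := by
      have := (X * M.p1).hasDerivAt z
      simpa using this
    have h1 := ((M.lin P.2).hasDerivAt z).mul (hp.sqrt hrad.ne')
    have h2 := ((((hasDerivAt_id z).const_mul 2).mul (M.n0.hasDerivAt z))).const_mul (σ * P.1)
    refine (h1.sub h2).congr_deriv ?_
    simp [hw]
  have e2 : HasDerivAt (fun t => M.κ * (t - 1) * √(t * M.p1.eval t) * M.sheet P σ t)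
      (M.κ * (z - 1) * w * (2 / (z - 1) ^ 2 - σ * P.1 * deriv M.slope z)) z := by
    have hd : DifferentiableAt ℝ (fun t => M.κ * (t - 1) * √(t * M.p1.eval t)) z :=
      DifferentiableAt.mul (by fun_prop) (DifferentiableAt.sqrt (by fun_prop) hrad.ne')
    have := hd.hasDerivAt.mul (M.sheet_hasDerivAt hl hz P σ)
    refine this.congr_deriv ?_
    rw [h0]; ring
  have e3 : (fun t => M.κ * (t - 1) * √(t * M.p1.eval t) * M.sheet P σ t) =ᶠ[nhds z]
      (fun t => (M.lin P.2).eval t * √(t * M.p1.eval t) - σ * P.1 * (2 * t * M.n0.eval t)) := by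
    filter_upwards [Ioo_mem_nhds hz.1 hz.2] with t ht
    exact M.denom_mul_sheet hl ht P σ
  have e4 := (e1.congr_of_eventuallyEq e3).unique e2
  rw [← mul_right_inj' (M.denom_ne hl hz), mul_zero, ← hw, ← e4]
  simp only [aeval_ofReal]
  have hs : σ * σ = 1 := by rcases hσ with rfl | rfl <;> norm_num
  have hs0 : σ ≠ 0 := by rintro rfl; simp at hs
  have hsi : σ⁻¹ = σ := by field_simp; nlinarith
  have key : ∀ a b c d e : ℝ, ((a : ℂ) * ((σ * w : ℝ) : ℂ) + b * (c / (2 * ((σ * w : ℝ) : ℂ))) =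
      P.1 * (2 * d + 2 * z * e)) ↔ a * w + b * (c / (2 * w)) - σ * P.1 * (2 * d + 2 * z * e) = 0 := by
    intro a b c d e
    norm_cast
    have e5 : c / (2 * (σ * w)) = σ * (c / (2 * w)) := by
      rw [show c / (2 * (σ * w)) = σ⁻¹ * (c / (2 * w)) by field_simp, hsi]
    rw [e5]
    constructor
    · intro h; linear_combination σ * h - (a * w + b * (c / (2 * w))) * hs
    · intro h; linear_combination σ * h + P.1 * (2 * d + 2 * z * e) * hs
  exact key _ _ _ _ _

theorem rootMultiplicity_crit {P : ℝ × ℝ} (hP : P.2 ≠ 1) {σ : ℝ} (hσ : σ = 1 ∨ σ = -1) :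
    (M.crit P).rootMultiplicity z = M.ord P z ((σ * √(z * M.p1.eval z) : ℝ) : ℂ) +
      M.ord P z (((-σ) * √(z * M.p1.eval z) : ℝ) : ℂ) := by
  rw [eq_rootMultiplicity_map (algebraMap ℝ ℂ).injective z, Complex.coe_algebraMap,
    ← M.ord_add_ord (M.lift_ne hl hz hσ) (M.lift_sq hl hz hσ) (M.crit_ne_zero hP)]
  congr 2
  push_cast; ring

end gap

section monotone
variable {l : ℕ} (hl : l ∈ Finset.Icc 1 M.g)
include hl

theorem exists_slope_eq (μ : ℝ) : ∃ z ∈ Set.Ioo (M.lo l) (M.hi l), M.slope z = μ := by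
  obtain ⟨z, hz, h⟩ := M.sheet_zero (C (M.κ * μ) * (X - C 1)) one_ne_zero hl
  refine ⟨z, hz, ?_⟩
  rw [slope, div_eq_iff (M.denom_ne hl hz)]
  simp only [eval_mul, eval_C, eval_sub, eval_X] at h
  linarith

/-- The equation slope² = μ² is `quad` with A = κμ(z - 1) and χ = 1. This polynomial is positive at
0, negative at 1, where A vanishes, and positive far to the right, so its two free zeros are
positive and each gap holds exactly two. One of these belongs to the value -μ, which leaves only one
for μ. For μ = 0 the only zero of `slope` in the gap is the zero of n₀. -/
theorem slope_injOn : Set.InjOn M.slope (Set.Ioo (M.lo l) (M.hi l)) := by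
  intro y hy z hz hyz
  by_contra hne
  obtain ⟨v, hv, hvs⟩ := M.exists_slope_eq hl (-M.slope y)
  by_cases h0 : M.slope y = 0
  · have hn : ∀ t ∈ Set.Ioo (M.lo l) (M.hi l), M.slope t = 0 → t = M.c l := by
      intro t ht h
      rw [slope, div_eq_zero_iff, or_iff_left (M.denom_ne hl ht)] at h
      have := M.lt_zero hl ht
      rw [← M.n0_eq_zero_iff hl (Set.Ioo_subset_Icc_self ht)]
      simpa [this.ne] using h
    exact hne ((hn y hy h0).trans (hn z hz (hyz ▸ h0)).symm)
  set μ := M.slope y with hμ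
  have hκμ : M.κ * μ ≠ 0 := mul_ne_zero M.κ_pos.ne' h0
  set A : ℝ[X] := C (M.κ * μ) * (X - C 1) with hA
  have hAd : A.natDegree = 1 := by rw [hA, natDegree_C_mul hκμ, natDegree_X_sub_C]
  have hAl : A.leadingCoeff = M.κ * μ := by
    rw [hA, leadingCoeff_mul, leadingCoeff_C, leadingCoeff_X_sub_C, mul_one]
  obtain ⟨hd, hlc⟩ := M.quad_degree hAd 1
  rw [hAl] at hlc
  set f := M.quad A 1 with hf
  have hf0 : f ≠ 0 := fun h => by rw [h, natDegree_zero] at hd; omega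
  have hlp : 0 < f.leadingCoeff := by rw [hlc]; have := M.lead_pos; positivity
  have hroot : ∀ t ∈ Set.Ioo (M.lo l) (M.hi l), ∀ s : ℝ, s ^ 2 = 1 → M.slope t = s * μ →
      f.eval t = 0 := by
    intro t ht s hs hst
    refine M.quad_eval_zero_of_sheet (A := A) (χ := 1) (s := s) (by rw [hs]; norm_num) hl ht ?_
    rw [slope, div_eq_iff (M.denom_ne hl ht)] at hst
    simp only [hA, eval_mul, eval_C, eval_sub, eval_X]
    rw [hst]
    linear_combination (-(M.κ * μ * (t - 1) * √(t * M.p1.eval t))) * hs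
  have hgap : 3 ≤ cnt f (M.gapC l) := by
    have hyv : y ≠ v := fun h => h0 (by rw [← h] at hvs; linarith)
    have hzv : z ≠ v := fun h => h0 (by rw [← h, ← hyz] at hvs; linarith)
    have := sum_rootMultiplicity_le_cnt f (I := M.gapC l) {y, z, v} (by
      simp only [Finset.mem_insert, Finset.mem_singleton, M.ofReal_mem_gapC]
      rintro t (rfl | rfl | rfl)
      · exact Set.Ioo_subset_Icc_self hy
      · exact Set.Ioo_subset_Icc_self hz
      · exact Set.Ioo_subset_Icc_self hv)
    rw [Finset.sum_insert (by simp [hne, hyv]), Finset.sum_pair hzv] at this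
    have := one_le_rootMultiplicity hf0 (hroot y hy 1 (by norm_num) (by rw [one_mul]))
    have := one_le_rootMultiplicity hf0 (hroot z hz 1 (by norm_num) (by rw [one_mul, hyz]))
    have := one_le_rootMultiplicity hf0 (hroot v hv (-1) (by norm_num) (by rw [hvs]; ring))
    omega
  have hpos : 2 ≤ cnt f GapData.posC := by
    have f0 : 0 < f.eval 0 := by
      rw [hf, quad_eval, hA]
      have := M.p1_pos_of_nonneg le_rfl
      simp; positivity
    have f1 : f.eval 1 < 0 := by
      rw [hf, quad_eval, hA]
      have := M.n0_eval_nonneg_ne zero_le_one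
      simp; positivity
    obtain ⟨r, hr, hr0⟩ := intermediate_value_Ioo' zero_le_one f.continuous.continuousOn ⟨f1, f0⟩
    obtain ⟨s, hs, hs0⟩ := exists_root_gt (by omega) hlp f1
    have hrs : r ≠ s := (hr.2.trans hs).ne
    have := sum_rootMultiplicity_le_cnt f (I := GapData.posC) {r, s} (by
      simp only [Finset.mem_insert, Finset.mem_singleton, GapData.ofReal_mem_posC]
      rintro t (rfl | rfl)
      · exact hr.1
      · linarith)
    rw [Finset.sum_pair hrs] at this
    have := one_le_rootMultiplicity hf0 hr0
    have := one_le_rootMultiplicity hf0 hs0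
    omega
  have := M.cnt_bound_one hd (fun j hj => M.two_le_quad_cnt_of_ne one_ne_zero hf0 hj) hl
  omega

theorem slope_continuousOn : ContinuousOn M.slope (Set.Ioo (M.lo l) (M.hi l)) := fun _ hz =>
  (M.slope_differentiableAt hl hz).continuousAt.continuousWithinAt

theorem sheet_continuousOn (P : ℝ × ℝ) (σ : ℝ) :
    ContinuousOn (M.sheet P σ) (Set.Ioo (M.lo l) (M.hi l)) := fun _ hz =>
  (M.sheet_hasDerivAt hl hz P σ).continuousAt.continuousWithinAt

/-- On one of the two sheets `χ · slope` increases. -/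
theorem exists_sign {χ : ℝ} (hχ : χ ≠ 0) : ∃ τ : ℝ, (τ = 1 ∨ τ = -1) ∧
    StrictMonoOn (fun z => τ * χ * M.slope z) (Set.Ioo (M.lo l) (M.hi l)) := by
  rcases (M.slope_continuousOn hl).strictMonoOn_of_injOn_Ioo (M.lo_lt_hi l hl)
    (M.slope_injOn hl) with h | h
  · rcases lt_or_gt_of_ne hχ with hc | hc
    · exact ⟨-1, Or.inr rfl, fun a ha b hb hab => by
        have := h ha hb hab; simp only; nlinarith⟩
    · exact ⟨1, Or.inl rfl, fun a ha b hb hab => by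
        have := h ha hb hab; simp only; nlinarith⟩
  · rcases lt_or_gt_of_ne hχ with hc | hc
    · exact ⟨1, Or.inl rfl, fun a ha b hb hab => by
        have := h ha hb hab; simp only; nlinarith⟩
    · exact ⟨-1, Or.inr rfl, fun a ha b hb hab => by
        have := h ha hb hab; simp only; nlinarith⟩

end monotone
end GapModel

theorem sign_neg {σ : ℝ} (h : σ = 1 ∨ σ = -1) : -σ = 1 ∨ -σ = -1 := by
  rcases h with rfl | rfl <;> norm_num

namespace GapModel
variable (M : GapModel)

/-! ### Regions of the square in terms of the reduced data -/

/-- All critical points but those forced in the other gaps lie over the gap `l`. -/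
def inner (l : ℕ) : Set (ℝ × ℝ) := {P | P ∈ square ∧ 4 ≤ cnt (M.crit P) (M.gapC l)}

/-- The equation changes sign from negative to positive on both sheets over the gap `l`. -/
def alternating (l : ℕ) : Set (ℝ × ℝ) :=
  {P | P ∈ square ∧ ∀ σ : ℝ, σ = 1 ∨ σ = -1 → ∃ a ∈ Set.Ioo (M.lo l) (M.hi l),
    ∃ b ∈ Set.Ioo (M.lo l) (M.hi l), a < b ∧ M.sheet P σ a < 0 ∧ 0 < M.sheet P σ b}

theorem square_ne {P : ℝ × ℝ} (h : P ∈ square) : P.2 ≠ 1 := h.2.2.ne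

theorem two_le_cnt_gap {P : ℝ × ℝ} (h : P ∈ square) {l : ℕ} (hl : l ∈ Finset.Icc 1 M.g) :
    2 ≤ cnt (M.crit P) (M.gapC l) :=
  M.two_le_quad_cnt (M.crit_ne_zero (square_ne h)) hl

theorem cnt_gap_le_four {P : ℝ × ℝ} (h : P ∈ square) {l : ℕ} (hl : l ∈ Finset.Icc 1 M.g) :
    cnt (M.crit P) M.restC + cnt (M.crit P) GapData.posC + cnt (M.crit P) (M.gapC l) ≤ 4 :=
  M.cnt_bound_one (M.crit_degree (square_ne h)).1 (fun _ hj => M.two_le_cnt_gap h hj) hl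

theorem cnt_rest_le_two {P : ℝ × ℝ} (h : P ∈ square) :
    cnt (M.crit P) M.restC + cnt (M.crit P) GapData.posC ≤ 2 :=
  M.cnt_bound_zero (M.crit_degree (square_ne h)).1 (fun _ hj => M.two_le_cnt_gap h hj)

section
variable {l : ℕ} (hl : l ∈ Finset.Icc 1 M.g) {P : ℝ × ℝ} (hP : P ∈ square)
include hl hP

/-- The order of vanishing on the sheet with sign `σ` over the gap. -/
theorem sum_ord_le (S : Finset ℝ) (hS : ∀ t ∈ S, t ∈ Set.Ioo (M.lo l) (M.hi l)) {σ : ℝ}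
    (hσ : σ = 1 ∨ σ = -1) :
    ∑ t ∈ S, M.ord P t ((σ * √(t * M.p1.eval t) : ℝ) : ℂ) +
      ∑ t ∈ S, M.ord P t (((-σ) * √(t * M.p1.eval t) : ℝ) : ℂ) ≤ cnt (M.crit P) (M.gapC l) := by
  rw [← Finset.sum_add_distrib, ← Finset.sum_congr rfl fun t ht =>
    M.rootMultiplicity_crit hl (hS t ht) (square_ne hP) hσ]
  exact sum_rootMultiplicity_le_cnt _ S fun t ht =>
    M.ofReal_mem_gapC.2 (Set.Ioo_subset_Icc_self (hS t ht))

omit hP in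
theorem exists_sheet_zero (hχ : P.1 ≠ 0) {σ : ℝ} (hσ : σ = 1 ∨ σ = -1) :
    ∃ z ∈ Set.Ioo (M.lo l) (M.hi l), M.sheet P σ z = 0 := by
  have hs : σ * P.1 ≠ 0 := mul_ne_zero (by rcases hσ with rfl | rfl <;> norm_num) hχ
  obtain ⟨z, hz, h⟩ := M.sheet_zero (M.lin P.2) hs hl
  exact ⟨z, hz, (M.sheet_eq_zero_iff hl hz P σ).2 h⟩

section monotone
variable {τ : ℝ} (hτ : τ = 1 ∨ τ = -1)
  (hmono : StrictMonoOn (fun z => τ * P.1 * M.slope z) (Set.Ioo (M.lo l) (M.hi l)))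
include hτ hmono

omit hP hτ in
-- On this sheet both terms, -mob and τχ · slope, increase.
theorem sheet_neg_strictMonoOn : StrictMonoOn (M.sheet P (-τ)) (Set.Ioo (M.lo l) (M.hi l)) := by
  intro a ha b hb hab
  have h1 := mob_lt hab (by have := M.lt_zero hl hb; linarith)
  have h2 := hmono ha hb hab
  simp only [sheet] at h2 ⊢
  linarith

omit hP hτ in
theorem deriv_slope_nonneg {z : ℝ} (hz : z ∈ Set.Ioo (M.lo l) (M.hi l)) :
    0 ≤ τ * P.1 * deriv M.slope z := by
  have h1 := (M.slope_differentiableAt hl hz).hasDerivAt.const_mul (τ * P.1)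
  have h2 : 0 ≤ derivWithin (fun z => τ * P.1 * M.slope z) (Set.Ioo (M.lo l) (M.hi l)) z :=
    hmono.monotoneOn.derivWithin_nonneg
  rwa [h1.hasDerivWithinAt.derivWithin (isOpen_Ioo.uniqueDiffWithinAt hz)] at h2

omit hP hτ hmono in
theorem ne_one_of_gap {z : ℝ} (hz : z ∈ Set.Ioo (M.lo l) (M.hi l)) : 0 < 2 / (z - 1) ^ 2 := by
  have := M.lt_zero hl hz
  have : z - 1 ≠ 0 := by linarith
  positivity

theorem ord_neg_le_one {z : ℝ} (hz : z ∈ Set.Ioo (M.lo l) (M.hi l)) :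
    M.ord P z (((-τ) * √(z * M.p1.eval z) : ℝ) : ℂ) ≤ 1 := by
  by_contra h
  have h1 := (M.two_le_ord_sheet hl hz (square_ne hP) (sign_neg hτ)).1 (by omega)
  have h2 := M.deriv_slope_nonneg hl hmono hz
  have h3 := M.ne_one_of_gap hl hz
  linarith [h1.2]

omit hτ in
theorem exists_left : ∃ a ∈ Set.Ioo (M.lo l) (M.hi l), ∀ z ∈ Set.Ioo (M.lo l) (M.hi l), z ≤ a →
    0 < M.sheet P τ z := by
  have hne : τ * P.1 ≠ 0 := by
    intro h0
    have h1 := M.lo_lt_hi l hl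
    have := hmono (a := (2 * M.lo l + M.hi l) / 3) ⟨by linarith, by linarith⟩
      (b := (M.lo l + 2 * M.hi l) / 3) ⟨by linarith, by linarith⟩ (by linarith)
    simp [h0] at this
  -- η and mob z both lie in (-1, 1), so their difference cannot outweigh 2.
  obtain ⟨a, ha, h⟩ := M.exists_slope_eq hl (-2 / (τ * P.1))
  refine ⟨a, ha, fun z hz hza => ?_⟩
  have h1 := hmono.monotoneOn hz ha hza
  simp only [h] at h1
  rw [mul_div_cancel₀ _ hne] at h1
  have h2 := (mob_mem (M.lt_zero hl hz)).2
  have h3 := hP.2.1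
  rw [sheet]; linarith

omit hτ in
theorem exists_right : ∃ b ∈ Set.Ioo (M.lo l) (M.hi l), ∀ z ∈ Set.Ioo (M.lo l) (M.hi l), b ≤ z →
    M.sheet P τ z < 0 := by
  have hne : τ * P.1 ≠ 0 := by
    intro h0
    have h1 := M.lo_lt_hi l hl
    have := hmono (a := (2 * M.lo l + M.hi l) / 3) ⟨by linarith, by linarith⟩
      (b := (M.lo l + 2 * M.hi l) / 3) ⟨by linarith, by linarith⟩ (by linarith)
    simp [h0] at this
  obtain ⟨a, ha, h⟩ := M.exists_slope_eq hl (2 / (τ * P.1))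
  refine ⟨a, ha, fun z hz hza => ?_⟩
  have h1 := hmono.monotoneOn ha hz hza
  simp only [h] at h1
  rw [mul_div_cancel₀ _ hne] at h1
  have h2 := (mob_mem (M.lt_zero hl hz)).1
  have h3 := hP.2.2
  rw [sheet]; linarith

/-- On the other sheet the sign change from negative to positive is automatic. -/
theorem mem_alternating_iff (hχ : P.1 ≠ 0) : P ∈ M.alternating l ↔
    ∃ a ∈ Set.Ioo (M.lo l) (M.hi l), ∃ b ∈ Set.Ioo (M.lo l) (M.hi l), a < b ∧
      M.sheet P τ a < 0 ∧ 0 < M.sheet P τ b := by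
  refine ⟨fun h => h.2 τ hτ, fun h => ⟨hP, fun σ hσ => ?_⟩⟩
  have : σ = τ ∨ σ = -τ := by
    rcases hσ with rfl | rfl <;> rcases hτ with rfl | rfl <;> norm_num
  rcases this with rfl | rfl
  · exact h
  · obtain ⟨z, hz, h0⟩ := M.exists_sheet_zero hl hχ (sign_neg hτ)
    have hm := M.sheet_neg_strictMonoOn hl hmono
    have ha : (M.lo l + z) / 2 ∈ Set.Ioo (M.lo l) (M.hi l) :=
      ⟨by linarith [hz.1], by linarith [hz.1, hz.2]⟩
    have hb : (z + M.hi l) / 2 ∈ Set.Ioo (M.lo l) (M.hi l) :=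
      ⟨by linarith [hz.1, hz.2], by linarith [hz.2]⟩
    refine ⟨_, ha, _, hb, by linarith [hz.1, hz.2], ?_, ?_⟩
    · rw [← h0]; exact hm ha hz (by linarith [hz.1])
    · rw [← h0]; exact hm hz hb (by linarith [hz.2])

omit hτ in
/-- Without alternation the equation changes sign exactly once on the sheet. -/
theorem exists_crossing (hn : ¬ ∃ a ∈ Set.Ioo (M.lo l) (M.hi l), ∃ b ∈ Set.Ioo (M.lo l) (M.hi l),
      a < b ∧ M.sheet P τ a < 0 ∧ 0 < M.sheet P τ b) :
    ∃ z ∈ Set.Ioo (M.lo l) (M.hi l), M.sheet P τ z = 0 ∧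
      (∀ t ∈ Set.Ioo (M.lo l) (M.hi l), t < z → 0 ≤ M.sheet P τ t) ∧
      (∀ t ∈ Set.Ioo (M.lo l) (M.hi l), z < t → M.sheet P τ t ≤ 0) := by
  obtain ⟨a, ha, hA⟩ := M.exists_left hl hP hmono
  obtain ⟨b, hb, hB⟩ := M.exists_right hl hP hmono
  -- The crossing is the supremum of the points where the equation is positive: a negative value to
  -- its left would be followed by a positive one.
  set S := {t ∈ Set.Ioo (M.lo l) (M.hi l) | 0 < M.sheet P τ t} with hS
  have haS : a ∈ S := ⟨ha, hA a ha le_rfl⟩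
  have hbS : ∀ t ∈ S, t ≤ b := fun t ht => by
    by_contra hbt
    exact absurd ht.2 (hB t ht.1 (not_le.1 hbt).le).not_gt
  have hbdd : BddAbove S := ⟨b, hbS⟩
  have hz : sSup S ∈ Set.Ioo (M.lo l) (M.hi l) :=
    ⟨ha.1.trans_le (le_csSup hbdd haS), (csSup_le ⟨a, haS⟩ hbS).trans_lt hb.2⟩
  have hleft : ∀ t ∈ Set.Ioo (M.lo l) (M.hi l), t < sSup S → 0 ≤ M.sheet P τ t := by
    intro t ht htz
    by_contra hneg
    obtain ⟨s, hs, hts⟩ := exists_lt_of_lt_csSup ⟨a, haS⟩ htz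
    exact hn ⟨t, ht, s, hs.1, hts, not_le.1 hneg, hs.2⟩
  have hright : ∀ t ∈ Set.Ioo (M.lo l) (M.hi l), sSup S < t → M.sheet P τ t ≤ 0 := by
    intro t ht htz
    by_contra hpos
    exact absurd (le_csSup hbdd (show t ∈ S from ⟨ht, not_le.1 hpos⟩)) htz.not_ge
  refine ⟨sSup S, hz, le_antisymm ?_ ?_, hleft, hright⟩
  · refine le_of_not_gt fun hpos => ?_
    have := (M.sheet_hasDerivAt hl hz P τ).continuousAt.eventually_const_lt hpos
    have h2 : ∀ᶠ t in nhds (sSup S), t ∈ Set.Ioo (M.lo l) (M.hi l) := Ioo_mem_nhds hz.1 hz.2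
    obtain ⟨t, ht, htz⟩ := ((this.and h2).filter_mono nhdsWithin_le_nhds |>.and
      (self_mem_nhdsWithin (s := Set.Ioi (sSup S)))).exists
    exact absurd (hright t ht.2 htz) ht.1.not_ge
  · refine le_of_not_gt fun hneg => ?_
    have := (M.sheet_hasDerivAt hl hz P τ).continuousAt.eventually_lt_const hneg
    have h2 : ∀ᶠ t in nhds (sSup S), t ∈ Set.Ioo (M.lo l) (M.hi l) := Ioo_mem_nhds hz.1 hz.2
    obtain ⟨t, ht, htz⟩ := ((this.and h2).filter_mono nhdsWithin_le_nhds |>.and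
      (self_mem_nhdsWithin (s := Set.Iio (sSup S)))).exists
    exact absurd (hleft t ht.2 htz) ht.1.not_ge

omit hmono in
theorem two_le_ord_of_extr {z : ℝ} (hz : z ∈ Set.Ioo (M.lo l) (M.hi l))
    (h0 : M.sheet P τ z = 0) (he : IsLocalExtr (M.sheet P τ) z) :
    2 ≤ M.ord P z ((τ * √(z * M.p1.eval z) : ℝ) : ℂ) :=
  (M.two_le_ord_sheet hl hz (square_ne hP) hτ).2
    ⟨h0, he.hasDerivAt_eq_zero (M.sheet_hasDerivAt hl hz P τ)⟩

omit hmono in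
/-- A zero other than the sign change has order at least two. -/
theorem two_le_ord_of_ne_crossing {z : ℝ}
    (hleft : ∀ t ∈ Set.Ioo (M.lo l) (M.hi l), t < z → 0 ≤ M.sheet P τ t)
    (hright : ∀ t ∈ Set.Ioo (M.lo l) (M.hi l), z < t → M.sheet P τ t ≤ 0)
    {y : ℝ} (hy : y ∈ Set.Ioo (M.lo l) (M.hi l)) (hyz : y ≠ z) (h0 : M.sheet P τ y = 0) :
    2 ≤ M.ord P y ((τ * √(y * M.p1.eval y) : ℝ) : ℂ) := by
  refine M.two_le_ord_of_extr hl hP hτ hy h0 ?_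
  have h2 : ∀ᶠ t in nhds y, t ∈ Set.Ioo (M.lo l) (M.hi l) := Ioo_mem_nhds hy.1 hy.2
  rcases lt_or_gt_of_ne hyz with h | h
  · left
    filter_upwards [h2, Iio_mem_nhds h] with t ht htz
    rw [h0]; exact hleft t ht htz
  · right
    filter_upwards [h2, Ioi_mem_nhds h] with t ht htz
    rw [h0]; exact hright t ht htz

omit hτ in
-- With the signs near the two ends the pattern is +, -, +, -, which gives three crossings.
theorem three_zeros (h : ∃ a ∈ Set.Ioo (M.lo l) (M.hi l), ∃ b ∈ Set.Ioo (M.lo l) (M.hi l),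
      a < b ∧ M.sheet P τ a < 0 ∧ 0 < M.sheet P τ b) :
    ∃ x y z : ℝ, x < y ∧ y < z ∧ ∀ t ∈ ({x, y, z} : Finset ℝ),
      t ∈ Set.Ioo (M.lo l) (M.hi l) ∧ M.sheet P τ t = 0 := by
  obtain ⟨a, ha, b, hb, hab, hA, hB⟩ := h
  obtain ⟨c, hc, hC⟩ := M.exists_left hl hP hmono
  obtain ⟨d, hd, hD⟩ := M.exists_right hl hP hmono
  have hca : c < a := by
    by_contra h; exact absurd (hC a ha (not_lt.1 h)) hA.not_gt
  have hbd : b < d := by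
    by_contra h; exact absurd (hD b hb (not_lt.1 h)) hB.not_gt
  have hcont := M.sheet_continuousOn hl P τ
  have sub : ∀ u ∈ Set.Ioo (M.lo l) (M.hi l), ∀ v ∈ Set.Ioo (M.lo l) (M.hi l),
      Set.Icc u v ⊆ Set.Ioo (M.lo l) (M.hi l) := fun u hu v hv t ht =>
    ⟨hu.1.trans_le ht.1, ht.2.trans_lt hv.2⟩
  obtain ⟨x, hx, hx0⟩ := intermediate_value_Ioo' hca.le (hcont.mono (sub c hc a ha))
    ⟨hA, hC c hc le_rfl⟩
  obtain ⟨y, hy, hy0⟩ := intermediate_value_Ioo hab.le (hcont.mono (sub a ha b hb)) ⟨hA, hB⟩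
  obtain ⟨z, hz, hz0⟩ := intermediate_value_Ioo' hbd.le (hcont.mono (sub b hb d hd))
    ⟨hD d hd le_rfl, hB⟩
  refine ⟨x, y, z, hx.2.trans hy.1, hy.2.trans hz.1, ?_⟩
  simp only [Finset.mem_insert, Finset.mem_singleton]
  rintro t (rfl | rfl | rfl)
  · exact ⟨sub c hc a ha (Set.Ioo_subset_Icc_self hx), hx0⟩
  · exact ⟨sub a ha b hb (Set.Ioo_subset_Icc_self hy), hy0⟩
  · exact ⟨sub b hb d hd (Set.Ioo_subset_Icc_self hz), hz0⟩

omit hmono in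
/-- Zeros on the sheet `τ` counted with order, plus the zero on the other sheet. -/
theorem sum_ord_add_one_le (hχ : P.1 ≠ 0) (S : Finset ℝ)
    (hS : ∀ t ∈ S, t ∈ Set.Ioo (M.lo l) (M.hi l)) :
    ∑ t ∈ S, M.ord P t ((τ * √(t * M.p1.eval t) : ℝ) : ℂ) + 1 ≤
      cnt (M.crit P) (M.gapC l) := by
  obtain ⟨z, hz, h0⟩ := M.exists_sheet_zero hl hχ (sign_neg hτ)
  have h1 := M.sum_ord_le hl hP (insert z S) (by
    intro t ht
    rcases Finset.mem_insert.1 ht with rfl | h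
    · exact hz
    · exact hS t h) hτ
  have h2 : ∑ t ∈ S, M.ord P t ((τ * √(t * M.p1.eval t) : ℝ) : ℂ) ≤
      ∑ t ∈ insert z S, M.ord P t ((τ * √(t * M.p1.eval t) : ℝ) : ℂ) :=
    Finset.sum_le_sum_of_subset (Finset.subset_insert _ _)
  have h3 := Finset.single_le_sum (f := fun t : ℝ => M.ord P t (((-τ) * √(t * M.p1.eval t) : ℝ) : ℂ))
    (fun _ _ => Nat.zero_le _) (Finset.mem_insert_self z S)
  have h4 := (M.one_le_ord_sheet hl hz (square_ne hP) (sign_neg hτ)).2 h0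
  omega

/-- Alternation excludes critical points of higher order. -/
theorem ord_le_one_of_alternating (hχ : P.1 ≠ 0)
    (h : ∃ a ∈ Set.Ioo (M.lo l) (M.hi l), ∃ b ∈ Set.Ioo (M.lo l) (M.hi l),
      a < b ∧ M.sheet P τ a < 0 ∧ 0 < M.sheet P τ b) {u : ℝ}
    (hu : u ∈ Set.Ioo (M.lo l) (M.hi l)) :
    M.ord P u ((τ * √(u * M.p1.eval u) : ℝ) : ℂ) ≤ 1 := by
  by_contra hcon
  obtain ⟨x, y, z, hxy, hyz, hT⟩ := M.three_zeros hl hP hmono h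
  set T : Finset ℝ := {x, y, z} with hTdef
  have hcard : T.card = 3 := by
    rw [hTdef, Finset.card_insert_of_notMem (by simp [hxy.ne, (hxy.trans hyz).ne]),
      Finset.card_pair hyz.ne]
  have hone : ∀ t ∈ T, 1 ≤ M.ord P t ((τ * √(t * M.p1.eval t) : ℝ) : ℂ) := fun t ht =>
    (M.one_le_ord_sheet hl (hT t ht).1 (square_ne hP) hτ).2 (hT t ht).2
  have h1 := M.sum_ord_add_one_le hl hP hτ hχ (insert u T) (by
    intro t ht
    rcases Finset.mem_insert.1 ht with rfl | h
    · exact hu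
    · exact (hT t h).1)
  have h2 := M.cnt_gap_le_four hP hl
  -- Whether or not `u` is one of the three zeros, at least two of them differ from it. With order
  -- two at `u` and one zero on the other sheet the total is five, but the gap holds at most four.
  have h3 : 2 ≤ ∑ t ∈ T.erase u, M.ord P t ((τ * √(t * M.p1.eval t) : ℝ) : ℂ) := by
    have : ∑ _t ∈ T.erase u, 1 ≤
        ∑ t ∈ T.erase u, M.ord P t ((τ * √(t * M.p1.eval t) : ℝ) : ℂ) :=
      Finset.sum_le_sum fun t ht => hone t (Finset.mem_of_mem_erase ht)
    rw [Finset.sum_const, smul_eq_mul, mul_one] at this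
    have := Finset.pred_card_le_card_erase (s := T) (a := u)
    omega
  have h4 : insert u T = insert u (T.erase u) := by
    ext t; by_cases h : t = u <;> simp [h]
  rw [h4, Finset.sum_insert (by simp)] at h1
  omega

theorem inner_of_alternating (hχ : P.1 ≠ 0) (h : P ∈ M.alternating l) : P ∈ M.inner l := by
  refine ⟨hP, ?_⟩
  obtain ⟨x, y, z, hxy, hyz, hT⟩ := M.three_zeros hl hP hmono (h.2 τ hτ)
  have h1 := M.sum_ord_add_one_le hl hP hτ hχ {x, y, z} (fun t ht => (hT t ht).1)
  have h2 : ∑ _t ∈ ({x, y, z} : Finset ℝ), 1 ≤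
      ∑ t ∈ ({x, y, z} : Finset ℝ), M.ord P t ((τ * √(t * M.p1.eval t) : ℝ) : ℂ) :=
    Finset.sum_le_sum fun t ht =>
      (M.one_le_ord_sheet hl (hT t ht).1 (square_ne hP) hτ).2 (hT t ht).2
  rw [Finset.sum_const, smul_eq_mul, mul_one,
    Finset.card_insert_of_notMem (by simp [hxy.ne, (hxy.trans hyz).ne]),
    Finset.card_pair hyz.ne] at h2
  omega

omit hP hτ hmono in
theorem crit_lo_ne (hχ : P.1 ≠ 0) : (M.crit P).eval (M.lo l) ≠ 0 := by
  have h1 := M.gap_neg hl (Set.left_mem_Icc.2 (M.lo_lt_hi l hl).le)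
  have h2 : M.n0.eval (M.lo l) ≠ 0 := fun h => by
    have := M.n0_ends hl; rw [h, zero_mul] at this; exact lt_irrefl _ this
  rw [crit_eval, M.p1_lo hl]
  simp [hχ, h1.ne, h2]

omit hP hτ hmono in
theorem crit_hi_ne (hχ : P.1 ≠ 0) : (M.crit P).eval (M.hi l) ≠ 0 := by
  have h1 := M.hi_neg l hl
  have h2 : M.n0.eval (M.hi l) ≠ 0 := fun h => by
    have := M.n0_ends hl; rw [h, mul_zero] at this; exact lt_irrefl _ this
  rw [crit_eval, M.p1_hi hl]
  simp [hχ, h1.ne, h2]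

/-- Three critical points over a gap without alternation produce one of higher order. -/
theorem exists_two_le_ord (hχ : P.1 ≠ 0) (h3 : 3 ≤ cnt (M.crit P) (M.gapC l))
    (hn : P ∉ M.alternating l) : ∃ z ∈ Set.Ioo (M.lo l) (M.hi l),
      2 ≤ M.ord P z ((τ * √(z * M.p1.eval z) : ℝ) : ℂ) := by
  rw [M.mem_alternating_iff hl hP hτ hmono hχ] at hn
  obtain ⟨z, hz, hz0, hleft, hright⟩ := M.exists_crossing hl hP hmono hn
  by_contra hcon
  push Not at hcon
  obtain ⟨y, hy, hy0⟩ := M.exists_sheet_zero hl hχ (sign_neg hτ)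
  -- If all orders on the sheet τ are at most one, the crossing is the only zero there. Together
  -- with the single simple zero on the other sheet this makes at most two.
  have hpm : ∀ t ∈ Set.Ioo (M.lo l) (M.hi l), (M.crit P).eval t = 0 → t = z ∨ t = y := by
    intro t ht h0
    have h1 := one_le_rootMultiplicity (M.crit_ne_zero (square_ne hP)) h0
    rw [M.rootMultiplicity_crit hl ht (square_ne hP) hτ] at h1
    by_cases h2 : 1 ≤ M.ord P t ((τ * √(t * M.p1.eval t) : ℝ) : ℂ)
    · left
      by_contra hne
      have := M.two_le_ord_of_ne_crossing hl hP hτ hleft hright ht hne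
        ((M.one_le_ord_sheet hl ht (square_ne hP) hτ).1 h2)
      exact absurd this (not_le.2 (hcon t ht))
    · right
      have h4 := (M.one_le_ord_sheet hl ht (square_ne hP) (sign_neg hτ)).1 (by omega)
      exact (M.sheet_neg_strictMonoOn hl hmono).injOn ht hy (h4.trans hy0.symm)
  have hle := cnt_le_sum_rootMultiplicity (M.crit P) (I := M.gapC l) {z, y} (by
    rintro _ ⟨t, ht, rfl⟩ h0
    rw [eval_map_ofReal] at h0
    norm_cast at h0
    rcases eq_or_lt_of_le ht.1 with h1 | h1
    · exact absurd (h1 ▸ h0) (M.crit_lo_ne hl hχ)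
    rcases eq_or_lt_of_le ht.2 with h2 | h2
    · exact absurd (h2 ▸ h0) (M.crit_hi_ne hl hχ)
    exact ⟨t, by simpa using hpm t ⟨h1, h2⟩ h0, rfl⟩)
  have b1 := hcon z hz
  have b2 := M.ord_neg_le_one hl hP hτ hmono hy
  by_cases hzy : z = y
  · subst hzy
    rw [Finset.pair_eq_singleton, Finset.sum_singleton,
      M.rootMultiplicity_crit hl hz (square_ne hP) hτ] at hle
    omega
  · have b3 : ¬ 1 ≤ M.ord P z (((-τ) * √(z * M.p1.eval z) : ℝ) : ℂ) := fun h =>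
      hzy ((M.sheet_neg_strictMonoOn hl hmono).injOn hz hy
        (((M.one_le_ord_sheet hl hz (square_ne hP) (sign_neg hτ)).1 h).trans hy0.symm))
    have b4 : ¬ 1 ≤ M.ord P y ((τ * √(y * M.p1.eval y) : ℝ) : ℂ) := fun h => by
      have := M.two_le_ord_of_ne_crossing hl hP hτ hleft hright hy (Ne.symm hzy)
        ((M.one_le_ord_sheet hl hy (square_ne hP) hτ).1 h)
      exact absurd this (not_le.2 (hcon y hy))
    rw [Finset.sum_pair hzy, M.rootMultiplicity_crit hl hz (square_ne hP) hτ,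
      M.rootMultiplicity_crit hl hy (square_ne hP) hτ] at hle
    omega

end monotone
end

/-! ### The vertical axis of the square -/

section axis
variable {η : ℝ}

/-- The double zero of the equation for `χ = 0`. -/
noncomputable def axisZero (η : ℝ) : ℝ := (η + 1) / (η - 1)

theorem axisZero_neg (hη : η ∈ Set.Ioo (-1 : ℝ) 1) : axisZero η < 0 :=
  div_neg_of_pos_of_neg (by linarith [hη.1]) (by linarith [hη.2])

theorem mob_axisZero (hη : η ∈ Set.Ioo (-1 : ℝ) 1) : mob (axisZero η) = η := by
  have : η - 1 ≠ 0 := by linarith [hη.2]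
  rw [mob, axisZero, div_eq_iff]
  · field_simp; ring
  · have := axisZero_neg hη; rw [axisZero] at this; linarith

theorem sheet_axis (σ z : ℝ) : M.sheet (0, η) σ z = η - mob z := by
  simp [sheet]

/-- For χ = 0 both sheets carry the same increasing function η - mob z, and the sign change is at
its zero. -/
theorem mem_alternating_axis (hη : η ∈ Set.Ioo (-1 : ℝ) 1) {l : ℕ} (hl : l ∈ Finset.Icc 1 M.g) :
    ((0, η) : ℝ × ℝ) ∈ M.alternating l ↔ axisZero η ∈ Set.Ioo (M.lo l) (M.hi l) := by
  have hsq : ((0, η) : ℝ × ℝ) ∈ square := ⟨⟨by norm_num, by norm_num⟩, hη⟩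
  have h0 := axisZero_neg hη
  have hm := mob_axisZero hη
  constructor
  · intro h
    obtain ⟨a, ha, b, hb, -, h1, h2⟩ := h.2 1 (Or.inl rfl)
    rw [sheet_axis] at h1 h2
    constructor
    · refine ha.1.trans (lt_of_not_ge fun hle => ?_)
      rcases eq_or_lt_of_le hle with h | h
      · rw [h] at hm; linarith
      · have := mob_lt h (by have := M.lt_zero hl ha; linarith); linarith
    · refine lt_of_not_ge fun hle => ?_
      have := mob_lt (hb.2.trans_le hle) (by linarith); linarith
  · intro h
    refine ⟨hsq, fun σ _ => ⟨(M.lo l + axisZero η) / 2, ⟨by linarith [h.1], by linarith [h.1, h.2]⟩,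
      (axisZero η + M.hi l) / 2, ⟨by linarith [h.1, h.2], by linarith [h.2]⟩,
      by linarith [h.1, h.2], ?_, ?_⟩⟩
    · rw [sheet_axis]
      have := mob_lt (a := (M.lo l + axisZero η) / 2) (b := axisZero η) (by linarith [h.1])
        (by linarith)
      linarith
    · rw [sheet_axis]
      have := mob_lt (a := axisZero η) (b := (axisZero η + M.hi l) / 2) (by linarith [h.2])
        (by linarith [M.hi_neg l hl])
      linarith

theorem lin_eq_axis (hη : η ∈ Set.Ioo (-1 : ℝ) 1) :
    M.lin η = C (M.κ * (η - 1)) * (X - C (axisZero η)) := by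
  have : η - 1 ≠ 0 := by linarith [hη.2]
  have e : C (η + 1) = C (η - 1) * C (axisZero η) := by
    rw [← C_mul, axisZero]; congr 1; field_simp
  rw [lin, e]; simp only [C_mul]; ring

theorem crit_axis (hη : η ∈ Set.Ioo (-1 : ℝ) 1) :
    M.crit (0, η) = (X - C (axisZero η)) ^ 2 * (C ((M.κ * (η - 1)) ^ 2) * M.p1) := by
  rw [crit, quad, M.lin_eq_axis hη, mul_pow, ← C_pow]; simp; ring

theorem two_le_axis (hη : η ∈ Set.Ioo (-1 : ℝ) 1) :
    2 ≤ (M.crit (0, η)).rootMultiplicity (axisZero η) := by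
  rw [le_rootMultiplicity_iff (M.crit_ne_zero (show ((0, η) : ℝ × ℝ).2 ≠ 1 from hη.2.ne)),
    M.crit_axis hη]
  exact dvd_mul_right _ _

theorem three_le_axis (hη : η ∈ Set.Ioo (-1 : ℝ) 1) (h : M.p1.eval (axisZero η) = 0) :
    3 ≤ (M.crit (0, η)).rootMultiplicity (axisZero η) := by
  rw [le_rootMultiplicity_iff (M.crit_ne_zero (show ((0, η) : ℝ × ℝ).2 ≠ 1 from hη.2.ne)),
    M.crit_axis hη, pow_succ]
  exact mul_dvd_mul_left _ (Dvd.dvd.mul_left (dvd_iff_isRoot.2 h) _)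

/-- The two ends of the gap and the double zero `axisZero` make four. If `axisZero` is an end, the
multiplicities there add up to three. -/
theorem mem_inner_axis_of_mem (hη : η ∈ Set.Ioo (-1 : ℝ) 1) {l : ℕ} (hl : l ∈ Finset.Icc 1 M.g)
    (h : axisZero η ∈ Set.Icc (M.lo l) (M.hi l)) : ((0, η) : ℝ × ℝ) ∈ M.inner l := by
  have hsq : ((0, η) : ℝ × ℝ) ∈ square := ⟨⟨by norm_num, by norm_num⟩, hη⟩
  have hne := M.crit_ne_zero (square_ne hsq)
  have hlt := M.lo_lt_hi l hl
  refine ⟨hsq, ?_⟩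
  have hlo : 1 ≤ (M.crit (0, η)).rootMultiplicity (M.lo l) := one_le_rootMultiplicity hne (by
    rw [crit_eval, M.p1_lo hl]; simp)
  have hhi : 1 ≤ (M.crit (0, η)).rootMultiplicity (M.hi l) := one_le_rootMultiplicity hne (by
    rw [crit_eval, M.p1_hi hl]; simp)
  have hax := M.two_le_axis hη
  have hpair := sum_rootMultiplicity_le_cnt (M.crit (0, η)) (I := M.gapC l) {M.lo l, M.hi l} (by
    simp [M.ofReal_mem_gapC, hlt.le])
  rw [Finset.sum_pair hlt.ne] at hpair
  rcases eq_or_lt_of_le h.1 with h1 | h1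
  · have := M.three_le_axis hη (by rw [← h1, M.p1_lo hl])
    rw [← h1] at this; omega
  rcases eq_or_lt_of_le h.2 with h2 | h2
  · have := M.three_le_axis hη (by rw [h2, M.p1_hi hl])
    rw [h2] at this; omega
  have := sum_rootMultiplicity_le_cnt (M.crit (0, η)) (I := M.gapC l)
    {M.lo l, M.hi l, axisZero η} (by
      simp only [Finset.mem_insert, Finset.mem_singleton, M.ofReal_mem_gapC]
      rintro t (rfl | rfl | rfl)
      · exact ⟨le_rfl, hlt.le⟩
      · exact ⟨hlt.le, le_rfl⟩
      · exact h)
  rw [Finset.sum_insert (by simp [hlt.ne, h1.ne]), Finset.sum_pair h2.ne'] at this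
  omega

/-- If the double zero lay in another gap or outside of all gaps, it would use up both free zeros,
leaving only two in this gap. -/
theorem axisZero_mem_of_three (hη : η ∈ Set.Ioo (-1 : ℝ) 1) {l : ℕ} (hl : l ∈ Finset.Icc 1 M.g)
    (h3 : 3 ≤ cnt (M.crit (0, η)) (M.gapC l)) : axisZero η ∈ Set.Icc (M.lo l) (M.hi l) := by
  have hsq : ((0, η) : ℝ × ℝ) ∈ square := ⟨⟨by norm_num, by norm_num⟩, hη⟩
  by_contra hn
  by_cases hj : ∃ j ∈ Finset.Icc 1 M.g, axisZero η ∈ Set.Icc (M.lo j) (M.hi j)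
  · obtain ⟨j, hj, h⟩ := hj
    have h4 := (M.mem_inner_axis_of_mem hη hj h).2
    have hlj : l ≠ j := by rintro rfl; exact hn h
    have := M.cnt_bound_two (M.crit_degree (square_ne hsq)).1
      (fun _ hj => M.two_le_cnt_gap hsq hj) hl hj hlj
    omega
  · push Not at hj
    have h0 := axisZero_neg hη
    have h2 := sum_rootMultiplicity_le_cnt (M.crit (0, η)) (I := M.restC) {axisZero η} (by
      simp only [Finset.mem_singleton]
      rintro t rfl
      exact ⟨by rw [GapData.ofReal_mem_posC]; exact not_lt.2 h0.le, fun j hj' h =>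
        hj j hj' (M.ofReal_mem_gapC.1 h)⟩)
    rw [Finset.sum_singleton] at h2
    have := M.two_le_axis hη
    have := M.cnt_gap_le_four hsq hl
    omega

end axis
end GapModel

/-! ### Closedness of the inner regions -/

theorem isOpen_square : IsOpen square := isOpen_Ioo.prod isOpen_Ioo

theorem exists_fin_map {R : Type*} (A : Multiset R) {n : ℕ} (h : A.card = n) :
    ∃ v : Fin n → R, A = Finset.univ.val.map v := by
  subst h
  induction A using Quotient.inductionOn with
  | h L =>
    refine ⟨fun i => L.get i, ?_⟩
    rw [Fin.univ_val_map]
    simp only [Multiset.quot_mk_to_coe, Multiset.coe_card]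
    rw [List.ofFn_get]

theorem le_cnt_of_dvd {f : ℝ[X]} (hf : f ≠ 0) {I : Set ℂ} {n : ℕ} (r : Fin n → ℝ)
    (hr : ∀ i, (r i : ℂ) ∈ I) (hd : ∏ i, (X - C (r i)) ∣ f) : n ≤ cnt f I := by
  classical
  have h1 := Polynomial.roots.le_of_dvd (map_ne_zero_of_ne hf)
    (Polynomial.map_dvd (algebraMap ℝ ℂ) hd)
  have h2 : (∏ i, (X - C (r i))).map (algebraMap ℝ ℂ) =
      (Multiset.map (fun a => X - C a) (Finset.univ.val.map fun i => (r i : ℂ))).prod := by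
    rw [Polynomial.map_prod, Multiset.map_map]
    simp [Finset.prod]
  rw [h2, roots_multiset_prod_X_sub_C] at h1
  have h3 := Multiset.countP_le_of_le (· ∈ I) h1
  rw [Multiset.countP_map] at h3
  have h4 : Multiset.filter (fun i => (r i : ℂ) ∈ I) Finset.univ.val = Finset.univ.val :=
    Multiset.filter_eq_self.2 fun i _ => hr i
  rw [h4] at h3
  simpa [cnt] using h3

theorem ofReal_of_mem (A : Multiset ℂ) {I : Set ℝ} (h : ∀ z ∈ A, ∃ t ∈ I, z = (t : ℝ)) :
    ∃ B : Multiset ℝ, A = B.map (fun t : ℝ => (t : ℂ)) ∧ ∀ t ∈ B, t ∈ I := by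
  refine ⟨A.map Complex.re, ?_, ?_⟩
  · rw [Multiset.map_map]
    conv_lhs => rw [← Multiset.map_id A]
    refine Multiset.map_congr rfl fun z hz => ?_
    obtain ⟨t, -, rfl⟩ := h z hz
    simp
  · intro t ht
    obtain ⟨z, hz, rfl⟩ := Multiset.mem_map.1 ht
    obtain ⟨s, hs, rfl⟩ := h z hz
    simpa using hs

namespace GapModel
variable (M : GapModel)

/-- The union of the gaps. -/
def gaps : Set ℝ := ⋃ l ∈ Finset.Icc 1 M.g, Set.Icc (M.lo l) (M.hi l)

theorem isCompact_gaps : IsCompact M.gaps :=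
  (Finset.Icc 1 M.g).isCompact_biUnion fun _ _ => isCompact_Icc

theorem gaps_neg {t : ℝ} (h : t ∈ M.gaps) : t < 0 := by
  simp only [gaps, Set.mem_iUnion] at h
  obtain ⟨l, hl, h⟩ := h
  exact M.gap_neg hl h

theorem mem_gaps {l : ℕ} (hl : l ∈ Finset.Icc 1 M.g) {t : ℝ}
    (h : t ∈ Set.Icc (M.lo l) (M.hi l)) : t ∈ M.gaps := by
  simp only [gaps, Set.mem_iUnion]; exact ⟨l, hl, h⟩

/-- The equation with prescribed real zeros. -/
def Factors (P : ℝ × ℝ) (r : Fin 4 → ℝ) (s : Fin (2 * M.g - 2) → ℝ) : Prop :=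
  ∀ t : ℝ, (M.crit P).eval t =
    (M.κ * (P.2 - 1)) ^ 2 * M.lead * ((∏ i, (t - r i)) * ∏ j, (t - s j))

/-- Four zeros in one gap exhaust the free ones, so all zeros are real and lie in the gaps. This
describes `inner` by tuples of zeros from a compact set. -/
theorem exists_factors {l : ℕ} (hl : l ∈ Finset.Icc 1 M.g) {P : ℝ × ℝ} (h : P ∈ M.inner l) :
    ∃ r s, (∀ i, r i ∈ Set.Icc (M.lo l) (M.hi l)) ∧ (∀ j, s j ∈ M.gaps) ∧ M.Factors P r s := by
  classical
  obtain ⟨hP, h4⟩ := h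
  have hb := M.cnt_gap_le_four hP hl
  obtain ⟨hd, hlc⟩ := M.crit_degree (square_ne hP)
  set f := M.crit P with hf
  set R := (f.map (algebraMap ℝ ℂ)).roots with hR
  have hc : cnt f (M.gapC l) = 4 := by omega
  have hrest : cnt f M.restC = 0 := by omega
  have hpos : cnt f GapData.posC = 0 := by omega
  rw [cnt, Multiset.countP_eq_zero] at hrest hpos
  have hall : ∀ z ∈ R, ∃ j ∈ Finset.Icc 1 M.g, z ∈ M.gapC j := by
    intro z hz
    by_contra hn
    push Not at hn
    exact hrest z hz ⟨hpos z hz, hn⟩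
  have hcard : R.card = 2 * M.g + 2 := by rw [hR, card_roots_map, hd]
  have hsplit := Multiset.filter_add_not (· ∈ M.gapC l) R
  have c1 : (R.filter (· ∈ M.gapC l)).card = 4 := by
    rw [← Multiset.countP_eq_card_filter, ← hc, cnt]
  have c2 : (R.filter (fun z => ¬ z ∈ M.gapC l)).card = 2 * M.g - 2 := by
    have := congrArg Multiset.card hsplit
    rw [Multiset.card_add, c1, hcard] at this
    omega
  obtain ⟨A, hA, hA'⟩ := ofReal_of_mem (R.filter (· ∈ M.gapC l)) (I := Set.Icc (M.lo l) (M.hi l))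
    fun z hz => (Multiset.mem_filter.1 hz).2
  obtain ⟨B, hB, hB'⟩ := ofReal_of_mem (R.filter (fun z => ¬ z ∈ M.gapC l)) (I := M.gaps)
    fun z hz => by
      obtain ⟨j, hj, t, ht, rfl⟩ := hall z (Multiset.mem_filter.1 hz).1
      exact ⟨t, M.mem_gaps hj ht, rfl⟩
  obtain ⟨r, hr⟩ := exists_fin_map A (n := 4) (by rw [← c1, hA, Multiset.card_map])
  obtain ⟨s, hs⟩ := exists_fin_map B (n := 2 * M.g - 2) (by rw [← c2, hB, Multiset.card_map])
  refine ⟨r, s, fun i => hA' _ ?_, fun j => hB' _ ?_, fun t => ?_⟩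
  · rw [hr]; exact Multiset.mem_map_of_mem r (Finset.mem_univ_val i)
  · rw [hs]; exact Multiset.mem_map_of_mem s (Finset.mem_univ_val j)
  · have e := (IsAlgClosed.splits (f.map (algebraMap ℝ ℂ))).eq_prod_roots
    rw [← hR, ← hsplit, hA, hB, hr, hs, leadingCoeff_map, hlc] at e
    have e2 := congrArg (eval (t : ℂ)) e
    rw [eval_map_ofReal] at e2
    apply Complex.ofReal_injective
    rw [e2]
    have e3 : ∀ {n : ℕ} (v : Fin n → ℝ), (Multiset.map (fun x => X - C x)
        (Multiset.map (fun t : ℝ => (t : ℂ)) (Multiset.map v Finset.univ.val))).prod =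
        ∏ i, (X - C (v i : ℂ)) := fun v => by
      rw [Multiset.map_map, Multiset.map_map]; rfl
    rw [Multiset.map_add, Multiset.prod_add, e3, e3]
    simp [eval_prod]

theorem mem_inner_of_factors {l : ℕ} {P : ℝ × ℝ} (hP : P ∈ square) {r s}
    (hr : ∀ i, r i ∈ Set.Icc (M.lo l) (M.hi l)) (h : M.Factors P r s) : P ∈ M.inner l := by
  refine ⟨hP, le_cnt_of_dvd (M.crit_ne_zero (square_ne hP)) r
    (fun i => M.ofReal_mem_gapC.2 (hr i)) ?_⟩
  have e : M.crit P = (∏ i, (X - C (r i))) *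
      (C ((M.κ * (P.2 - 1)) ^ 2 * M.lead) * ∏ j, (X - C (s j))) := by
    refine Polynomial.funext fun t => ?_
    rw [h t]
    simp only [eval_mul, eval_C, eval_prod, eval_sub, eval_X]
    ring
  rw [e]; exact dvd_mul_right _ _

theorem continuous_crit_eval : Continuous fun p : (ℝ × ℝ) × ℝ => (M.crit p.1).eval p.2 := by
  simp only [crit_eval]
  fun_prop

/-- The set is the projection of a closed set along a compact factor, the space of zeros,
intersected with the closed square. It does not reach the boundary of the square. A product over
negative zeros vanishes nowhere on [0, ∞), whereas `crit` vanishes at 0 for η = -1 and at 1 for χ =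
±1; for η = 1 the leading factor vanishes but `crit` is positive at 0. -/
theorem isClosed_inner {l : ℕ} (hl : l ∈ Finset.Icc 1 M.g) : IsClosed (M.inner l) := by
  set K : Set ((Fin 4 → ℝ) × (Fin (2 * M.g - 2) → ℝ)) :=
    (Set.univ.pi fun _ => Set.Icc (M.lo l) (M.hi l)) ×ˢ (Set.univ.pi fun _ => M.gaps) with hK
  have hKc : IsCompact K := (isCompact_univ_pi fun _ => isCompact_Icc).prod
    (isCompact_univ_pi fun _ => M.isCompact_gaps)
  have : CompactSpace K := isCompact_iff_compactSpace.1 hKc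
  set Z : Set ((ℝ × ℝ) × K) := {p | M.Factors p.1 p.2.1.1 p.2.1.2} with hZ
  have hZc : IsClosed Z := by
    have : Z = ⋂ t : ℝ, {p | (M.crit p.1).eval t = (M.κ * (p.1.2 - 1)) ^ 2 * M.lead *
        ((∏ i, (t - p.2.1.1 i)) * ∏ j, (t - p.2.1.2 j))} := by
      ext p; simp [hZ, Factors]
    rw [this]
    refine isClosed_iInter fun t => isClosed_eq ?_ ?_
    · exact M.continuous_crit_eval.comp (by fun_prop : Continuous fun p : (ℝ × ℝ) × K => (p.1, t))
    · fun_prop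
  have h2 : IsClosed (Prod.fst '' Z) := isClosedMap_fst_of_compactSpace _ hZc
  have h3 : IsClosed (Set.Icc (-1 : ℝ) 1 ×ˢ Set.Icc (-1 : ℝ) 1) := isClosed_Icc.prod isClosed_Icc
  convert h2.inter h3 using 1
  ext P
  constructor
  · intro h
    obtain ⟨r, s, hr, hs, hf⟩ := M.exists_factors hl h
    exact ⟨⟨(P, ⟨(r, s), fun i _ => hr i, fun j _ => hs j⟩), hf, rfl⟩,
      Set.Ioo_subset_Icc_self h.1.1, Set.Ioo_subset_Icc_self h.1.2⟩
  · rintro ⟨⟨⟨P', ⟨r, s⟩, hr, hs⟩, hf, rfl⟩, h1, h2⟩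
    have hr' : ∀ i, r i ∈ Set.Icc (M.lo l) (M.hi l) := fun i => hr i trivial
    have hs' : ∀ j, s j ∈ M.gaps := fun j => hs j trivial
    have hf' : M.Factors P' r s := hf
    have hne : ∀ t : ℝ, 0 ≤ t → (∏ i, (t - r i)) * ∏ j, (t - s j) ≠ 0 := by
      intro t ht
      refine mul_ne_zero (Finset.prod_ne_zero_iff.2 fun i _ => ?_)
        (Finset.prod_ne_zero_iff.2 fun j _ => ?_)
      · have := M.gap_neg hl (hr' i); linarith
      · have := M.gaps_neg (hs' j); linarith
    have hp0 := M.p1_pos_of_nonneg le_rfl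
    have hκ := M.κ_pos
    have hη1 : P'.2 ≠ 1 := by
      intro h
      have := hf' 0
      rw [crit_eval, h] at this
      simp [hp0.ne', hκ.ne'] at this
    have ha : (M.κ * (P'.2 - 1)) ^ 2 * M.lead ≠ 0 :=
      mul_ne_zero (pow_ne_zero _ (mul_ne_zero hκ.ne' (sub_ne_zero.2 hη1))) M.lead_pos.ne'
    have hη2 : P'.2 ≠ -1 := by
      intro h
      have := hf' 0
      rw [crit_eval] at this
      exact mul_ne_zero ha (hne 0 le_rfl) (by rw [← this, h]; ring)
    have hχ : P'.1 ^ 2 ≠ 1 := by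
      intro h
      have := hf' 1
      rw [crit_eval, h] at this
      refine mul_ne_zero ha (hne 1 zero_le_one) ?_
      have h1 := M.at_one
      rw [← this, n0]
      linear_combination 4 * h1
    refine M.mem_inner_of_factors ⟨⟨lt_of_le_of_ne h1.1 ?_, lt_of_le_of_ne h1.2 ?_⟩,
      lt_of_le_of_ne h2.1 hη2.symm, lt_of_le_of_ne h2.2 hη1⟩ hr' hf'
    · rintro h; exact hχ (by simp only at h; rw [← h]; norm_num)
    · rintro h; exact hχ (by simp only at h; rw [h]; norm_num)

end GapModel

/-! ### The outer, middle and inner regions -/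

open Filter Topology

namespace GapModel
variable (M : GapModel)

/-- Two simple positive zeros. -/
def outer : Set (ℝ × ℝ) := {P | P ∈ square ∧ ∃ t > 0, (M.crit P).eval t < 0}

/-- A double positive zero. -/
def outerEdge : Set (ℝ × ℝ) :=
  {P | P ∈ square ∧ (∃ t > 0, (M.crit P).eval t = 0) ∧ ∀ t > 0, 0 ≤ (M.crit P).eval t}

/-- No positive zero. -/
def noPos : Set (ℝ × ℝ) := {P | P ∈ square ∧ ∀ t > 0, 0 < (M.crit P).eval t}

/-- A zero outside of the gaps and of the positive half line. -/
def middle : Set (ℝ × ℝ) :=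
  {P | P ∈ square ∧ ∃ z ∈ M.restC, ((M.crit P).map (algebraMap ℝ ℂ)).eval z = 0}

/-- The boundary of `alternating`. -/
def innerEdge (l : ℕ) : Set (ℝ × ℝ) := M.inner l \ M.alternating l

theorem cnt_pos_of_root {f : ℝ[X]} (hf : f ≠ 0) {I : Set ℂ} {z : ℂ} (hz : z ∈ I)
    (h : (f.map (algebraMap ℝ ℂ)).eval z = 0) : 0 < cnt f I := by
  classical
  rw [cnt, Multiset.countP_pos]
  exact ⟨z, (mem_roots (map_ne_zero_of_ne hf)).2 h, hz⟩

theorem crit_zero_pos {P : ℝ × ℝ} (h : P.2 ≠ -1) : 0 < (M.crit P).eval 0 := by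
  have h1 := M.p1_pos_of_nonneg le_rfl
  have h2 := M.κ_pos
  have h3 : P.2 + 1 ≠ 0 := fun h' => h (by linarith)
  rw [crit_eval]
  have : (P.2 - 1) * 0 - (P.2 + 1) ≠ 0 := by simpa using neg_ne_zero.2 h3
  simp only [mul_zero, zero_mul, sub_zero] at this ⊢
  positivity

theorem exists_two_roots {f : ℝ[X]} (hd : 0 < f.natDegree) (hl : 0 < f.leadingCoeff)
    (h0 : 0 < f.eval 0) {t : ℝ} (ht : 0 < t) (hneg : f.eval t < 0) :
    ∃ r s, 0 < r ∧ r < t ∧ t < s ∧ f.eval r = 0 ∧ f.eval s = 0 := by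
  obtain ⟨r, hr, hr0⟩ := intermediate_value_Ioo' ht.le f.continuous.continuousOn ⟨hneg, h0⟩
  obtain ⟨s, hs, hs0⟩ := exists_root_gt hd hl hneg
  exact ⟨r, s, hr.1, hr.2, hs, hr0, hs0⟩

section
variable {P : ℝ × ℝ} (hP : P ∈ square)
include hP

theorem crit_natDegree_pos : 0 < (M.crit P).natDegree := by
  rw [(M.crit_degree (square_ne hP)).1]; omega

theorem exists_two_roots_crit {t : ℝ} (ht : 0 < t) (hneg : (M.crit P).eval t < 0) :
    ∃ r s, 0 < r ∧ r < t ∧ t < s ∧ (M.crit P).eval r = 0 ∧ (M.crit P).eval s = 0 :=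
  exists_two_roots (M.crit_natDegree_pos hP) (M.crit_leadingCoeff_pos (square_ne hP))
    (M.crit_zero_pos hP.2.1.ne') ht hneg

/-- A positive point where the equation is not positive yields two positive zeros. -/
theorem two_le_cnt_pos {t : ℝ} (ht : 0 < t) (h : (M.crit P).eval t ≤ 0) :
    2 ≤ cnt (M.crit P) GapData.posC := by
  have hne := M.crit_ne_zero (square_ne hP)
  have key : ∀ t : ℝ, 0 < t → (M.crit P).eval t < 0 → 2 ≤ cnt (M.crit P) GapData.posC := by
    intro t ht hneg
    obtain ⟨r, s, hr, hrt, hts, hr0, hs0⟩ := M.exists_two_roots_crit hP ht hneg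
    have := sum_rootMultiplicity_le_cnt (M.crit P) (I := GapData.posC) {r, s} (by
      simp only [Finset.mem_insert, Finset.mem_singleton, GapData.ofReal_mem_posC]
      rintro t (rfl | rfl)
      · exact hr
      · linarith)
    rw [Finset.sum_pair (hrt.trans hts).ne] at this
    have := one_le_rootMultiplicity hne hr0
    have := one_le_rootMultiplicity hne hs0
    omega
  by_cases hall : ∀ t > 0, 0 ≤ (M.crit P).eval t
  · have h2 := two_le_of_nonneg hne (le_antisymm h (hall t ht))
      (by filter_upwards [Ioi_mem_nhds ht] with s hs using hall s hs)
    have := sum_rootMultiplicity_le_cnt (M.crit P) (I := GapData.posC) {t} (by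
      simp only [Finset.mem_singleton, GapData.ofReal_mem_posC]
      rintro _ rfl; exact ht)
    rw [Finset.sum_singleton] at this
    omega
  · push Not at hall
    obtain ⟨s, hs, h⟩ := hall
    exact key s hs h

omit hP in
theorem cnt_pos_eq_zero (h : P ∈ M.noPos) : cnt (M.crit P) GapData.posC = 0 := by
  classical
  rw [cnt, Multiset.countP_eq_zero]
  rintro _ hz ⟨t, ht, rfl⟩
  have := (mem_roots'.1 hz).2
  rw [IsRoot, eval_map_ofReal] at this
  exact (h.2 t ht).ne' (by exact_mod_cast this)

theorem cnt_rest_eq_zero (h : P ∉ M.middle) : cnt (M.crit P) M.restC = 0 := by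
  classical
  rw [cnt, Multiset.countP_eq_zero]
  intro z hz hr
  exact h ⟨hP, z, hr, (mem_roots'.1 hz).2⟩

end

/-- A nonpositive value at a positive point costs two positive zeros, which with four in a gap
exceeds the number available. -/
theorem inner_subset_noPos {l : ℕ} (hl : l ∈ Finset.Icc 1 M.g) : M.inner l ⊆ M.noPos := by
  refine fun P h => ⟨h.1, fun t ht => ?_⟩
  by_contra hn
  have := M.two_le_cnt_pos h.1 ht (not_lt.1 hn)
  have := M.cnt_gap_le_four h.1 hl
  have := h.2
  omega

theorem middle_subset_noPos : M.middle ⊆ M.noPos := by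
  rintro P ⟨hP, z, hz, h0⟩
  refine ⟨hP, fun t ht => ?_⟩
  by_contra hn
  have := M.two_le_cnt_pos hP ht (not_lt.1 hn)
  have := M.cnt_rest_le_two hP
  have := cnt_pos_of_root (M.crit_ne_zero (square_ne hP)) hz h0
  omega

theorem middle_disjoint_inner {l : ℕ} (hl : l ∈ Finset.Icc 1 M.g) {P : ℝ × ℝ}
    (h : P ∈ M.middle) : P ∉ M.inner l := by
  intro h'
  obtain ⟨hP, z, hz, h0⟩ := h
  have := M.cnt_gap_le_four hP hl
  have := cnt_pos_of_root (M.crit_ne_zero (square_ne hP)) hz h0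
  have := h'.2
  omega

theorem inner_disjoint {l j : ℕ} (hl : l ∈ Finset.Icc 1 M.g) (hj : j ∈ Finset.Icc 1 M.g)
    (hlj : l ≠ j) {P : ℝ × ℝ} (h : P ∈ M.inner l) : P ∉ M.inner j := by
  intro h'
  have := M.cnt_bound_two (M.crit_degree (square_ne h.1)).1
    (fun _ hj => M.two_le_cnt_gap h.1 hj) hl hj hlj
  have := h.2
  have := h'.2
  omega

theorem noPos_or {P : ℝ × ℝ} (hP : P ∈ square) : P ∈ M.noPos ∨ P ∈ M.outer ∨ P ∈ M.outerEdge := by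
  by_cases h1 : ∃ t > 0, (M.crit P).eval t < 0
  · exact Or.inr (Or.inl ⟨hP, h1⟩)
  push Not at h1
  by_cases h2 : ∃ t > 0, (M.crit P).eval t = 0
  · exact Or.inr (Or.inr ⟨hP, h2, h1⟩)
  push Not at h2
  exact Or.inl ⟨hP, fun t ht => lt_of_le_of_ne (h1 t ht) (h2 t ht).symm⟩

theorem noPos_disjoint_outer {P : ℝ × ℝ} (h : P ∈ M.noPos) : P ∉ M.outer := by
  rintro ⟨-, t, ht, h'⟩; exact absurd (h.2 t ht) h'.not_gt

theorem noPos_disjoint_outerEdge {P : ℝ × ℝ} (h : P ∈ M.noPos) : P ∉ M.outerEdge := by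
  rintro ⟨-, ⟨t, ht, h'⟩, -⟩; exact (h.2 t ht).ne' h'

theorem outer_disjoint_outerEdge {P : ℝ × ℝ} (h : P ∈ M.outer) : P ∉ M.outerEdge := by
  obtain ⟨-, t, ht, h⟩ := h
  rintro ⟨-, -, h'⟩; exact absurd (h' t ht) h.not_ge

/-! ### Openness -/

theorem isOpen_neg : IsOpen {P | ∃ t > 0, (M.crit P).eval t < 0} := by
  have : {P | ∃ t > 0, (M.crit P).eval t < 0} =
      ⋃ t ∈ Set.Ioi (0 : ℝ), {P | (M.crit P).eval t < 0} := by ext; simp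
  rw [this]
  refine isOpen_biUnion fun t _ => isOpen_lt ?_ continuous_const
  exact M.continuous_crit_eval.comp (by fun_prop : Continuous fun p : ℝ × ℝ => (p, t))

theorem isOpen_outer : IsOpen M.outer := isOpen_square.inter M.isOpen_neg

theorem isOpen_alternating (l : ℕ) : IsOpen (M.alternating l) := by
  have hc : ∀ σ z, Continuous fun P => M.sheet P σ z := fun σ z => by unfold sheet; fun_prop
  have : M.alternating l = square ∩ ⋂ σ ∈ ({1, -1} : Set ℝ),
      ⋃ a ∈ Set.Ioo (M.lo l) (M.hi l), ⋃ b ∈ Set.Ioo (M.lo l) (M.hi l),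
        {P | a < b ∧ M.sheet P σ a < 0 ∧ 0 < M.sheet P σ b} := by
    ext P
    simp only [alternating, Set.mem_ofPred_eq, Set.mem_inter_iff, Set.mem_iInter, Set.mem_iUnion,
      Set.mem_insert_iff, Set.mem_singleton_iff, exists_prop]
  rw [this]
  refine isOpen_square.inter (Set.Finite.isOpen_biInter (by simp) fun σ _ => ?_)
  refine isOpen_biUnion fun a _ => isOpen_biUnion fun b _ => ?_
  by_cases hab : a < b
  · simp only [hab, true_and]
    exact (isOpen_lt (hc σ a) continuous_const).inter (isOpen_lt continuous_const (hc σ b))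
  · simp [hab]

/-- On a compact interval positivity is stable. Beyond it, `crit` is bounded below, for all nearby
parameters at once, by one fixed polynomial that tends to infinity. -/
theorem isOpen_noPos : IsOpen M.noPos := by
  refine isOpen_iff_mem_nhds.2 fun P hP => ?_
  have hsq := hP.1
  -- Half the distance to the side η = 1, where the degree drops. Near P this gives |lin(t)| ≥ κδt,
  -- while χ² ≤ 1 bounds the other term.
  set δ := (1 - P.2) / 2 with hδ
  have hδ0 : 0 < δ := by have := hsq.2.2; rw [hδ]; linarith
  have hκδ : M.κ * δ ≠ 0 := mul_ne_zero M.κ_pos.ne' hδ0.ne'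
  obtain ⟨hd, hlc⟩ := M.quad_degree (A := C (M.κ * δ) * X) (natDegree_C_mul_X _ hκδ) 1
  have hlim := (M.quad (C (M.κ * δ) * X) 1).tendsto_atTop_of_leadingCoeff_nonneg
    (natDegree_pos_iff_degree_pos.1 (by omega)) (by rw [hlc]; have := M.lead_pos; positivity)
  obtain ⟨T, hT⟩ := eventually_atTop.1 (hlim.eventually_gt_atTop 0)
  have h1 : ∀ᶠ Q in 𝓝 P, ∀ t ∈ Set.Icc 0 T, 0 < (M.crit Q).eval t := by
    refine isCompact_Icc.eventually_forall_of_forall_eventually fun t ht => ?_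
    refine M.continuous_crit_eval.continuousAt.eventually_const_lt ?_
    rcases eq_or_lt_of_le ht.1 with h | h
    · simp only [← h]; exact M.crit_zero_pos hsq.2.1.ne'
    · exact hP.2 t h
  have h2 : ∀ᶠ Q : ℝ × ℝ in 𝓝 P, Q.2 < 1 - δ :=
    continuousAt_snd.eventually_lt_const (by rw [hδ]; linarith [hsq.2.2])
  filter_upwards [h1, h2, isOpen_square.mem_nhds hsq] with Q hQ1 hQ2 hQ
  refine ⟨hQ, fun t ht => ?_⟩
  by_cases htT : t ≤ T
  · exact hQ1 t ⟨ht.le, htT⟩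
  have h3 := hT t (not_le.1 htT).le
  rw [quad_eval] at h3
  simp only [eval_mul, eval_C, eval_X] at h3
  rw [crit_eval]
  have h4 := M.p1_pos_of_nonneg ht.le
  have h5 : Q.1 ^ 2 ≤ 1 := by nlinarith [hQ.1.1, hQ.1.2]
  have h6 : (M.κ * δ * t) ^ 2 ≤ (M.κ * ((Q.2 - 1) * t - (Q.2 + 1))) ^ 2 := by
    have : M.κ * δ * t ≤ M.κ * -((Q.2 - 1) * t - (Q.2 + 1)) := by
      rw [mul_assoc]
      refine mul_le_mul_of_nonneg_left ?_ M.κ_pos.le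
      nlinarith [hQ.2.1]
    have := pow_le_pow_left₀ (by have := M.κ_pos; positivity) this 2
    nlinarith
  have h7 := mul_le_mul_of_nonneg_right h6 h4.le
  have h8 : 4 * Q.1 ^ 2 * t * M.n0.eval t ^ 2 ≤ 4 * 1 ^ 2 * t * M.n0.eval t ^ 2 := by
    have : 0 ≤ t * M.n0.eval t ^ 2 := by positivity
    nlinarith
  linarith

/-! ### Motion along the lines of points with a common zero -/

/-- The line of points for which `z` solves the equation on the sheet `τ`. -/
noncomputable def line (P : ℝ × ℝ) (τ z c : ℝ) : ℝ × ℝ :=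
  (c * P.1, mob z + τ * (c * P.1) * M.slope z)

theorem line_one {P : ℝ × ℝ} {τ z : ℝ} (h : M.sheet P τ z = 0) : M.line P τ z 1 = P := by
  rw [sheet] at h
  refine Prod.ext ?_ ?_
  · simp [line]
  · simp only [line]; linarith

theorem continuous_line (P : ℝ × ℝ) (τ z : ℝ) : Continuous (M.line P τ z) := by
  unfold line; fun_prop

theorem tendsto_line {P : ℝ × ℝ} {τ z : ℝ} (h : M.sheet P τ z = 0) :
    Tendsto (M.line P τ z) (𝓝 1) (𝓝 P) := by
  have := (M.continuous_line P τ z).tendsto 1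
  rwa [M.line_one h] at this

/-- Along the line z stays a zero; only the weight c of the `slope` difference against the `mob`
difference varies. -/
theorem sheet_line (P : ℝ × ℝ) (τ z c t : ℝ) : M.sheet (M.line P τ z c) τ t =
    (mob z - mob t) + c * (τ * P.1 * M.slope z - τ * P.1 * M.slope t) := by
  simp only [sheet, line]; ring

section
variable {l : ℕ} (hl : l ∈ Finset.Icc 1 M.g) {P : ℝ × ℝ} (hP : P ∈ square)
include hl hP

section monotone
variable {τ : ℝ} (hτ : τ = 1 ∨ τ = -1)
  (hmono : StrictMonoOn (fun z => τ * P.1 * M.slope z) (Set.Ioo (M.lo l) (M.hi l)))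
include hτ hmono

omit hl hP hτ in
theorem line_mono {z c : ℝ} (hc : 0 < c) :
    StrictMonoOn (fun t => τ * (M.line P τ z c).1 * M.slope t) (Set.Ioo (M.lo l) (M.hi l)) := by
  intro a ha b hb hab
  have := mul_lt_mul_of_pos_left (hmono ha hb hab) hc
  simp only [line] at this ⊢
  linarith

/-- At a zero of order at least two the contribution 2/(z - 1)² of `mob` to the derivative cancels
that of `slope`. Moving along the line of z towards χ = 0 weakens the second one, so z becomes a
change from negative to positive. -/
theorem mem_closure_alternating (hχ : P.1 ≠ 0) {z : ℝ} (hz : z ∈ Set.Ioo (M.lo l) (M.hi l))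
    (h2 : 2 ≤ M.ord P z ((τ * √(z * M.p1.eval z) : ℝ) : ℂ)) : P ∈ closure (M.alternating l) := by
  obtain ⟨h0, hd⟩ := (M.two_le_ord_sheet hl hz (square_ne hP) hτ).1 h2
  have hlim := (M.tendsto_line h0).mono_left (nhdsWithin_le_nhds (s := Set.Iio 1))
  refine mem_closure_of_tendsto hlim ?_
  filter_upwards [hlim.eventually (isOpen_square.mem_nhds hP), self_mem_nhdsWithin,
    nhdsWithin_le_nhds (Ioi_mem_nhds (zero_lt_one' ℝ))] with c hcsq hc1 hc0
  have hc1 : c < 1 := hc1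
  have hc0 : 0 < c := hc0
  have hχ' : (M.line P τ z c).1 ≠ 0 := mul_ne_zero hc0.ne' hχ
  rw [M.mem_alternating_iff hl hcsq hτ (M.line_mono hmono hc0) hχ']
  have hz0 : M.sheet (M.line P τ z c) τ z = 0 := by rw [sheet_line]; ring
  have hder := M.sheet_hasDerivAt hl hz (M.line P τ z c) τ
  have hpos : 0 < 2 / (z - 1) ^ 2 - τ * (M.line P τ z c).1 * deriv M.slope z := by
    have h3 := M.ne_one_of_gap hl hz
    have h4 : τ * P.1 * deriv M.slope z = 2 / (z - 1) ^ 2 := by linarith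
    have : τ * (M.line P τ z c).1 * deriv M.slope z = c * (τ * P.1 * deriv M.slope z) := by
      simp only [line]; ring
    rw [this, h4]; nlinarith
  have hI : ∀ᶠ t in 𝓝 z, t ∈ Set.Ioo (M.lo l) (M.hi l) := Ioo_mem_nhds hz.1 hz.2
  have hs := hasDerivAt_iff_tendsto_slope.1 hder
  have hs1 := hs.eventually_const_lt hpos
  have hl1 : ∀ᶠ t in 𝓝[<] z, 0 < _root_.slope (M.sheet (M.line P τ z c) τ) z t :=
    hs1.filter_mono (nhdsWithin_mono _ fun t (ht : t < z) => ht.ne)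
  have hr1 : ∀ᶠ t in 𝓝[>] z, 0 < _root_.slope (M.sheet (M.line P τ z c) τ) z t :=
    hs1.filter_mono (nhdsWithin_mono _ fun t (ht : z < t) => ht.ne')
  obtain ⟨a, ⟨ha1, ha2⟩, ha3⟩ := ((hl1.and (hI.filter_mono nhdsWithin_le_nhds)).and
    (self_mem_nhdsWithin (s := Set.Iio z))).exists
  obtain ⟨b, ⟨hb1, hb2⟩, hb3⟩ := ((hr1.and (hI.filter_mono nhdsWithin_le_nhds)).and
    (self_mem_nhdsWithin (s := Set.Ioi z))).exists
  have ha3 : a < z := ha3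
  have hb3 : z < b := hb3
  rw [slope_def_field, hz0, sub_zero] at ha1 hb1
  refine ⟨a, ha2, b, hb2, ha3.trans hb3, ?_, ?_⟩
  · by_contra hn
    have := div_nonpos_of_nonneg_of_nonpos (not_lt.1 hn) (sub_neg.2 ha3).le
    linarith
  · by_contra hn
    have := div_nonpos_of_nonpos_of_nonneg (not_lt.1 hn) (sub_pos.2 hb3).le
    linarith

end monotone

omit hP in
theorem alternating_subset_inner : M.alternating l ⊆ M.inner l := by
  intro P h
  by_cases hχ : P.1 = 0
  · obtain ⟨χ, η⟩ := P
    obtain rfl : χ = 0 := hχ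
    exact M.mem_inner_axis_of_mem h.1.2 hl
      (Set.Ioo_subset_Icc_self ((M.mem_alternating_axis h.1.2 hl).1 h))
  · obtain ⟨τ, hτ, hmono⟩ := M.exists_sign hl hχ
    exact M.inner_of_alternating hl h.1 hτ hmono hχ h

omit hP in
theorem closure_alternating_subset : closure (M.alternating l) ⊆ M.inner l :=
  closure_minimal (M.alternating_subset_inner hl) (M.isClosed_inner hl)

/-- A third zero in the gap forces a fourth. For χ ≠ 0, either the equation alternates, or there is
a zero of higher order and P is a limit of alternating points, where closedness of `inner` applies.
-/
theorem mem_inner_of_three (h3 : 3 ≤ cnt (M.crit P) (M.gapC l)) : P ∈ M.inner l := by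
  by_cases hχ : P.1 = 0
  · obtain ⟨χ, η⟩ := P
    obtain rfl : χ = 0 := hχ
    exact M.mem_inner_axis_of_mem hP.2 hl (M.axisZero_mem_of_three hP.2 hl h3)
  · by_cases ha : P ∈ M.alternating l
    · exact M.alternating_subset_inner hl ha
    obtain ⟨τ, hτ, hmono⟩ := M.exists_sign hl hχ
    obtain ⟨z, hz, h2⟩ := M.exists_two_le_ord hl hP hτ hmono hχ h3 ha
    exact M.closure_alternating_subset hl (M.mem_closure_alternating hl hP hτ hmono hχ hz h2)

end

/-- Conversely, if all 2g + 2 zeros lie in the g gaps, some gap contains three, hence four. -/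
theorem middle_iff {P : ℝ × ℝ} :
    P ∈ M.middle ↔ P ∈ M.noPos ∧ ∀ l ∈ Finset.Icc 1 M.g, P ∉ M.inner l := by
  refine ⟨fun h => ⟨M.middle_subset_noPos h, fun l hl => M.middle_disjoint_inner hl h⟩, ?_⟩
  rintro ⟨h1, h2⟩
  by_contra hn
  have hP := h1.1
  have e1 := M.cnt_pos_eq_zero h1
  have e2 := M.cnt_rest_eq_zero hP hn
  have e3 := M.cnt_total (M.crit P)
  rw [e1, e2, (M.crit_degree (square_ne hP)).1] at e3
  have e4 : ∑ l ∈ Finset.Icc 1 M.g, cnt (M.crit P) (M.gapC l) ≤ ∑ _l ∈ Finset.Icc 1 M.g, 2 := by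
    refine Finset.sum_le_sum fun l hl => ?_
    by_contra h3
    exact h2 l hl (M.mem_inner_of_three hl hP (by omega))
  rw [Finset.sum_const, Nat.card_Icc, smul_eq_mul] at e4
  omega

theorem isClosed_iUnion_inner : IsClosed (⋃ l ∈ Set.Icc 1 M.g, M.inner l) :=
  (Set.finite_Icc 1 M.g).isClosed_biUnion fun _ hl => M.isClosed_inner (Finset.mem_Icc.2 hl)

theorem middle_eq : M.middle = M.noPos ∩ (⋃ l ∈ Set.Icc 1 M.g, M.inner l)ᶜ := by
  ext P; rw [M.middle_iff]; simp

theorem isOpen_middle : IsOpen M.middle := by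
  rw [M.middle_eq]; exact M.isOpen_noPos.inter M.isClosed_iUnion_inner.isOpen_compl

end GapModel

/-! ### The boundary of the square and the outer curve -/

theorem closure_square : closure square = Set.Icc (-1 : ℝ) 1 ×ˢ Set.Icc (-1 : ℝ) 1 := by
  rw [square, closure_prod_eq, closure_Ioo (by norm_num)]

/-- Two points in different parts of an open partition lie in different components. -/
theorem notMem_connectedComponentIn {X : Type*} [TopologicalSpace X] {E U V : Set X}
    (hU : IsOpen U) (hV : IsOpen V) (hd : ∀ x ∈ U, x ∉ V) (hc : Eᶜ ⊆ U ∪ V) {a b : X}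
    (ha : a ∈ U) (hb : b ∈ V) : b ∉ connectedComponentIn Eᶜ a := by
  intro hmem
  by_cases haE : a ∈ Eᶜ
  · have h1 : IsPreconnected (connectedComponentIn Eᶜ a) := isPreconnected_connectedComponentIn
    have h2 := (connectedComponentIn_subset Eᶜ a).trans hc
    have h3 := h1.subset_left_of_subset_union hU hV (Set.disjoint_left.2 hd) h2
      ⟨a, mem_connectedComponentIn haE, ha⟩
    exact hd b (h3 hmem) hb
  · rw [connectedComponentIn_eq_empty haE] at hmem
    exact hmem

theorem eq_or_eq_of_sq {t : ℝ} (h : t ^ 2 = 1) : t = 1 ∨ t = -1 :=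
  sq_eq_sq_iff_eq_or_eq_neg.1 (by simpa using h)

namespace GapModel
variable (M : GapModel)

/-- The four points of the outer edge on the boundary of the square. -/
def corners : Set (ℝ × ℝ) := {(0, 1), (0, -1), (1, M.estar), (-1, M.estar)}

theorem corners_disjoint_square {P : ℝ × ℝ} (h : P ∈ M.corners) : P ∉ square := by
  simp only [corners, Set.mem_insert_iff, Set.mem_singleton_iff] at h
  rintro ⟨⟨h1, h2⟩, h3, h4⟩
  rcases h with rfl | rfl | rfl | rfl
  · exact lt_irrefl _ h4
  · exact lt_irrefl _ h3
  · exact lt_irrefl _ h2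
  · exact lt_irrefl _ h1

theorem crit_eval_one {P : ℝ × ℝ} (h : P.1 ^ 2 = 1) : (M.crit P).eval 1 = 0 := by
  have h1 := M.at_one
  rw [crit_eval, h, n0]
  linear_combination 4 * h1

/-- The linear factor equals -2κ at 1 for every η, and its derivative is κ(η - 1). So the derivative
of `crit` at 1 is affine in η, and it vanishes at `estar` by construction. -/
theorem crit_deriv_one {P : ℝ × ℝ} (h : P.1 ^ 2 = 1) : (derivative (M.crit P)).eval 1 =
    -4 * M.κ ^ 2 * (P.2 - M.estar) * M.p1.eval 1 := by
  have h1 := M.deriv_one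
  rw [← n0] at h1
  rw [crit, quad, h, lin]
  simp [derivative_pow] at h1 ⊢
  linear_combination h1

/-- At the other points of the boundary of the square the equation becomes negative. -/
theorem exists_neg_of_boundary {P : ℝ × ℝ} (hP : P ∈ closure square) (hP' : P ∉ square)
    (hc : P ∉ M.corners) : ∃ t > 0, (M.crit P).eval t < 0 := by
  rw [closure_square] at hP
  obtain ⟨χ, η⟩ := P
  have hκ := M.κ_pos
  obtain ⟨⟨c1, c2⟩, c3, c4⟩ := hP
  simp only at c1 c2 c3 c4
  have h01 : χ = 0 → η ≠ 1 := by rintro rfl rfl; exact hc (by simp [corners])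
  have h02 : χ = 0 → η ≠ -1 := by rintro rfl rfl; exact hc (by simp [corners])
  by_cases h1 : η = 1
  · subst h1
    have hχ : χ ≠ 0 := fun h => h01 h rfl
    -- For η = 1 the linear factor is the constant -2κ, and `f` is the negative of `crit`: its term
    -- z n₀² has the larger degree 2g + 1.
    set f : ℝ[X] := C (4 * χ ^ 2) * X * M.n0 ^ 2 - C (4 * M.κ ^ 2) * M.p1 with hf
    have hχ2 : 4 * χ ^ 2 ≠ 0 := by positivity
    have hn0 : M.n0 ≠ 0 := fun h => M.n0_eval_nonneg_ne le_rfl (by rw [h, eval_zero])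
    have d1 : (C (4 * χ ^ 2) * X * M.n0 ^ 2).natDegree = 2 * M.g + 1 := by
      rw [mul_assoc, natDegree_C_mul hχ2, natDegree_mul X_ne_zero (pow_ne_zero _ hn0), natDegree_X,
        natDegree_pow, M.n0_natDegree]; ring
    have d2 : (C (4 * M.κ ^ 2) * M.p1).natDegree = 2 * M.g := by
      rw [natDegree_C_mul (by positivity), M.p1_natDegree]
    have d3 : f.natDegree = 2 * M.g + 1 := by
      rw [hf, natDegree_sub_eq_left_of_natDegree_lt (by omega), d1]
    have d4 : f.leadingCoeff = 4 * χ ^ 2 * M.n0.leadingCoeff ^ 2 := by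
      rw [hf, leadingCoeff_sub_of_degree_lt (degree_lt_degree (by omega)), mul_assoc,
        leadingCoeff_mul, leadingCoeff_mul, leadingCoeff_C, leadingCoeff_X, leadingCoeff_pow,
        one_mul]
    have hlim := f.tendsto_atTop_of_leadingCoeff_nonneg
      (natDegree_pos_iff_degree_pos.1 (by omega)) (by rw [d4]; positivity)
    obtain ⟨t, ht, ht0⟩ := ((hlim.eventually_gt_atTop 0).and (eventually_gt_atTop 0)).exists
    refine ⟨t, ht0, ?_⟩
    rw [crit_eval]
    simp [hf] at ht
    simp only
    nlinarith
  by_cases h2 : η = -1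
  · subst h2
    have hχ : χ ≠ 0 := fun h => h02 h rfl
    -- For η = -1 the polynomial `crit` is t times `f`, and `f` is negative at 0.
    set f : ℝ → ℝ := fun t => 4 * M.κ ^ 2 * t * M.p1.eval t - 4 * χ ^ 2 * M.n0.eval t ^ 2 with hf
    have hcont : Continuous f := by rw [hf]; fun_prop
    have hf0 : f 0 < 0 := by
      have := M.n0_eval_nonneg_ne le_rfl
      simp only [hf, mul_zero, zero_mul, zero_sub, neg_neg_iff_pos]
      positivity
    obtain ⟨t, ht, ht0⟩ := ((hcont.continuousAt.eventually_lt_const hf0).filter_mono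
      nhdsWithin_le_nhds |>.and (self_mem_nhdsWithin (s := Set.Ioi (0 : ℝ)))).exists
    have ht0 : 0 < t := ht0
    refine ⟨t, ht0, ?_⟩
    rw [crit_eval]
    simp only [hf] at ht ⊢
    nlinarith
  have c3 : -1 < η := lt_of_le_of_ne c3 (Ne.symm h2)
  have c4 : η < 1 := lt_of_le_of_ne c4 h1
  have hχ : χ ^ 2 = 1 := by
    by_contra hχ
    refine hP' ⟨⟨lt_of_le_of_ne c1 ?_, lt_of_le_of_ne c2 ?_⟩, c3, c4⟩
    · rintro h; exact hχ (by simp only at h; rw [← h]; norm_num)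
    · rintro h; exact hχ (by simp only at h; rw [h]; norm_num)
  have he : η ≠ M.estar := by
    rintro rfl
    rcases eq_or_eq_of_sq hχ with rfl | rfl
    · exact hc (by simp [corners])
    · exact hc (by simp [corners])
  by_contra hn
  push Not at hn
  -- If `crit` were nonnegative on the half line, its zero at 1 would be a minimum, and the
  -- vanishing derivative would give η = `estar`.
  have h0 := M.crit_eval_one (P := (χ, η)) hχ
  have hmin : IsLocalMin (fun s => (M.crit (χ, η)).eval s) 1 := by
    filter_upwards [Ioi_mem_nhds (zero_lt_one' ℝ)] with s hs
    rw [h0]; exact hn s hs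
  have := hmin.hasDerivAt_eq_zero ((M.crit (χ, η)).hasDerivAt 1)
  rw [M.crit_deriv_one hχ] at this
  have h5 := (M.p1_pos_of_nonneg zero_le_one).ne'
  have h6 : η - M.estar ≠ 0 := sub_ne_zero.2 he
  simp [hκ.ne', h5, h6] at this

/-- At the tangency points the equation is nonnegative. -/
theorem crit_tangency_nonneg {χ : ℝ} (hχ : χ ^ 2 = 1) {t : ℝ} (ht : 0 < t) :
    0 ≤ (M.crit (χ, M.estar)).eval t := by
  by_contra hneg
  rw [not_le] at hneg
  have hP1 : ((χ, M.estar) : ℝ × ℝ).2 ≠ 1 := M.estar_mem.2.ne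
  have hne := M.crit_ne_zero hP1
  obtain ⟨hd, -⟩ := M.crit_degree hP1
  have h1 := M.crit_eval_one (P := (χ, M.estar)) hχ
  have h2 := two_le_rootMultiplicity hne h1 (by
    rw [M.crit_deriv_one hχ]; simp)
  have hb := M.cnt_bound_zero hd fun l hl => M.two_le_quad_cnt hne hl
  obtain ⟨r, s, hr, hrt, hts, hr0, hs0⟩ := exists_two_roots (by omega)
    (M.crit_leadingCoeff_pos hP1) (M.crit_zero_pos M.estar_mem.1.ne') ht hneg
  -- A second positive zero besides the double one at 1 would make three, one more than the count
  -- allows.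
  have hy : ∃ y : ℝ, 0 < y ∧ y ≠ 1 ∧ (M.crit (χ, M.estar)).eval y = 0 := by
    by_cases h : r = 1
    · exact ⟨s, by linarith, by linarith, hs0⟩
    · exact ⟨r, hr, h, hr0⟩
  obtain ⟨y, hy, hy1, hy0⟩ := hy
  have := sum_rootMultiplicity_le_cnt (M.crit (χ, M.estar)) (I := GapData.posC) {1, y} (by
    simp only [Finset.mem_insert, Finset.mem_singleton, GapData.ofReal_mem_posC]
    rintro t (rfl | rfl)
    · exact zero_lt_one
    · exact hy)
  rw [Finset.sum_pair hy1.symm] at this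
  have := one_le_rootMultiplicity hne hy0
  omega

theorem tangency_mem_noPos {χ : ℝ} (hχ : χ ∈ Set.Ioo (-1 : ℝ) 1) :
    (χ, M.estar) ∈ M.noPos := by
  refine ⟨⟨hχ, M.estar_mem⟩, fun t ht => ?_⟩
  have h := M.crit_tangency_nonneg (χ := 1) (by norm_num) ht
  rw [crit_eval] at h ⊢
  have h1 : χ ^ 2 < 1 := by nlinarith [hχ.1, hχ.2]
  have h2 := M.n0_eval_nonneg_ne ht.le
  have h3 : 0 < t * M.n0.eval t ^ 2 := by positivity
  simp only at h ⊢
  nlinarith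

theorem axis_mem_noPos {η : ℝ} (hη : η ∈ Set.Ioo (-1 : ℝ) 1) : ((0, η) : ℝ × ℝ) ∈ M.noPos := by
  refine ⟨⟨⟨by norm_num, by norm_num⟩, hη⟩, fun t ht => ?_⟩
  rw [crit_eval]
  have h1 := M.p1_pos_of_nonneg ht.le
  have h2 : (η - 1) * t - (η + 1) ≠ 0 := by nlinarith [hη.1, hη.2]
  have h3 := M.κ_pos
  have : 0 < (M.κ * ((η - 1) * t - (η + 1))) ^ 2 * M.p1.eval t := by positivity
  simpa using this

theorem mem_closure_middle_of_noPos {P : ℝ × ℝ} (h1 : P ∈ closure M.noPos)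
    (h2 : P ∉ ⋃ l ∈ Set.Icc 1 M.g, M.inner l) : P ∈ closure M.middle := by
  rw [middle_eq, Set.inter_comm]
  exact M.isClosed_iUnion_inner.isOpen_compl.inter_closure ⟨h2, h1⟩

theorem notMem_iUnion_inner_of_square {P : ℝ × ℝ} (h : P ∉ square) :
    P ∉ ⋃ l ∈ Set.Icc 1 M.g, M.inner l := by
  simp only [Set.mem_iUnion, not_exists]
  exact fun l _ h' => h h'.1

/-- The approach is along χ = 0 and along η = `estar`, on which `crit` is positive for t > 0. No
`inner` region contains a boundary point of the square. -/
theorem corners_subset_closure_middle : M.corners ⊆ closure M.middle := by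
  intro P hP
  refine M.mem_closure_middle_of_noPos ?_
    (M.notMem_iUnion_inner_of_square (M.corners_disjoint_square hP))
  have key : ∀ (f : ℝ → ℝ × ℝ) (x : ℝ), Continuous f → x ∈ Set.Icc (-1 : ℝ) 1 →
      (∀ y ∈ Set.Ioo (-1 : ℝ) 1, f y ∈ M.noPos) → f x ∈ closure M.noPos := by
    intro f x hf hx h
    rw [← closure_Ioo (by norm_num)] at hx
    exact map_mem_closure hf hx h
  have k1 := key (fun y => (0, y)) 1 (by fun_prop) (by norm_num) fun y hy => M.axis_mem_noPos hy
  have k2 := key (fun y => (0, y)) (-1) (by fun_prop) (by norm_num)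
    fun y hy => M.axis_mem_noPos hy
  have k3 := key (fun y => (y, M.estar)) 1 (by fun_prop) (by norm_num)
    fun y hy => M.tangency_mem_noPos hy
  have k4 := key (fun y => (y, M.estar)) (-1) (by fun_prop) (by norm_num)
    fun y hy => M.tangency_mem_noPos hy
  rcases hP with rfl | rfl | rfl | rfl
  exacts [k1, k2, k3, k4]

theorem boundary_subset_closure_outer {P : ℝ × ℝ} (hP : P ∈ closure square) (hP' : P ∉ square)
    (hc : P ∉ M.corners) : P ∈ closure M.outer := by
  rw [outer, Set.ofPred_and, Set.inter_comm]
  exact M.isOpen_neg.inter_closure ⟨M.exists_neg_of_boundary hP hP' hc, hP⟩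

/-- The approach is along the sides of the square, whose other points are already limits of `outer`.
-/
theorem corners_subset_closure_outer : M.corners ⊆ closure M.outer := by
  intro P hP
  have hs := M.estar_mem
  have key : ∀ (f : ℝ → ℝ × ℝ) (x : ℝ), Continuous f → f x = P →
      (∀ᶠ y in 𝓝[>] x, f y ∈ closure square ∧ f y ∉ square ∧ f y ∉ M.corners) →
      P ∈ closure M.outer := by
    intro f x hf hx h
    have hlim := (hf.tendsto x).mono_left (nhdsWithin_le_nhds (s := Set.Ioi x))
    rw [hx] at hlim
    rw [← closure_closure]
    refine mem_closure_of_tendsto hlim ?_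
    filter_upwards [h] with y hy
    exact M.boundary_subset_closure_outer hy.1 hy.2.1 hy.2.2
  have horiz : ∀ η : ℝ, η ^ 2 = 1 → P = (0, η) → P ∈ closure M.outer := by
    intro η hη hP
    have hη' : η = 1 ∨ η = -1 := eq_or_eq_of_sq hη
    refine key (fun y => (y, η)) 0 (by fun_prop) hP.symm ?_
    filter_upwards [Ioo_mem_nhdsGT (zero_lt_one' ℝ)] with y hy
    refine ⟨?_, ?_, ?_⟩
    · rw [closure_square]
      refine ⟨⟨by linarith [hy.1], hy.2.le⟩, ?_⟩
      rcases hη' with rfl | rfl <;> norm_num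
    · rintro ⟨-, h1, h2⟩
      rcases hη' with rfl | rfl
      · exact lt_irrefl _ h2
      · exact lt_irrefl _ h1
    · rintro (h | h | h | h) <;> simp only [Set.mem_singleton_iff, Prod.mk.injEq] at h <;>
        linarith [hy.1, hy.2]
  have vert : ∀ χ : ℝ, χ ^ 2 = 1 → P = (χ, M.estar) → P ∈ closure M.outer := by
    intro χ hχ hP
    have hχ' : χ = 1 ∨ χ = -1 := eq_or_eq_of_sq hχ
    refine key (fun y => (χ, y)) M.estar (by fun_prop) hP.symm ?_
    filter_upwards [Ioo_mem_nhdsGT hs.2] with y hy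
    refine ⟨?_, ?_, ?_⟩
    · rw [closure_square]
      refine ⟨?_, by linarith [hy.1, hs.1], hy.2.le⟩
      rcases hχ' with rfl | rfl <;> norm_num
    · rintro ⟨⟨h1, h2⟩, -⟩
      rcases hχ' with rfl | rfl
      · exact lt_irrefl _ h2
      · exact lt_irrefl _ h1
    · rintro (h | h | h | h) <;> simp only [Set.mem_singleton_iff, Prod.mk.injEq] at h <;>
        linarith [hy.1, hy.2, hs.1, h.2]
  rcases hP with h | h | h | h
  · exact horiz 1 (by norm_num) h
  · exact horiz (-1) (by norm_num) h
  · exact vert 1 (by norm_num) h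
  · exact vert (-1) (by norm_num) h

/-- Scaling `χ`. -/
theorem tendsto_scale (P : ℝ × ℝ) : Tendsto (fun c : ℝ => ((c * P.1, P.2) : ℝ × ℝ)) (𝓝 1) (𝓝 P) := by
  have : Continuous fun c : ℝ => ((c * P.1, P.2) : ℝ × ℝ) := by fun_prop
  simpa using this.tendsto 1

theorem outerEdge_ne {P : ℝ × ℝ} (h : P ∈ M.outerEdge) : P.1 ≠ 0 := by
  intro h0
  obtain ⟨χ, η⟩ := P
  obtain rfl : χ = 0 := h0
  exact M.noPos_disjoint_outerEdge (M.axis_mem_noPos h.1.2) h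

/-- At a positive zero the only term depending on χ is -4χ² t n₀² < 0, so enlarging |χ| makes the
value negative. Shrinking |χ| makes `crit` positive on the whole half line, which gives the next
lemma. -/
theorem outerEdge_subset_closure_outer : M.outerEdge ⊆ closure M.outer := by
  intro P hP
  have hχ := M.outerEdge_ne hP
  obtain ⟨hsq, ⟨t, ht, h0⟩, -⟩ := hP
  have hlim := (tendsto_scale P).mono_left (nhdsWithin_le_nhds (s := Set.Ioi 1))
  refine mem_closure_of_tendsto hlim ?_
  filter_upwards [hlim.eventually (isOpen_square.mem_nhds hsq), self_mem_nhdsWithin] with c hc hc1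
  have hc1 : 1 < c := hc1
  refine ⟨hc, t, ht, ?_⟩
  rw [crit_eval] at h0 ⊢
  simp only
  have h1 : 0 < P.1 ^ 2 * (t * M.n0.eval t ^ 2) := by
    have := M.n0_eval_nonneg_ne ht.le
    positivity
  have h2 : 1 < c ^ 2 := by nlinarith
  nlinarith

theorem outerEdge_subset_closure_noPos : M.outerEdge ⊆ closure M.noPos := by
  intro P hP
  have hχ := M.outerEdge_ne hP
  obtain ⟨hsq, -, hall⟩ := hP
  have hlim := (tendsto_scale P).mono_left (nhdsWithin_le_nhds (s := Set.Iio 1))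
  refine mem_closure_of_tendsto hlim ?_
  filter_upwards [hlim.eventually (isOpen_square.mem_nhds hsq), self_mem_nhdsWithin,
    nhdsWithin_le_nhds (Ioi_mem_nhds (zero_lt_one' ℝ))] with c hc hc1 hc0
  have hc1 : c < 1 := hc1
  have hc0 : 0 < c := hc0
  refine ⟨hc, fun t ht => ?_⟩
  have h0 := hall t ht
  rw [crit_eval] at h0 ⊢
  simp only
  have h1 : 0 < P.1 ^ 2 * (t * M.n0.eval t ^ 2) := by
    have := M.n0_eval_nonneg_ne ht.le
    positivity
  have h2 : c ^ 2 < 1 := by nlinarith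
  nlinarith

theorem outerEdge_subset_closure_middle : M.outerEdge ⊆ closure M.middle := by
  intro P hP
  refine M.mem_closure_middle_of_noPos (M.outerEdge_subset_closure_noPos hP) ?_
  simp only [Set.mem_iUnion, not_exists]
  exact fun l hl h => M.noPos_disjoint_outerEdge
    (M.inner_subset_noPos (Finset.mem_Icc.2 hl) h) hP

/-! ### The inner edges -/

section
variable {l : ℕ} (hl : l ∈ Finset.Icc 1 M.g)
include hl

/-- Near a point over the gap `l` the other inner regions are absent. -/
theorem mem_closure_middle_of_inner {P : ℝ × ℝ} (hP : P ∈ M.inner l)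
    (h : P ∈ closure (M.inner l)ᶜ) : P ∈ closure M.middle := by
  set U := M.noPos ∩ (⋃ j ∈ Set.Icc 1 M.g \ {l}, M.inner j)ᶜ with hU
  have hUo : IsOpen U := M.isOpen_noPos.inter (((Set.finite_Icc 1 M.g).subset
    Set.sdiff_subset).isClosed_biUnion fun j hj =>
      M.isClosed_inner (Finset.mem_Icc.2 hj.1)).isOpen_compl
  have hPU : P ∈ U := by
    refine ⟨M.inner_subset_noPos hl hP, ?_⟩
    simp only [Set.mem_compl_iff, Set.mem_iUnion, not_exists]
    exact fun j hj => M.inner_disjoint hl (Finset.mem_Icc.2 hj.1) (Ne.symm hj.2) hP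
  refine closure_mono ?_ (hUo.inter_closure ⟨hPU, h⟩)
  rintro Q ⟨⟨h1, h2⟩, h3⟩
  refine M.middle_iff.2 ⟨h1, fun j hj => ?_⟩
  by_cases hjl : j = l
  · subst hjl; exact h3
  · simp only [Set.mem_compl_iff, Set.mem_iUnion, not_exists] at h2
    exact h2 j ⟨Finset.mem_Icc.1 hj, hjl⟩

omit hl in
theorem axisZero_mob {z : ℝ} (hz : z < 0) : axisZero (mob z) = z := by
  have : z - 1 ≠ 0 := by linarith
  rw [axisZero, mob]
  field_simp
  ring

omit hl in
theorem tendsto_axis {z : ℝ} (hz : z < 0) :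
    Tendsto (fun t => ((0, mob t) : ℝ × ℝ)) (𝓝 z) (𝓝 (0, mob z)) :=
  tendsto_const_nhds.prodMk_nhds (mob_hasDerivAt (by linarith)).continuousAt

/-- On χ = 0 membership in `inner` means that `axisZero` is in the closed gap, and alternation that
it is in the open one. -/
theorem innerEdge_axis {η : ℝ} (h : ((0, η) : ℝ × ℝ) ∈ M.innerEdge l) :
    η = mob (M.lo l) ∨ η = mob (M.hi l) := by
  obtain ⟨h1, h2⟩ := h
  have hη := h1.1.2
  have h3 := M.axisZero_mem_of_three hη hl ((by norm_num : 3 ≤ 4).trans h1.2)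
  rw [M.mem_alternating_axis hη hl] at h2
  have h4 := mob_axisZero hη
  rcases eq_or_lt_of_le h3.1 with h5 | h5
  · left; rw [h5, h4]
  rcases eq_or_lt_of_le h3.2 with h6 | h6
  · right; rw [← h6, h4]
  exact absurd ⟨h5, h6⟩ h2

theorem axis_mem_closure_alternating {z : ℝ} (hz : z ∈ Set.Icc (M.lo l) (M.hi l)) :
    ((0, mob z) : ℝ × ℝ) ∈ closure (M.alternating l) := by
  rw [← closure_Ioo (M.lo_lt_hi l hl).ne] at hz
  have hz0 : z < 0 := by
    rw [closure_Ioo (M.lo_lt_hi l hl).ne] at hz; exact M.gap_neg hl hz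
  have := mem_closure_iff_nhdsWithin_neBot.1 hz
  refine mem_closure_of_tendsto ((tendsto_axis hz0).mono_left
    (nhdsWithin_le_nhds (s := Set.Ioo (M.lo l) (M.hi l)))) ?_
  filter_upwards [self_mem_nhdsWithin] with t ht
  have ht0 := M.lt_zero hl ht
  rw [M.mem_alternating_axis (mob_mem ht0) hl, axisZero_mob ht0]
  exact ht

theorem axis_mem_closure_compl {z : ℝ} (hz : z = M.lo l ∨ z = M.hi l) :
    ((0, mob z) : ℝ × ℝ) ∈ closure (M.inner l)ᶜ := by
  have hlt := M.lo_lt_hi l hl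
  have hz0 : z < 0 := by
    rcases hz with rfl | rfl
    · exact M.gap_neg hl ⟨le_rfl, hlt.le⟩
    · exact M.hi_neg l hl
  have hout : ∀ t, t < 0 → t ∉ Set.Icc (M.lo l) (M.hi l) → ((0, mob t) : ℝ × ℝ) ∈ (M.inner l)ᶜ := by
    intro t ht hn h
    have := M.axisZero_mem_of_three (mob_mem ht) hl ((by norm_num : 3 ≤ 4).trans h.2)
    rw [axisZero_mob ht] at this
    exact hn this
  rcases hz with rfl | rfl
  · refine mem_closure_of_tendsto ((tendsto_axis hz0).mono_left
      (nhdsWithin_le_nhds (s := Set.Iio (M.lo l)))) ?_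
    filter_upwards [self_mem_nhdsWithin] with t ht
    have ht : t < M.lo l := ht
    exact hout t (ht.trans hz0) fun h => absurd h.1 ht.not_ge
  · refine mem_closure_of_tendsto ((tendsto_axis hz0).mono_left
      (nhdsWithin_le_nhds (s := Set.Ioi (M.hi l)))) ?_
    filter_upwards [self_mem_nhdsWithin, nhdsWithin_le_nhds (Iio_mem_nhds hz0)] with t ht ht0
    have ht : M.hi l < t := ht
    exact hout t ht0 fun h => absurd h.2 ht.not_ge

theorem innerEdge_subset_closure_alternating : M.innerEdge l ⊆ closure (M.alternating l) := by
  intro P h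
  have hlt := M.lo_lt_hi l hl
  by_cases hχ : P.1 = 0
  · obtain ⟨χ, η⟩ := P
    obtain rfl : χ = 0 := hχ
    rcases M.innerEdge_axis hl h with rfl | rfl
    · exact M.axis_mem_closure_alternating hl ⟨le_rfl, hlt.le⟩
    · exact M.axis_mem_closure_alternating hl ⟨hlt.le, le_rfl⟩
  · obtain ⟨τ, hτ, hmono⟩ := M.exists_sign hl hχ
    obtain ⟨z, hz, h2⟩ := M.exists_two_le_ord hl h.1.1 hτ hmono hχ (by have := h.1.2; omega) h.2
    exact M.mem_closure_alternating hl h.1.1 hτ hmono hχ hz h2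

/-- Moving away from the axis along the line of the sign change leaves the inner region. -/
theorem mem_closure_compl_of_notMem {P : ℝ × ℝ} (hP : P ∈ square) (hχ : P.1 ≠ 0)
    (hn : P ∉ M.alternating l) : P ∈ closure (M.inner l)ᶜ := by
  obtain ⟨τ, hτ, hmono⟩ := M.exists_sign hl hχ
  rw [M.mem_alternating_iff hl hP hτ hmono hχ] at hn
  obtain ⟨z, hz, h0, hleft, hright⟩ := M.exists_crossing hl hP hmono hn
  have hlim := (M.tendsto_line h0).mono_left (nhdsWithin_le_nhds (s := Set.Ioi 1))
  refine mem_closure_of_tendsto hlim ?_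
  filter_upwards [hlim.eventually (isOpen_square.mem_nhds hP), self_mem_nhdsWithin] with c hc hc1
  have hc1 : 1 < c := hc1
  have hc0 : 0 < c := by linarith
  have hχ' : (M.line P τ z c).1 ≠ 0 := mul_ne_zero hc0.ne' hχ
  have hmono' := M.line_mono hmono (z := z) hc0
  -- the sign of the equation on the sheet
  have hs : ∀ t, M.sheet (M.line P τ z c) τ t = M.sheet P τ t +
      (c - 1) * (τ * P.1 * M.slope z - τ * P.1 * M.slope t) := by
    intro t
    rw [sheet_line]
    rw [sheet] at h0 ⊢
    linear_combination -h0
  -- Moving outwards adds a multiple of the difference of the increasing `slope` terms, so the weak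
  -- signs on the two sides of the crossing become strict.
  have hL : ∀ t ∈ Set.Ioo (M.lo l) (M.hi l), t < z → 0 < M.sheet (M.line P τ z c) τ t := by
    intro t ht htz
    have h1 := hleft t ht htz
    have h2 := hmono ht hz htz
    simp only at h2
    rw [hs]; nlinarith
  have hR : ∀ t ∈ Set.Ioo (M.lo l) (M.hi l), z < t → M.sheet (M.line P τ z c) τ t < 0 := by
    intro t ht htz
    have h1 := hright t ht htz
    have h2 := hmono hz ht htz
    simp only at h2
    rw [hs]; nlinarith
  intro hin
  have hna : M.line P τ z c ∉ M.alternating l := by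
    rw [M.mem_alternating_iff hl hc hτ hmono' hχ']
    rintro ⟨a, ha, b, hb, hab, h1, h2⟩
    have haz : z ≤ a := by
      by_contra h; exact absurd (hL a ha (not_le.1 h)) h1.not_gt
    exact absurd (hR b hb (haz.trans_lt hab)) h2.not_gt
  -- Without alternation a higher-order zero must exist, and the strict signs place it at the
  -- crossing. There the derivative of `slope` already outweighs 2/(z - 1)² at P, and c > 1 makes it
  -- strictly larger, so the order cannot be two.
  obtain ⟨y, hy, hy2⟩ := M.exists_two_le_ord hl hc hτ hmono' hχ' (by have := hin.2; omega) hna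
  obtain ⟨hy0, hyd⟩ := (M.two_le_ord_sheet hl hy (square_ne hc) hτ).1 hy2
  obtain rfl : y = z := by
    rcases lt_trichotomy y z with h | h | h
    · exact absurd hy0 (hL y hy h).ne'
    · exact h
    · exact absurd hy0 (hR y hy h).ne
  -- the derivative at the sign change is negative
  have hd0 : 2 / (y - 1) ^ 2 - τ * P.1 * deriv M.slope y ≤ 0 := by
    have hder := M.sheet_hasDerivAt hl hy P τ
    have hI : ∀ᶠ t in 𝓝 y, t ∈ Set.Ioo (M.lo l) (M.hi l) := Ioo_mem_nhds hy.1 hy.2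
    by_contra hpos
    rw [not_le] at hpos
    have hs1 := (hasDerivAt_iff_tendsto_slope.1 hder).eventually_const_lt hpos
    have hr1 : ∀ᶠ t in 𝓝[>] y, 0 < _root_.slope (M.sheet P τ) y t :=
      hs1.filter_mono (nhdsWithin_mono _ fun t (ht : y < t) => ht.ne')
    obtain ⟨b, ⟨hb1, hb2⟩, hb3⟩ := ((hr1.and (hI.filter_mono nhdsWithin_le_nhds)).and
      (self_mem_nhdsWithin (s := Set.Ioi y))).exists
    have hb3 : y < b := hb3
    rw [slope_def_field, h0, sub_zero] at hb1
    have := div_nonpos_of_nonpos_of_nonneg (hright b hb2 hb3) (sub_pos.2 hb3).le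
    linarith
  have h4 := M.ne_one_of_gap hl hy
  have h5 : τ * (M.line P τ y c).1 * deriv M.slope y = c * (τ * P.1 * deriv M.slope y) := by
    simp only [line]; ring
  rw [h5] at hyd
  nlinarith

theorem innerEdge_subset_closure_middle : M.innerEdge l ⊆ closure M.middle := by
  intro P h
  refine M.mem_closure_middle_of_inner hl h.1 ?_
  by_cases hχ : P.1 = 0
  · obtain ⟨χ, η⟩ := P
    obtain rfl : χ = 0 := hχ
    rcases M.innerEdge_axis hl h with rfl | rfl
    · exact M.axis_mem_closure_compl hl (Or.inl rfl)
    · exact M.axis_mem_closure_compl hl (Or.inr rfl)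
  · exact M.mem_closure_compl_of_notMem hl h.1.1 hχ h.2

end

/-! ### The phase diagram -/

theorem closure_middle_subset_square : closure M.middle ⊆ closure square :=
  closure_mono fun _ h => h.1

theorem innerEdge_disjoint_middle {l : ℕ} (hl : l ∈ Finset.Icc 1 M.g) {P : ℝ × ℝ}
    (h : P ∈ M.innerEdge l) : P ∉ M.middle := fun h' => M.middle_disjoint_inner hl h' h.1

theorem outerEdge_disjoint_middle {P : ℝ × ℝ} (h : P ∈ M.outerEdge) : P ∉ M.middle := fun h' =>
  M.noPos_disjoint_outerEdge (M.middle_subset_noPos h') h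

/-- A limit point of `middle` cannot lie in the open sets `outer` and `alternating`, nor, on the
boundary of the square, where `crit` takes a negative value on the half line. What remains is the
stated union. -/
theorem frontier_middle : frontier M.middle =
    (M.outerEdge ∪ M.corners) ∪ ⋃ l ∈ Set.Icc 1 M.g, M.innerEdge l := by
  rw [M.isOpen_middle.frontier_eq]
  ext P
  constructor
  · rintro ⟨h1, h2⟩
    have hdisj : ∀ U : Set (ℝ × ℝ), IsOpen U → (∀ Q ∈ M.middle, Q ∉ U) → P ∉ U := by
      intro U hU hQ hPU
      obtain ⟨Q, hQU, hQm⟩ := mem_closure_iff.1 h1 U hU hPU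
      exact hQ Q hQm hQU
    by_cases hsq : P ∈ square
    · rcases M.noPos_or hsq with h | h | h
      · right
        rw [M.middle_iff] at h2
        push Not at h2
        obtain ⟨l, hl, hin⟩ := h2 h
        simp only [Set.mem_iUnion]
        refine ⟨l, Finset.mem_Icc.1 hl, hin, ?_⟩
        exact hdisj _ (M.isOpen_alternating l) fun Q hQ hQ' =>
          M.middle_disjoint_inner hl hQ (M.alternating_subset_inner hl hQ')
      · exact absurd h (hdisj _ M.isOpen_outer fun Q hQ =>
          M.noPos_disjoint_outer (M.middle_subset_noPos hQ))
      · exact Or.inl (Or.inl h)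
    · left; right
      by_contra hc
      have := M.exists_neg_of_boundary (M.closure_middle_subset_square h1) hsq hc
      exact hdisj _ M.isOpen_neg (fun Q hQ hQ' =>
        M.noPos_disjoint_outer (M.middle_subset_noPos hQ) ⟨hQ.1, hQ'⟩) this
  · rintro ((h | h) | h)
    · exact ⟨M.outerEdge_subset_closure_middle h, M.outerEdge_disjoint_middle h⟩
    · exact ⟨M.corners_subset_closure_middle h, fun h' => M.corners_disjoint_square h h'.1⟩
    · simp only [Set.mem_iUnion] at h
      obtain ⟨l, hl, h⟩ := h
      have hl' := Finset.mem_Icc.2 hl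
      exact ⟨M.innerEdge_subset_closure_middle hl' h, M.innerEdge_disjoint_middle hl' h⟩

theorem separates_outer : Separates (M.outerEdge ∪ M.corners) M.middle M.outer := by
  refine ⟨?_, ?_, ?_, ?_⟩
  · rw [M.frontier_middle, M.isOpen_outer.frontier_eq]
    ext P
    constructor
    · rintro ⟨h | h, h1, h2⟩
      · exact h
      · simp only [Set.mem_iUnion] at h
        obtain ⟨l, hl, h⟩ := h
        obtain ⟨Q, hQ, hQ'⟩ := mem_closure_iff.1 h1 M.noPos M.isOpen_noPos
          (M.inner_subset_noPos (Finset.mem_Icc.2 hl) h.1)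
        exact absurd hQ' (M.noPos_disjoint_outer hQ)
    · rintro (h | h)
      · exact ⟨Or.inl (Or.inl h), M.outerEdge_subset_closure_outer h,
          fun h' => M.outer_disjoint_outerEdge h' h⟩
      · exact ⟨Or.inl (Or.inr h), M.corners_subset_closure_outer h,
          fun h' => M.corners_disjoint_square h h'.1⟩
  · rintro P h (h' | h')
    · exact M.outerEdge_disjoint_middle h' h
    · exact M.corners_disjoint_square h' h.1
  · rintro P h (h' | h')
    · exact M.outer_disjoint_outerEdge h h'
    · exact M.corners_disjoint_square h' h.1
  · intro a ha b hb
    -- The exterior of the closed square joins the side of the frozen region. The boundary points of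
    -- the square are covered by the openness of the condition that `crit` is negative at some
    -- positive point.
    refine notMem_connectedComponentIn (U := M.noPos)
      (V := {P | ∃ t > 0, (M.crit P).eval t < 0} ∪ (closure square)ᶜ) M.isOpen_noPos
      (M.isOpen_neg.union isClosed_closure.isOpen_compl) ?_ ?_ (M.middle_subset_noPos ha)
      (Or.inl hb.2)
    · rintro P h (h' | h')
      · exact M.noPos_disjoint_outer h ⟨h.1, h'⟩
      · exact h' (subset_closure h.1)
    · intro P h
      rw [Set.mem_compl_iff, Set.mem_union, not_or] at h
      by_cases hc : P ∈ closure square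
      · by_cases hsq : P ∈ square
        · rcases M.noPos_or hsq with h' | h' | h'
          · exact Or.inl h'
          · exact Or.inr (Or.inl h'.2)
          · exact absurd h' h.1
        · exact Or.inr (Or.inl (M.exists_neg_of_boundary hc hsq h.2))
      · exact Or.inr (Or.inr hc)

theorem innerEdge_disjoint_alternating {l j : ℕ} (hl : l ∈ Finset.Icc 1 M.g)
    (hj : j ∈ Finset.Icc 1 M.g) {P : ℝ × ℝ} (h : P ∈ M.innerEdge l) : P ∉ M.alternating j := by
  intro h'
  by_cases hlj : l = j
  · subst hlj; exact h.2 h'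
  · exact M.inner_disjoint hl hj hlj h.1 (M.alternating_subset_inner hj h')

/-- An arbitrary set of gaps covers both the union of the inner curves and each single curve. -/
theorem separates_inner {s : Set ℕ} (hs : s ⊆ Set.Icc 1 M.g) :
    Separates (⋃ l ∈ s, M.innerEdge l) M.middle (⋃ l ∈ s, M.alternating l) := by
  have hs' : ∀ l ∈ s, l ∈ Finset.Icc 1 M.g := fun l hl => Finset.mem_Icc.2 (hs hl)
  have hfin := (Set.finite_Icc 1 M.g).subset hs
  have hopen : IsOpen (⋃ l ∈ s, M.alternating l) :=
    isOpen_biUnion fun l _ => M.isOpen_alternating l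
  have hedge : ∀ P ∈ ⋃ l ∈ s, M.innerEdge l, P ∉ ⋃ l ∈ s, M.alternating l := by
    intro P h
    simp only [Set.mem_iUnion, not_exists] at h ⊢
    obtain ⟨l, hl, h⟩ := h
    exact fun j hj => M.innerEdge_disjoint_alternating (hs' l hl) (hs' j hj) h
  refine ⟨?_, ?_, ?_, ?_⟩
  · rw [M.frontier_middle, hopen.frontier_eq]
    ext P
    constructor
    · rintro ⟨-, h1, h2⟩
      rw [hfin.closure_biUnion] at h1
      simp only [Set.mem_iUnion, not_exists] at h1 h2 ⊢
      obtain ⟨l, hl, h1⟩ := h1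
      exact ⟨l, hl, M.closure_alternating_subset (hs' l hl) h1, h2 l hl⟩
    · intro h
      refine ⟨Or.inr ?_, ?_, hedge P h⟩
      · simp only [Set.mem_iUnion] at h ⊢
        obtain ⟨l, hl, h⟩ := h
        exact ⟨l, hs hl, h⟩
      · simp only [Set.mem_iUnion] at h
        obtain ⟨l, hl, h⟩ := h
        exact closure_mono (Set.subset_biUnion_of_mem (u := fun l => M.alternating l) hl)
          (M.innerEdge_subset_closure_alternating (hs' l hl) h)
  · intro P h h'
    simp only [Set.mem_iUnion] at h'
    obtain ⟨l, hl, h'⟩ := h'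
    exact M.innerEdge_disjoint_middle (hs' l hl) h' h
  · exact fun P h h' => hedge P h' h
  · intro a ha b hb
    -- The part of the plane missed by the two open sets is `inner` without `alternating`, which is
    -- the curve itself.
    refine notMem_connectedComponentIn (U := (⋃ l ∈ s, M.inner l)ᶜ)
      (V := ⋃ l ∈ s, M.alternating l)
      (hfin.isClosed_biUnion fun l hl => M.isClosed_inner (hs' l hl)).isOpen_compl hopen ?_ ?_ ?_ hb
    · intro P h h'
      simp only [Set.mem_compl_iff, Set.mem_iUnion, not_exists] at h h'
      obtain ⟨l, hl, h'⟩ := h'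
      exact h l hl (M.alternating_subset_inner (hs' l hl) h')
    · intro P h
      by_cases h' : P ∈ ⋃ l ∈ s, M.inner l
      · right
        simp only [Set.mem_compl_iff, Set.mem_iUnion, not_exists] at h h' ⊢
        obtain ⟨l, hl, h'⟩ := h'
        by_contra hn
        exact h l hl ⟨h', fun h'' => hn ⟨l, hl, h''⟩⟩
      · exact Or.inl h'
    · simp only [Set.mem_compl_iff, Set.mem_iUnion, not_exists]
      exact fun l hl => M.middle_disjoint_inner (hs' l hl) ha

end GapModel

/-! ### The differential `dF` in local coordinates -/

/-- The reduced data belong to the given weights. -/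
structure Reduces {k : ℕ} (α β : Fin k → ℝ) (M : GapModel) : Prop where
  one_le : 1 ≤ k
  pos_α : ∀ m, 0 < α m
  pos_β : ∀ m, 0 < β m
  shape : LayerShape k 1 (polyPhi α β)
  g_eq : M.g = kPrime α β - 1
  lo_eq : M.lo = fun l => x α β (2 * l)
  hi_eq : M.hi = fun l => x α β (2 * l - 1)
  κ_eq : M.κ = k
  estar_eq : M.estar = tangency α β
  p0_eq : p0 α β = X * M.p1
  num_eq : num α β = M.n0

section
variable {k : ℕ} {α β : Fin k → ℝ}

theorem trace_Phi (hα : ∀ m, 0 < α m) (hβ : ∀ m, 0 < β m) {z : ℂ} (h0 : z ≠ 0) (h1 : z ≠ 1) :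
    (Phi α β z).trace = aeval z (tr α β) / (z - 1) ^ k := by
  have h := congrArg Matrix.trace (eval_polyPhi α β hα hβ h0 h1)
  have hz : (z - 1) ^ k ≠ 0 := pow_ne_zero _ (sub_ne_zero.2 h1)
  rw [eq_div_iff hz, tr, Matrix.trace_fin_two, Matrix.trace_fin_two]
  rw [Matrix.trace_fin_two, Matrix.trace_fin_two] at h
  simp at h
  rw [map_add, h]; ring

theorem aeval_p (z : ℂ) : aeval z (q α β) ^ 2 * aeval z (p0 α β) =
    aeval z (tr α β) ^ 2 - 4 * (z - 1) ^ (2 * k) := by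
  have h := congrArg (aeval z) ((q_sq_mul_p0 α β).trans (p_eq α β))
  have h4 : aeval z (4 : ℝ[X]) = (4 : ℂ) := map_ofNat _ 4
  simpa [h4] using h

/-- The logarithmic derivative of `ρ`. -/
theorem logDeriv_rho (hk : 1 ≤ k) (hα : ∀ m, 0 < α m) (hβ : ∀ m, 0 < β m)
    (h : LayerShape k 1 (polyPhi α β)) {Z W : ℂ → ℂ} {s Z' : ℂ} (hZ : HasDerivAt Z Z' s)
    (hW : DifferentiableAt ℂ W s) (hsq : ∀ᶠ t in 𝓝 s, W t ^ 2 = aeval (Z t) (p0 α β))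
    (h0 : Z s ≠ 0) (h1 : Z s ≠ 1) (hw : W s ≠ 0) :
    logDeriv (fun t => rho α β (Z t) (W t)) s =
      Z' * aeval (Z s) (num α β) / ((Z s - 1) * W s) := by
  have hz1 : Z s - 1 ≠ 0 := sub_ne_zero.2 h1
  have e1 : (fun t => rho α β (Z t) (W t)) =ᶠ[𝓝 s]
      fun t => (aeval (Z t) (tr α β) + aeval (Z t) (q α β) * W t) / (2 * (Z t - 1) ^ k) := by
    filter_upwards [hZ.continuousAt.eventually_ne h0, hZ.continuousAt.eventually_ne h1]
      with t ht0 ht1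
    have : (Z t - 1) ^ k ≠ 0 := pow_ne_zero _ (sub_ne_zero.2 ht1)
    rw [rho, trace_Phi hα hβ ht0 ht1]
    field_simp
  have hq := ((q α β).hasDerivAt_aeval (Z s)).comp s hZ
  have ht := ((tr α β).hasDerivAt_aeval (Z s)).comp s hZ
  have hp := ((p0 α β).hasDerivAt_aeval (Z s)).comp s hZ
  have hw' := hW.hasDerivAt
  have hsq' : 2 * W s * deriv W s = aeval (Z s) (derivative (p0 α β)) * Z' := by
    have h2 := (hw'.pow 2).congr_of_eventuallyEq (f₁ := fun t => aeval (Z t) (p0 α β))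
      (hsq.mono fun t ht => ht.symm)
    have := h2.unique hp
    simpa using this
  have hW2 := hsq.self_of_nhds
  -- The product of T + qw with its conjugate is 4(z - 1)²ᵏ, so ρ has no zero away from z = 1.
  have hN0 : aeval (Z s) (tr α β) + aeval (Z s) (q α β) * W s ≠ 0 := by
    intro hN
    have h2 := aeval_p (α := α) (β := β) (Z s)
    rw [← hW2] at h2
    have h3 : (4 : ℂ) * (Z s - 1) ^ (2 * k) = 0 := by
      linear_combination (aeval (Z s) (tr α β) - aeval (Z s) (q α β) * W s) * hN + h2
    exact mul_ne_zero (by norm_num) (pow_ne_zero _ hz1) h3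
  have hN : HasDerivAt (fun t => aeval (Z t) (tr α β) + aeval (Z t) (q α β) * W t)
      (aeval (Z s) (derivative (tr α β)) * Z' + (aeval (Z s) (derivative (q α β)) * Z' * W s +
        aeval (Z s) (q α β) * deriv W s)) s := ht.add (hq.mul hw')
  have hD : HasDerivAt (fun t => 2 * (Z t - 1) ^ k) (2 * (k * (Z s - 1) ^ (k - 1) * Z')) s :=
    ((hZ.sub_const 1).pow k).const_mul 2
  have hD0 : 2 * (Z s - 1) ^ k ≠ 0 := mul_ne_zero two_ne_zero (pow_ne_zero _ hz1)
  have e2 : rho α β (Z s) (W s) =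
      (aeval (Z s) (tr α β) + aeval (Z s) (q α β) * W s) / (2 * (Z s - 1) ^ k) := e1.self_of_nhds
  rw [logDeriv_apply, e1.deriv_eq, e2, (hN.fun_div hD hD0).deriv]
  have hkk : (Z s - 1) ^ k = (Z s - 1) ^ (k - 1) * (Z s - 1) := by
    rw [← pow_succ, Nat.sub_add_cancel hk]
  have i1 := congrArg (aeval (Z s)) (num_identity hk h)
  have i2 := congrArg (aeval (Z s)) (q_mul_num hk h)
  rw [trNum] at i2
  simp only [map_sub, map_mul, map_add, aeval_X, map_one, aeval_C, map_ofNat] at i1 i2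
  simp only [Complex.coe_algebraMap, Complex.ofReal_natCast] at i1 i2
  rw [← hW2] at i1
  have hpk : (Z s - 1) ^ (k - 1) ≠ 0 := pow_ne_zero _ hz1
  rw [hkk]
  generalize (Z s - 1) ^ (k - 1) = D at *
  generalize aeval (Z s) (tr α β) = T at *
  generalize aeval (Z s) (derivative (tr α β)) = T' at *
  generalize aeval (Z s) (q α β) = Q at *
  generalize aeval (Z s) (derivative (q α β)) = Q' at *
  generalize aeval (Z s) (num α β) = R at *
  generalize aeval (Z s) (derivative (p0 α β)) = p' at *
  generalize deriv W s = W' at *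
  generalize W s = w at *
  generalize Z s = z at *
  have key : 2 * ((T' * Z' + (Q' * Z' * w + Q * W')) * (z - 1) * w - k * Z' * (T + Q * w) * w) =
      2 * (Z' * R * (T + Q * w)) := by
    linear_combination (z - 1) * Q * hsq' + Z' * i1 - 2 * Z' * w * i2
  rw [div_div_eq_mul_div, div_eq_div_iff hN0 (mul_ne_zero hz1 hw)]
  field_simp
  linear_combination (1 / 2) * key

/-- The orders of the differential from a local normal form. -/
theorem critOrder_eq {P : ℝ × ℝ} {y : Surface α β} {n : ℤ} {g : ℂ → ℂ} (hg : AnalyticAt ℂ g 0)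
    (h0 : g 0 ≠ 0) (h : ∀ᶠ s in 𝓝[≠] (0 : ℂ), dF α β P y s = s ^ n * g s) :
    critOrder α β P y = n := by
  have hm : MeromorphicAt (fun s : ℂ => s ^ n * g s) 0 :=
    ((MeromorphicAt.id 0).zpow n).mul hg.meromorphicAt
  rw [critOrder, meromorphicOrderAt_congr h, meromorphicOrderAt_eq_int_iff hm]
  exact ⟨g, hg, h0, Eventually.of_forall fun s => by simp⟩

namespace Reduces
variable {M : GapModel} (hR : Reduces α β M)
include hR

theorem root_real {z : ℂ} (h : aeval z (p0 α β) = 0) : ∃ e : ℝ, z = e ∧ (p0 α β).eval e = 0 := by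
  have hs := p0_splits hR.one_le hR.pos_α hR.pos_β hR.shape
  have hne := p0_ne_zero hR.one_le hR.shape
  have h2 : z ∈ ((p0 α β).map (algebraMap ℝ ℂ)).roots := by
    rw [mem_roots (map_ne_zero_of_ne hne), IsRoot, eval_map_algebraMap, h]
  rw [hs.roots_map] at h2
  obtain ⟨e, he, rfl⟩ := Multiset.mem_map.1 h2
  exact ⟨e, rfl, (mem_roots'.1 he).2⟩

/-- The zeros of `p₀` are simple. -/
theorem exists_factor {e : ℝ} (h : (p0 α β).eval e = 0) :
    ∃ r : ℝ[X], p0 α β = (X - C e) * r ∧ r.eval e ≠ 0 := by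
  have hne := p0_ne_zero hR.one_le hR.shape
  have h1 : (p0 α β).rootMultiplicity e = 1 := by
    rw [← count_roots]
    exact Multiset.count_eq_one_of_mem (p0_roots_nodup hR.one_le hR.shape) ((mem_roots hne).2 h)
  obtain ⟨r, hr, hnd⟩ := exists_eq_pow_rootMultiplicity_mul_and_not_dvd (p0 α β) hne e
  rw [h1, pow_one] at hr
  exact ⟨r, hr, by simpa [dvd_iff_isRoot] using hnd⟩

theorem deriv_ne_zero {z : ℂ} (h : aeval z (p0 α β) = 0) :
    aeval z (derivative (p0 α β)) ≠ 0 := by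
  obtain ⟨e, rfl, he⟩ := hR.root_real h
  obtain ⟨r, hr, hr0⟩ := hR.exists_factor he
  rw [aeval_ofReal, hr]
  simpa using hr0

/-- The differential away from its poles and zeros at special points. -/
theorem dF_eq {P : ℝ × ℝ} {y : Surface α β} {s Z' : ℂ} (hs : s ≠ 0)
    (hZ : HasDerivAt (locZ α β y) Z' s) (hW : DifferentiableAt ℂ (locW α β y) s)
    (h0 : locZ α β y s ≠ 0) (h1 : locZ α β y s ≠ 1) (hw : locW α β y s ≠ 0) :
    dF α β P y s = Z' / (4 * locZ α β y s * (locZ α β y s - 1) * locW α β y s) *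
      (aeval (locZ α β y s) (M.lin P.2) * locW α β y s -
        P.1 * (2 * locZ α β y s * aeval (locZ α β y s) M.n0)) := by
  have hsq : ∀ᶠ t in 𝓝 s, locW α β y t ^ 2 = aeval (locZ α β y t) (p0 α β) := by
    filter_upwards [isOpen_ne.mem_nhds hs] with t ht
    refine locW_sq α β y ht fun a _ ha => hR.deriv_ne_zero ?_
    rw [← a.2, ha]; simp
  have h1' : locZ α β y s - 1 ≠ 0 := sub_ne_zero.2 h1
  rw [dF, logDeriv_rho hR.one_le hR.pos_α hR.pos_β hR.shape hZ hW hsq h0 h1 hw,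
    logDeriv_apply, logDeriv_apply, hZ.deriv, (hZ.sub_const 1).deriv, hR.num_eq, GapModel.lin]
  simp only [map_sub, map_mul, aeval_X, aeval_C, map_add, map_one, hR.κ_eq,
    Complex.coe_algebraMap]
  push_cast
  field_simp
  ring

section regular
variable {a : AffineCurve α β} (ha : a.1.2 ≠ 0)
include ha

omit hR in
theorem locZ_regular : locZ α β (a : Surface α β) = fun s => a.1.1 + s := if_neg ha

omit hR in
theorem locW_regular : locW α β (a : Surface α β) = branch (p0 α β) a.1.1 a.1.2 := if_neg ha

omit ha in
theorem w_sq : a.1.2 ^ 2 = aeval a.1.1 (X * M.p1) := by rw [← hR.p0_eq]; exact a.2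

theorem z_ne_zero : a.1.1 ≠ 0 := M.z_ne_zero ha hR.w_sq

theorem dF_regular (P : ℝ × ℝ) : ∀ᶠ s in 𝓝[≠] (0 : ℂ), dF α β P (a : Surface α β) s =
    1 / (4 * (a.1.1 + s) * (a.1.1 + s - 1) * branch (p0 α β) a.1.1 a.1.2 s) *
      M.psi P a.1.1 a.1.2 s := by
  have hA := branch_analyticAt (f := p0 α β) ha a.2
  have hz0 := hR.z_ne_zero ha
  have e1 : ∀ᶠ s in 𝓝[≠] (0 : ℂ), a.1.1 + s ≠ 1 := by
    by_cases h : a.1.1 = 1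
    · filter_upwards [self_mem_nhdsWithin] with s hs
      rw [h]; simpa using hs
    · have : ContinuousAt (fun s : ℂ => a.1.1 + s) 0 := by fun_prop
      exact (this.eventually_ne (by simpa using h)).filter_mono nhdsWithin_le_nhds
  have e0 : ∀ᶠ s in 𝓝[≠] (0 : ℂ), a.1.1 + s ≠ 0 := by
    have : ContinuousAt (fun s : ℂ => a.1.1 + s) 0 := by fun_prop
    exact (this.eventually_ne (by simpa using hz0)).filter_mono nhdsWithin_le_nhds
  have ew : ∀ᶠ s in 𝓝[≠] (0 : ℂ), branch (p0 α β) a.1.1 a.1.2 s ≠ 0 :=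
    (hA.continuousAt.eventually_ne (by rwa [branch_zero ha a.2])).filter_mono nhdsWithin_le_nhds
  have ed := hA.eventually_analyticAt.filter_mono (nhdsWithin_le_nhds (s := {0}ᶜ))
  filter_upwards [self_mem_nhdsWithin, e0, e1, ew, ed] with s hs h0 h1 hw hd
  have := hR.dF_eq (P := P) (y := (a : Surface α β)) (s := s) (Z' := 1) hs
    (by rw [locZ_regular ha]; exact (hasDerivAt_id s).const_add _)
    (by rw [locW_regular ha]; exact hd.differentiableAt)
    (by rw [locZ_regular ha]; exact h0) (by rw [locZ_regular ha]; exact h1)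
    (by rw [locW_regular ha]; exact hw)
  rw [this, locZ_regular ha, locW_regular ha, GapModel.psi, ← hR.p0_eq]

theorem critOrder_regular {P : ℝ × ℝ} (hP : P.2 ≠ 1) (h1 : a.1.1 ≠ 1) :
    critOrder α β P (a : Surface α β) = ((M.ord P a.1.1 a.1.2 : ℕ) : ℤ) := by
  have hsq := hR.w_sq (a := a)
  have hA := branch_analyticAt (f := p0 α β) ha a.2
  have hz0 := hR.z_ne_zero ha
  obtain ⟨g, hg, hg0, hge⟩ := ((M.psi_analyticAt (P := P) ha hsq).analyticOrderAt_eq_natCast).1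
    (M.coe_ord ha hsq (M.crit_ne_zero hP)).symm
  have hne : 4 * (a.1.1 + 0) * (a.1.1 + 0 - 1) * branch (p0 α β) a.1.1 a.1.2 0 ≠ 0 := by
    rw [branch_zero ha a.2, add_zero]
    exact mul_ne_zero (mul_ne_zero (mul_ne_zero (by norm_num) hz0) (sub_ne_zero.2 h1)) ha
  refine critOrder_eq (g := fun s => 1 / (4 * (a.1.1 + s) * (a.1.1 + s - 1) *
    branch (p0 α β) a.1.1 a.1.2 s) * g s) ?_ (mul_ne_zero (one_div_ne_zero hne) hg0) ?_
  · exact (analyticAt_const.div ((by fun_prop : AnalyticAt ℂ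
      (fun s : ℂ => 4 * (a.1.1 + s) * (a.1.1 + s - 1)) 0).mul hA) hne).mul hg
  · filter_upwards [hR.dF_regular ha P, hge.filter_mono nhdsWithin_le_nhds] with s h1 h2
    rw [h1, h2, sub_zero, smul_eq_mul, zpow_natCast]; ring

/-- The prefactor of dF has a simple pole over z = 1, and the numerator does not vanish there
because `crit` takes the value 4(1 - χ²)κ² p₁(1) > 0. -/
theorem critOrder_one {P : ℝ × ℝ} (hP : P ∈ square) (h1 : a.1.1 = 1) :
    critOrder α β P (a : Surface α β) = ((-1 : ℤ) : WithTop ℤ) := by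
  have hsq := hR.w_sq (a := a)
  have hA := branch_analyticAt (f := p0 α β) ha a.2
  have hne := M.crit_ne_zero (GapModel.square_ne hP)
  have hpsi : M.psi P a.1.1 a.1.2 0 ≠ 0 := by
    have h2 := M.ord_add_ord ha hsq hne
    have h3 : (M.crit P).eval 1 ≠ 0 := by
      have h4 := M.at_one
      rw [← GapModel.n0] at h4
      have h5 : (M.crit P).eval 1 = 4 * (1 - P.1 ^ 2) * (M.κ ^ 2 * M.p1.eval 1) := by
        rw [M.crit_eval]
        linear_combination (4 * P.1 ^ 2) * h4
      rw [h5]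
      have h6 : P.1 ^ 2 < 1 := by nlinarith [hP.1.1, hP.1.2]
      have h7 := M.p1_pos_of_nonneg zero_le_one
      have h8 := M.κ_pos
      have : 0 < 1 - P.1 ^ 2 := by linarith
      positivity
    have h4 : ((M.crit P).map (algebraMap ℝ ℂ)).rootMultiplicity a.1.1 = 0 := by
      rw [rootMultiplicity_eq_zero_iff]
      intro h5
      rw [h1, IsRoot, show (1 : ℂ) = ((1 : ℝ) : ℂ) by simp, eval_map_ofReal] at h5
      exact absurd (by exact_mod_cast h5) h3
    intro h5
    have h6 : ¬ 1 ≤ M.ord P a.1.1 a.1.2 := by omega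
    rw [M.one_le_ord_iff ha hsq hne] at h6
    rw [M.psi_zero ha hsq, sub_eq_zero] at h5
    exact h6 h5
  have hne2 : 4 * (1 + 0) * branch (p0 α β) a.1.1 a.1.2 0 ≠ 0 := by
    rw [branch_zero ha a.2]
    simpa using ha
  refine critOrder_eq (g := fun s => M.psi P a.1.1 a.1.2 s / (4 * (1 + s) *
    branch (p0 α β) a.1.1 a.1.2 s)) ?_ (div_ne_zero hpsi hne2) ?_
  · exact (M.psi_analyticAt ha hsq).div ((by fun_prop : AnalyticAt ℂ
      (fun s : ℂ => 4 * (1 + s)) 0).mul hA) hne2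
  · filter_upwards [hR.dF_regular ha P, self_mem_nhdsWithin] with s h2 hs
    have hs : s ≠ 0 := hs
    rw [h2, h1, zpow_neg_one, add_sub_cancel_left]
    field_simp

end regular

end Reduces
end

/-! ### The differential at the branch points and at infinity -/

section
variable {k : ℕ} {α β : Fin k → ℝ}

theorem analyticAt_aeval_sq (f : ℝ[X]) (e : ℂ) : AnalyticAt ℂ (fun s : ℂ => aeval (e + s ^ 2) f) 0 :=
  AnalyticAt.aeval_polynomial (by fun_prop) f

theorem locZ_branch {a : AffineCurve α β} (ha : a.1.2 = 0) :
    locZ α β (a : Surface α β) = fun s => a.1.1 + s ^ 2 := if_pos ha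

namespace Reduces
variable {M : GapModel} (hR : Reduces α β M)
include hR

/-- The local normal form of `w` at a branch point. -/
theorem exists_locW_branch {a : AffineCurve α β} (ha : a.1.2 = 0) :
    ∃ G : ℂ → ℂ, AnalyticAt ℂ G 0 ∧ G 0 ≠ 0 ∧
      ∀ᶠ s in 𝓝[≠] (0 : ℂ), locW α β (a : Surface α β) s = s * G s := by
  have h0 : aeval a.1.1 (p0 α β) = 0 := by rw [← a.2, ha]; simp
  obtain ⟨e, he, he0⟩ := hR.root_real h0
  obtain ⟨r, hr, hr0⟩ := hR.exists_factor he0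
  have hd := hR.deriv_ne_zero h0
  have hrz : ∀ z : ℂ, aeval z (p0 α β) = (z - e) * aeval z r := fun z => by rw [hr]; simp
  have hd2 : aeval a.1.1 (derivative (p0 α β)) = aeval a.1.1 r := by
    have : ∀ z : ℂ, aeval z (derivative (p0 α β)) = aeval z r + (z - e) * aeval z (derivative r) :=
      fun z => by rw [hr]; simp
    rw [this, he]; simp
  set c := aeval a.1.1 (derivative (p0 α β)) with hc
  have hA : AnalyticAt ℂ (fun s : ℂ => aeval (a.1.1 + s ^ 2) r / c) 0 :=
    (analyticAt_aeval_sq r _).div_const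
  have h1 : aeval (a.1.1 + 0 ^ 2) r / c = 1 := by
    rw [zero_pow two_ne_zero, add_zero, ← hd2, div_self hd]
  have hc0 : c ^ (1 / 2 : ℂ) ≠ 0 := fun h => hd (by rw [← cpow_half_sq c, h]; simp)
  refine ⟨fun s => c ^ (1 / 2 : ℂ) * (aeval (a.1.1 + s ^ 2) r / c) ^ (1 / 2 : ℂ),
    analyticAt_const.mul (hA.cpow analyticAt_const ?_), ?_, ?_⟩
  · rw [h1]; exact Complex.one_mem_slitPlane
  · simp only [h1, Complex.one_cpow, mul_one]; exact hc0
  · filter_upwards [self_mem_nhdsWithin] with s hs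
    have hs : s ≠ 0 := hs
    have e1 : locW α β (a : Surface α β) s = s * c ^ (1 / 2 : ℂ) *
        (aeval (a.1.1 + s ^ 2) (p0 α β) / (c * s ^ 2)) ^ (1 / 2 : ℂ) := by
      have : locW α β (a : Surface α β) = fun s => s * c ^ (1 / 2 : ℂ) *
        (aeval (a.1.1 + s ^ 2) (p0 α β) / (c * s ^ 2)) ^ (1 / 2 : ℂ) := if_pos ha
      rw [this]
    -- The quotient extends analytically to s = 0 with value 1, where the principal square root is
    -- analytic.
    have e2 : aeval (a.1.1 + s ^ 2) (p0 α β) / (c * s ^ 2) = aeval (a.1.1 + s ^ 2) r / c := by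
      rw [hrz, he, add_sub_cancel_left]
      field_simp
    rw [e1, e2, mul_assoc]

/-- With z = e + s² and w = sG, the factor 2s of dz cancels the factor s of w in the denominator. -/
theorem dF_branch {a : AffineCurve α β} (ha : a.1.2 = 0) {G : ℂ → ℂ} (hG : AnalyticAt ℂ G 0)
    (hG0 : G 0 ≠ 0) (hW : ∀ᶠ s in 𝓝[≠] (0 : ℂ), locW α β (a : Surface α β) s = s * G s)
    (P : ℝ × ℝ) : ∀ᶠ s in 𝓝[≠] (0 : ℂ), a.1.1 + s ^ 2 ≠ 0 ∧ a.1.1 + s ^ 2 ≠ 1 ∧ G s ≠ 0 ∧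
      dF α β P (a : Surface α β) s =
        (s * aeval (a.1.1 + s ^ 2) (M.lin P.2) * G s -
          P.1 * (2 * (a.1.1 + s ^ 2) * aeval (a.1.1 + s ^ 2) M.n0)) /
        (2 * (a.1.1 + s ^ 2) * (a.1.1 + s ^ 2 - 1) * G s) := by
  have h0 : aeval a.1.1 (p0 α β) = 0 := by rw [← a.2, ha]; simp
  obtain ⟨e, he, he0⟩ := hR.root_real h0
  have hc : ContinuousAt (fun s : ℂ => a.1.1 + s ^ 2) 0 := by fun_prop
  have hne1 : a.1.1 ≠ 1 := by
    rw [he]; intro h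
    have h2 : e = 1 := by exact_mod_cast h
    rw [hR.p0_eq, h2] at he0
    simp at he0
    exact (M.p1_pos_of_nonneg zero_le_one).ne' he0
  have e1 : ∀ᶠ s in 𝓝[≠] (0 : ℂ), a.1.1 + s ^ 2 ≠ 1 :=
    (hc.eventually_ne (by simpa using hne1)).filter_mono nhdsWithin_le_nhds
  have e0 : ∀ᶠ s in 𝓝[≠] (0 : ℂ), a.1.1 + s ^ 2 ≠ 0 := by
    by_cases h : a.1.1 = 0
    · filter_upwards [self_mem_nhdsWithin] with s hs
      rw [h, zero_add]; exact pow_ne_zero 2 hs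
    · exact (hc.eventually_ne (by simpa using h)).filter_mono nhdsWithin_le_nhds
  have eG := (hG.continuousAt.eventually_ne hG0).filter_mono (nhdsWithin_le_nhds (s := {0}ᶜ))
  have ed := hG.eventually_analyticAt.filter_mono (nhdsWithin_le_nhds (s := {0}ᶜ))
  filter_upwards [self_mem_nhdsWithin, e0, e1, eG, ed, hW,
    eventually_eventually_nhdsWithin.2 hW] with s hs h0 h1 hg hd hw hww
  have hs : s ≠ 0 := hs
  have hww' : locW α β (a : Surface α β) =ᶠ[𝓝 s] fun t => t * G t := by
    rwa [isOpen_compl_singleton.nhdsWithin_eq hs] at hww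
  have hZ : HasDerivAt (locZ α β (a : Surface α β)) (2 * s) s := by
    rw [locZ_branch ha]
    simpa using (hasDerivAt_pow 2 s).const_add a.1.1
  have := hR.dF_eq (P := P) (y := (a : Surface α β)) hs hZ
    ((differentiableAt_id.mul hd.differentiableAt).congr_of_eventuallyEq hww')
    (by rw [locZ_branch ha]; exact h0) (by rw [locZ_branch ha]; exact h1)
    (by rw [hw]; exact mul_ne_zero hs hg)
  refine ⟨h0, h1, hg, ?_⟩
  rw [this, hw, locZ_branch ha]
  have h1' : a.1.1 + s ^ 2 - 1 ≠ 0 := sub_ne_zero.2 h1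
  field_simp
  ring

/-- The point `(0, 0)` is a simple pole. -/
theorem critOrder_zero {a : AffineCurve α β} (ha : a.1.2 = 0) (hz : a.1.1 = 0) {P : ℝ × ℝ}
    (hP : P ∈ square) : critOrder α β P (a : Surface α β) = ((-1 : ℤ) : WithTop ℤ) := by
  obtain ⟨G, hG, hG0, hW⟩ := hR.exists_locW_branch ha
  have hl := analyticAt_aeval_sq (M.lin P.2) 0
  have hn := analyticAt_aeval_sq M.n0 0
  have hden : 2 * ((0 : ℂ) ^ 2 - 1) * G 0 ≠ 0 := by simpa using hG0
  have hlin : aeval (0 : ℂ) (M.lin P.2) ≠ 0 := by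
    rw [show (0 : ℂ) = ((0 : ℝ) : ℂ) by simp, aeval_ofReal, M.lin_eval]
    have h1 := M.κ_pos
    have h2 := hP.2.1
    have : M.κ * ((P.2 - 1) * 0 - (P.2 + 1)) < 0 := by nlinarith
    exact_mod_cast this.ne
  refine critOrder_eq (g := fun s => (aeval (0 + s ^ 2) (M.lin P.2) * G s -
    P.1 * (2 * s * aeval (0 + s ^ 2) M.n0)) / (2 * (s ^ 2 - 1) * G s)) ?_ ?_ ?_
  · exact ((hl.mul hG).sub (analyticAt_const.mul ((by fun_prop : AnalyticAt ℂ
      (fun s : ℂ => 2 * s) 0).mul hn))).div ((by fun_prop : AnalyticAt ℂ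
      (fun s : ℂ => 2 * (s ^ 2 - 1)) 0).mul hG) hden
  · refine div_ne_zero ?_ hden
    simpa using ⟨hlin, hG0⟩
  · filter_upwards [hR.dF_branch ha hG hG0 hW P, self_mem_nhdsWithin] with s h hs
    have hs : s ≠ 0 := hs
    obtain ⟨h0, h1, hg, h⟩ := h
    rw [hz, zero_add] at h1
    have h1' : s ^ 2 - 1 ≠ 0 := sub_ne_zero.2 h1
    rw [h, hz, zpow_neg_one]
    simp only [zero_add]
    field_simp

section
variable {a : AffineCurve α β} (ha : a.1.2 = 0) {e : ℝ} (he : a.1.1 = e)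
  (he0 : e < 0) {P : ℝ × ℝ}
include ha he he0

theorem critOrder_branch_ne (hn : M.n0.eval e ≠ 0) (hχ : P.1 ≠ 0) :
    critOrder α β P (a : Surface α β) = ((0 : ℤ) : WithTop ℤ) := by
  obtain ⟨G, hG, hG0, hW⟩ := hR.exists_locW_branch ha
  have hl := analyticAt_aeval_sq (M.lin P.2) e
  have hnn := analyticAt_aeval_sq M.n0 e
  have hez : (e : ℂ) ≠ 0 := by exact_mod_cast he0.ne
  have hez1 : (e : ℂ) - 1 ≠ 0 := by
    have : e - 1 ≠ 0 := by linarith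
    exact_mod_cast this
  have hden : 2 * ((e : ℂ) + 0 ^ 2) * ((e : ℂ) + 0 ^ 2 - 1) * G 0 ≠ 0 := by
    rw [zero_pow two_ne_zero, add_zero]
    exact mul_ne_zero (mul_ne_zero (mul_ne_zero two_ne_zero hez) hez1) hG0
  refine critOrder_eq (g := fun s => (s * aeval ((e : ℂ) + s ^ 2) (M.lin P.2) * G s -
    P.1 * (2 * ((e : ℂ) + s ^ 2) * aeval ((e : ℂ) + s ^ 2) M.n0)) /
    (2 * ((e : ℂ) + s ^ 2) * ((e : ℂ) + s ^ 2 - 1) * G s)) ?_ (div_ne_zero ?_ hden) ?_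
  · exact (((analyticAt_id.mul hl).mul hG).sub (analyticAt_const.mul ((by fun_prop : AnalyticAt ℂ
      (fun s : ℂ => 2 * ((e : ℂ) + s ^ 2)) 0).mul hnn))).div ((by fun_prop : AnalyticAt ℂ
      (fun s : ℂ => 2 * ((e : ℂ) + s ^ 2) * ((e : ℂ) + s ^ 2 - 1)) 0).mul hG) hden
  · rw [zero_pow two_ne_zero, add_zero, aeval_ofReal M.n0]
    have : ((M.n0.eval e : ℝ) : ℂ) ≠ 0 := by exact_mod_cast hn
    have : (P.1 : ℂ) ≠ 0 := by exact_mod_cast hχ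
    simp [*]
  · filter_upwards [hR.dF_branch ha hG hG0 hW P] with s h
    rw [h.2.2.2, he, zpow_zero, one_mul]

theorem critOrder_branch_axis (hχ : P.1 = 0) (hl0 : (M.lin P.2).eval e ≠ 0) :
    critOrder α β P (a : Surface α β) = ((1 : ℤ) : WithTop ℤ) := by
  obtain ⟨G, hG, hG0, hW⟩ := hR.exists_locW_branch ha
  have hl := analyticAt_aeval_sq (M.lin P.2) e
  have hez : (e : ℂ) ≠ 0 := by exact_mod_cast he0.ne
  have hez1 : (e : ℂ) - 1 ≠ 0 := by
    have : e - 1 ≠ 0 := by linarith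
    exact_mod_cast this
  have hden : 2 * ((e : ℂ) + 0 ^ 2) * ((e : ℂ) + 0 ^ 2 - 1) ≠ 0 := by
    rw [zero_pow two_ne_zero, add_zero]
    exact mul_ne_zero (mul_ne_zero two_ne_zero hez) hez1
  refine critOrder_eq (g := fun s => aeval ((e : ℂ) + s ^ 2) (M.lin P.2) /
    (2 * ((e : ℂ) + s ^ 2) * ((e : ℂ) + s ^ 2 - 1))) ?_ (div_ne_zero ?_ hden) ?_
  · exact hl.div (by fun_prop) hden
  · rw [zero_pow two_ne_zero, add_zero, aeval_ofReal]
    exact_mod_cast hl0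
  · filter_upwards [hR.dF_branch ha hG hG0 hW P] with s h
    obtain ⟨h0, h1, hg, h⟩ := h
    rw [he] at h0 h1
    have h1' := sub_ne_zero.2 h1
    rw [h, he, zpow_one, hχ]
    simp only [Complex.ofReal_zero, zero_mul, sub_zero]
    field_simp

/-- When e is the zero of the linear factor, that factor equals κ(η - 1)s²; one more s comes from w.
-/
theorem critOrder_branch_axisZero (hP : P ∈ square) (hχ : P.1 = 0)
    (hl0 : (M.lin P.2).eval e = 0) :
    critOrder α β P (a : Surface α β) = ((3 : ℤ) : WithTop ℤ) := by
  obtain ⟨G, hG, hG0, hW⟩ := hR.exists_locW_branch ha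
  have hez : (e : ℂ) ≠ 0 := by exact_mod_cast he0.ne
  have hez1 : (e : ℂ) - 1 ≠ 0 := by
    have : e - 1 ≠ 0 := by linarith
    exact_mod_cast this
  have hden : 2 * ((e : ℂ) + 0 ^ 2) * ((e : ℂ) + 0 ^ 2 - 1) ≠ 0 := by
    rw [zero_pow two_ne_zero, add_zero]
    exact mul_ne_zero (mul_ne_zero two_ne_zero hez) hez1
  have hl : ∀ s : ℂ, aeval ((e : ℂ) + s ^ 2) (M.lin P.2) = (M.κ * (P.2 - 1) : ℝ) * s ^ 2 := by
    intro s
    rw [M.lin_eval] at hl0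
    have h1 : (M.κ : ℂ) * ((P.2 - 1) * e - (P.2 + 1)) = 0 := by exact_mod_cast hl0
    simp only [GapModel.lin, map_mul, map_sub, map_add, aeval_C, aeval_X, map_one,
      Complex.coe_algebraMap]
    push_cast
    linear_combination h1
  refine critOrder_eq (g := fun s => ((M.κ * (P.2 - 1) : ℝ) : ℂ) /
    (2 * ((e : ℂ) + s ^ 2) * ((e : ℂ) + s ^ 2 - 1))) ?_ (div_ne_zero ?_ hden) ?_
  · exact analyticAt_const.div (by fun_prop) hden
  · have h1 := hP.2.2
    have := mul_ne_zero M.κ_pos.ne' (by linarith : P.2 - 1 ≠ 0)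
    exact_mod_cast this
  · filter_upwards [hR.dF_branch ha hG hG0 hW P] with s h
    obtain ⟨h0, h1, hg, h⟩ := h
    rw [he] at h0 h1
    have h1' := sub_ne_zero.2 h1
    rw [h, he, hl, hχ, show ((3 : ℤ)) = ((3 : ℕ) : ℤ) by rfl, zpow_natCast]
    simp only [Complex.ofReal_zero, zero_mul, sub_zero]
    field_simp

end

/-- The point at infinity is a simple pole. -/
theorem critOrder_infty {P : ℝ × ℝ} (hP : P ∈ square) :
    critOrder α β P OnePoint.infty = ((-1 : ℤ) : WithTop ℤ) := by
  have hne := p0_ne_zero hR.one_le hR.shape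
  set R : ℂ → ℂ := fun s => (aeval (s ^ 2) (p0 α β).reverse) ^ (1 / 2 : ℂ) with hRdef
  have hp0 : aeval ((0 : ℂ) ^ 2) (p0 α β).reverse = ((p0 α β).leadingCoeff : ℂ) := by
    rw [zero_pow two_ne_zero, ← coeff_zero_eq_aeval_zero', coeff_zero_reverse]; rfl
  have hlead := p0_leadingCoeff_pos hR.one_le hR.shape
  have hRa : AnalyticAt ℂ R 0 := by
    refine AnalyticAt.cpow (AnalyticAt.aeval_polynomial (by fun_prop) _) analyticAt_const ?_
    rw [hp0]
    exact Complex.ofReal_mem_slitPlane.2 hlead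
  have hR0 : R 0 ≠ 0 := by
    intro h
    have h2 := cpow_half_sq (aeval ((0 : ℂ) ^ 2) (p0 α β).reverse)
    rw [show (aeval ((0 : ℂ) ^ 2) (p0 α β).reverse) ^ (1 / 2 : ℂ) = R 0 from rfl, h, hp0] at h2
    simp only [ne_eq, OfNat.ofNat_ne_zero, not_false_eq_true, zero_pow] at h2
    exact hlead.ne (by exact_mod_cast h2)
  have hZf : locZ α β (OnePoint.infty : Surface α β) = fun s => (s ^ 2)⁻¹ := rfl
  have hWf : locW α β (OnePoint.infty : Surface α β) =
      fun s => s⁻¹ ^ (p0 α β).natDegree * R s := rfl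
  have hd : (p0 α β).natDegree = 2 * M.g + 1 := by
    rw [p0_natDegree hR.one_le hR.shape, hR.g_eq]
  have hn : ∀ s : ℂ, s ≠ 0 → aeval ((s ^ 2)⁻¹) M.n0 = aeval (s ^ 2) M.n0.reverse * (s⁻¹) ^ (2 * M.g) := by
    intro s hs
    let _ := invertibleOfNonzero (inv_ne_zero (pow_ne_zero 2 hs))
    have := Polynomial.eval₂_reverse_mul_pow (algebraMap ℝ ℂ) (s ^ 2)⁻¹ M.n0
    simp only [invOf_eq_inv, inv_inv] at this
    rw [aeval_def, aeval_def, ← this, M.n0_natDegree, pow_mul, inv_pow s 2]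
  have hna : AnalyticAt ℂ (fun s : ℂ => aeval (s ^ 2) M.n0.reverse) 0 :=
    AnalyticAt.aeval_polynomial (by fun_prop) _
  -- Here dz/z = -2 ds/s. The linear factor grows like s⁻² and z n₀/w at most like s⁻¹, so the
  -- χ-term carries an extra s and g(0) = -κ(η - 1)/2.
  refine critOrder_eq (g := fun s => (M.κ * ((P.2 - 1) - (P.2 + 1) * s ^ 2) -
    2 * P.1 * s * (aeval (s ^ 2) M.n0.reverse / R s)) / (-2 * (1 - s ^ 2))) ?_ ?_ ?_
  · refine AnalyticAt.div (AnalyticAt.sub (by fun_prop) (AnalyticAt.mul (by fun_prop)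
      (hna.div hRa hR0))) (by fun_prop) (by norm_num)
  · refine div_ne_zero ?_ (by norm_num)
    have h1 := mul_ne_zero M.κ_pos.ne' (by linarith [hP.2.2] : P.2 - 1 ≠ 0)
    have h2 : ((M.κ * (P.2 - 1) : ℝ) : ℂ) ≠ 0 := by exact_mod_cast h1
    push_cast at h2
    simpa using h2
  · have e1 : ∀ᶠ s in 𝓝[≠] (0 : ℂ), s ^ 2 ≠ 1 := by
      have : ContinuousAt (fun s : ℂ => s ^ 2) 0 := by fun_prop
      exact (this.eventually_ne (by simp)).filter_mono nhdsWithin_le_nhds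
    have eR := (hRa.continuousAt.eventually_ne hR0).filter_mono (nhdsWithin_le_nhds (s := {0}ᶜ))
    have ed := hRa.eventually_analyticAt.filter_mono (nhdsWithin_le_nhds (s := {0}ᶜ))
    filter_upwards [self_mem_nhdsWithin, e1, eR, ed] with s hs h1 hr hda
    have hs : s ≠ 0 := hs
    have hs2 : s ^ 2 ≠ 0 := pow_ne_zero 2 hs
    have hZ : HasDerivAt (locZ α β (OnePoint.infty : Surface α β)) (-2 / s ^ 3) s := by
      rw [hZf]
      refine ((hasDerivAt_pow 2 s).fun_inv hs2).congr_deriv ?_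
      field_simp
      ring
    have hz1 : (s ^ 2)⁻¹ ≠ 1 := fun h => h1 (inv_eq_one.1 h)
    have := hR.dF_eq (P := P) (y := OnePoint.infty) hs hZ
      (by
        rw [hWf]
        exact ((differentiableAt_inv hs).pow _).mul hda.differentiableAt)
      (by rw [hZf]; exact inv_ne_zero hs2) (by rw [hZf]; exact hz1)
      (by rw [hWf]; exact mul_ne_zero (pow_ne_zero _ (inv_ne_zero hs)) hr)
    rw [this, hZf, hWf, hd]
    simp only
    rw [hn s hs]
    have h1' : 1 - s ^ 2 ≠ 0 := sub_ne_zero.2 (Ne.symm h1)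
    have h1'' : (s ^ 2)⁻¹ - 1 ≠ 0 := sub_ne_zero.2 hz1
    have hl : aeval ((s ^ 2)⁻¹) (M.lin P.2) =
        M.κ * ((P.2 - 1) - (P.2 + 1) * s ^ 2) * (s ^ 2)⁻¹ := by
      simp only [GapModel.lin, map_mul, map_sub, map_add, aeval_C, aeval_X, map_one,
        Complex.coe_algebraMap]
      field_simp
    have e3 : (s ^ 2)⁻¹ - 1 = (1 - s ^ 2) * (s ^ 2)⁻¹ := by field_simp
    rw [hl, e3, zpow_neg_one]
    have hu : s⁻¹ ^ (2 * M.g) ≠ 0 := pow_ne_zero _ (inv_ne_zero hs)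
    rw [pow_succ s⁻¹ (2 * M.g)]
    generalize s⁻¹ ^ (2 * M.g) = u at *
    generalize aeval (s ^ 2) M.n0.reverse = v at *
    generalize R s = w at *
    field_simp
    ring

end Reduces
end

/-! ### Critical points on the surface in terms of the polynomial `crit` -/

section
variable {k : ℕ} {α β : Fin k → ℝ}

namespace Reduces
variable {M : GapModel} (hR : Reduces α β M)
include hR

section
variable {P : ℝ × ℝ} (hP : P ∈ square)
include hP

theorem not_critical_infty : ¬ 1 ≤ critOrder α β P OnePoint.infty := by
  rw [hR.critOrder_infty hP]; decide

section regular
variable {a : AffineCurve α β} (ha : a.1.2 ≠ 0)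
include ha

theorem one_le_regular : 1 ≤ critOrder α β P (a : Surface α β) ↔
    a.1.1 ≠ 1 ∧ 1 ≤ M.ord P a.1.1 a.1.2 := by
  by_cases h1 : a.1.1 = 1
  · rw [hR.critOrder_one ha hP h1]; simp only [h1, ne_eq, not_true, false_and, iff_false]; decide
  · rw [hR.critOrder_regular ha (GapModel.square_ne hP) h1]
    simp only [ne_eq, h1, not_false_eq_true, true_and]
    norm_cast

theorem two_le_regular : 2 ≤ critOrder α β P (a : Surface α β) ↔
    a.1.1 ≠ 1 ∧ 2 ≤ M.ord P a.1.1 a.1.2 := by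
  by_cases h1 : a.1.1 = 1
  · rw [hR.critOrder_one ha hP h1]; simp only [h1, ne_eq, not_true, false_and, iff_false]; decide
  · rw [hR.critOrder_regular ha (GapModel.square_ne hP) h1]
    simp only [ne_eq, h1, not_false_eq_true, true_and]
    rw [show (2 : WithTop ℤ) = ((2 : ℤ) : WithTop ℤ) from rfl, WithTop.coe_le_coe]
    norm_cast

theorem eq_two_regular : critOrder α β P (a : Surface α β) = 2 ↔
    a.1.1 ≠ 1 ∧ M.ord P a.1.1 a.1.2 = 2 := by
  by_cases h1 : a.1.1 = 1
  · rw [hR.critOrder_one ha hP h1]; simp only [h1, ne_eq, not_true, false_and, iff_false]; decide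
  · rw [hR.critOrder_regular ha (GapModel.square_ne hP) h1]
    simp only [ne_eq, h1, not_false_eq_true, true_and]
    rw [show (2 : WithTop ℤ) = ((2 : ℤ) : WithTop ℤ) from rfl, WithTop.coe_eq_coe]
    norm_cast

end regular

section branch
variable {a : AffineCurve α β} (ha : a.1.2 = 0)
include ha

omit hP in
/-- A branch point lies over the end of a gap or over zero. -/
theorem branch_real : ∃ e : ℝ, a.1.1 = e ∧ (e = 0 ∨ e < 0 ∧ M.p1.eval e = 0 ∧ M.n0.eval e ≠ 0) := by
  have h0 : aeval a.1.1 (p0 α β) = 0 := by rw [← a.2, ha]; simp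
  obtain ⟨e, he, he0⟩ := hR.root_real h0
  refine ⟨e, he, ?_⟩
  by_cases hz : e = 0
  · exact Or.inl hz
  rw [hR.p0_eq, eval_mul, eval_X, mul_eq_zero, or_iff_right hz] at he0
  refine Or.inr ⟨?_, he0, M.n0_ne_zero_eval fun l hl h => (M.p1_neg hl h).ne he0⟩
  by_contra hneg
  exact (M.p1_pos_of_nonneg (not_lt.1 hneg)).ne' he0

theorem one_le_branch : 1 ≤ critOrder α β P (a : Surface α β) ↔ a.1.1 ≠ 0 ∧ P.1 = 0 := by
  obtain ⟨e, he, h | ⟨h1, h2, h3⟩⟩ := hR.branch_real ha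
  · have hz : a.1.1 = 0 := by rw [he, h]; simp
    rw [hR.critOrder_zero ha hz hP]
    simp only [hz, ne_eq, not_true, false_and, iff_false]; decide
  · have hz : a.1.1 ≠ 0 := by rw [he]; exact_mod_cast h1.ne
    by_cases hχ : P.1 = 0
    · simp only [hz, hχ, ne_eq, not_false_eq_true, and_true, iff_true]
      by_cases hl : (M.lin P.2).eval e = 0
      · rw [hR.critOrder_branch_axisZero ha he h1 hP hχ hl]; decide
      · rw [hR.critOrder_branch_axis ha he h1 hχ hl]; decide
    · rw [hR.critOrder_branch_ne ha he h1 h3 hχ]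
      simp only [hχ, and_false, iff_false]; decide

theorem two_le_branch {e : ℝ} (he : a.1.1 = e) : 2 ≤ critOrder α β P (a : Surface α β) ↔
    e ≠ 0 ∧ P.1 = 0 ∧ (M.lin P.2).eval e = 0 := by
  obtain ⟨e', he', h⟩ := hR.branch_real ha
  obtain rfl : e = e' := Complex.ofReal_injective (he.symm.trans he')
  rcases h with h | ⟨h1, h2, h3⟩
  · have hz : a.1.1 = 0 := by rw [he, h]; simp
    rw [hR.critOrder_zero ha hz hP]
    simp only [h, ne_eq, not_true, false_and, iff_false]; decide
  · by_cases hχ : P.1 = 0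
    · simp only [h1.ne, hχ, ne_eq, not_false_eq_true, true_and]
      by_cases hl : (M.lin P.2).eval e = 0
      · rw [hR.critOrder_branch_axisZero ha he h1 hP hχ hl]
        simp only [hl, iff_true]; decide
      · rw [hR.critOrder_branch_axis ha he h1 hχ hl]
        simp only [hl, iff_false]; decide
    · rw [hR.critOrder_branch_ne ha he h1 h3 hχ]
      simp only [hχ, false_and, and_false, iff_false]; decide

end branch
end

/-! ### The ovals -/

omit hR in
theorem coe_mem_oval_zero {a : AffineCurve α β} :
    (a : Surface α β) ∈ oval α β 0 ↔ ∃ t : ℝ, 0 ≤ t ∧ a.1.1 = t := by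
  simp only [oval, if_true, Set.mem_ofPred_eq]
  constructor
  · rintro (h | ⟨b, hb, t, ht, h⟩)
    · exact absurd h (OnePoint.coe_ne_infty a)
    · rw [OnePoint.coe_injective hb]; exact ⟨t, ht, h⟩
  · rintro ⟨t, ht, h⟩
    exact Or.inr ⟨a, rfl, t, ht, h⟩

theorem mem_oval_iff {l : ℕ} (hl : l ∈ Finset.Icc 1 M.g) {y : Surface α β} :
    y ∈ oval α β l ↔ ∃ a : AffineCurve α β, y = (a : Surface α β) ∧
      ∃ t ∈ Set.Icc (M.lo l) (M.hi l), a.1.1 = (t : ℂ) := by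
  have h0 : l ≠ 0 := by have := Finset.mem_Icc.1 hl; omega
  rw [oval, if_neg h0, hR.lo_eq, hR.hi_eq]; rfl

theorem coe_mem_oval_iff {l : ℕ} (hl : l ∈ Finset.Icc 1 M.g) {a : AffineCurve α β} :
    (a : Surface α β) ∈ oval α β l ↔ a.1.1 ∈ M.gapC l := by
  rw [hR.mem_oval_iff hl]
  constructor
  · rintro ⟨b, hb, h⟩; rw [OnePoint.coe_injective hb]; exact h
  · intro h; exact ⟨a, rfl, h⟩

theorem coe_mem_ovals_iff {a : AffineCurve α β} : (a : Surface α β) ∈ ovals α β ↔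
    (∃ t : ℝ, 0 ≤ t ∧ a.1.1 = t) ∨ ∃ l ∈ Finset.Icc 1 M.g, a.1.1 ∈ M.gapC l := by
  simp only [ovals, Set.mem_iUnion]
  constructor
  · rintro ⟨l, hl, h⟩
    by_cases h0 : l = 0
    · subst h0; exact Or.inl (coe_mem_oval_zero.1 h)
    · have hl' : l ∈ Finset.Icc 1 M.g := by
        rw [hR.g_eq]; exact Finset.mem_Icc.2 ⟨by omega, hl.2⟩
      exact Or.inr ⟨l, hl', (hR.coe_mem_oval_iff hl').1 h⟩
  · rintro (h | ⟨l, hl, h⟩)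
    · exact ⟨0, ⟨le_rfl, Nat.zero_le _⟩, coe_mem_oval_zero.2 h⟩
    · refine ⟨l, ⟨Nat.zero_le _, ?_⟩, (hR.coe_mem_oval_iff hl).2 h⟩
      have := (Finset.mem_Icc.1 hl).2
      rwa [hR.g_eq] at this

/-! ### The rough region -/

theorem eval_crit_of_ord {P : ℝ × ℝ} (hP : P ∈ square) {a : AffineCurve α β} (ha : a.1.2 ≠ 0)
    (h : 1 ≤ M.ord P a.1.1 a.1.2) : ((M.crit P).map (algebraMap ℝ ℂ)).eval a.1.1 = 0 := by
  have hne := M.crit_ne_zero (GapModel.square_ne hP)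
  have h1 := M.ord_add_ord ha hR.w_sq hne
  exact (rootMultiplicity_pos (map_ne_zero_of_ne hne)).1 (by omega)

omit hR in
theorem p1_ne_zero_of_rest {z : ℂ} (hz : z ∈ M.restC) : aeval z M.p1 ≠ 0 := by
  intro h
  simp only [GapData.p1, map_mul, aeval_C, map_prod, map_sub, aeval_X, mul_eq_zero,
    Finset.prod_eq_zero_iff] at h
  rcases h with h | ⟨l, hl, h | h⟩
  · exact M.lead_pos.ne' (by simpa using h)
  · exact hz.2 l hl ⟨M.lo l, ⟨le_rfl, (M.lo_lt_hi l hl).le⟩, sub_eq_zero.1 h⟩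
  · exact hz.2 l hl ⟨M.hi l, ⟨(M.lo_lt_hi l hl).le, le_rfl⟩, sub_eq_zero.1 h⟩

/-- A point off the ovals is not a branch point, since all zeros of p₀ are 0 or ends of gaps; the
point at infinity is a pole. So critical points off the ovals correspond to zeros of `crit` in
`restC`. -/
theorem rough_eq : rough α β = M.middle := by
  ext P
  constructor
  · rintro ⟨hP, y, hy, hyo⟩
    refine ⟨hP, ?_⟩
    rcases y with _ | a
    · exact absurd hy (hR.not_critical_infty hP)
    change (a : Surface α β) ∈ _ at hy
    change (a : Surface α β) ∉ _ at hyo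
    rw [hR.coe_mem_ovals_iff, not_or] at hyo
    obtain ⟨h1, h2⟩ := hyo
    push Not at h2
    have hrest : a.1.1 ∈ M.restC := ⟨fun ⟨t, ht, h⟩ => h1 ⟨t, ht.le, h⟩, h2⟩
    have ha : a.1.2 ≠ 0 := by
      intro h
      have h3 := hR.w_sq (a := a)
      rw [h, map_mul, aeval_X] at h3
      have h4 : a.1.1 ≠ 0 := fun h => h1 ⟨0, le_rfl, by simpa using h⟩
      exact mul_ne_zero h4 (p1_ne_zero_of_rest hrest) (by rw [← h3]; simp)
    exact ⟨a.1.1, hrest, hR.eval_crit_of_ord hP ha ((hR.one_le_regular hP ha).1 hy).2⟩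
  · rintro ⟨hP, z, hz, h0⟩
    refine ⟨hP, ?_⟩
    have hne := M.crit_ne_zero (GapModel.square_ne hP)
    have hz0 : z ≠ 0 := by
      rintro rfl
      rw [show (0 : ℂ) = ((0 : ℝ) : ℂ) by simp, eval_map_ofReal] at h0
      exact (M.crit_zero_pos hP.2.1.ne').ne' (by exact_mod_cast h0)
    have hz1 : z ≠ 1 := by rintro rfl; exact hz.1 ⟨1, one_pos, by simp⟩
    obtain ⟨w, hw⟩ := IsAlgClosed.exists_pow_nat_eq (aeval z (X * M.p1)) two_pos
    have hw0 : w ≠ 0 := by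
      rintro rfl
      rw [map_mul, aeval_X] at hw
      exact mul_ne_zero hz0 (p1_ne_zero_of_rest hz) (by rw [← hw]; simp)
    have hsum := M.ord_add_ord (P := P) hw0 hw hne
    have hpos := (rootMultiplicity_pos (map_ne_zero_of_ne hne)).2 h0
    -- The orders over the two lifts sum to a positive multiplicity, so one of them is critical.
    have hex : ∃ w : ℂ, w ≠ 0 ∧ w ^ 2 = aeval z (X * M.p1) ∧ 1 ≤ M.ord P z w := by
      by_cases h : 1 ≤ M.ord P z w
      · exact ⟨w, hw0, hw, h⟩
      · exact ⟨-w, neg_ne_zero.2 hw0, by rw [neg_sq, hw], by omega⟩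
    obtain ⟨w, hw0, hw, ho⟩ := hex
    let a : AffineCurve α β := ⟨(z, w), by rw [hR.p0_eq]; exact hw⟩
    refine ⟨(a : Surface α β), (hR.one_le_regular (a := a) hP hw0).2 ⟨hz1, ho⟩, ?_⟩
    rw [hR.coe_mem_ovals_iff]
    rintro (⟨t, ht, h⟩ | ⟨l, hl, h⟩)
    · have h : z = t := h
      rcases eq_or_lt_of_le ht with h' | h'
      · exact hz0 (by rw [h, ← h']; simp)
      · exact hz.1 ⟨t, h', h⟩
    · exact hz.2 l hl h

/-! ### The frozen region -/

section positive
variable {P : ℝ × ℝ} (hP : P ∈ square)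
include hP

omit hR in
theorem lin_neg {t : ℝ} (ht : 0 < t) : (M.lin P.2).eval t < 0 := by
  rw [M.lin_eval]
  have h1 := M.κ_pos
  have h2 : (P.2 - 1) * t - (P.2 + 1) < 0 := by nlinarith [hP.2.1, hP.2.2]
  exact mul_neg_of_pos_of_neg h1 h2

omit hR in
theorem crit_one_ne : (M.crit P).eval 1 ≠ 0 := by
  have h4 := M.at_one
  rw [← GapModel.n0] at h4
  have h5 : (M.crit P).eval 1 = 4 * (1 - P.1 ^ 2) * (M.κ ^ 2 * M.p1.eval 1) := by
    rw [M.crit_eval]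
    linear_combination (4 * P.1 ^ 2) * h4
  rw [h5]
  have h6 : P.1 ^ 2 < 1 := by nlinarith [hP.1.1, hP.1.2]
  have h7 := M.p1_pos_of_nonneg zero_le_one
  have h8 := M.κ_pos
  have : 0 < 1 - P.1 ^ 2 := by linarith
  positivity

/-- Critical points on the outer oval lie over zeros on the positive half line. -/
theorem exists_of_critical {y : Surface α β} (hy : y ∈ oval α β 0)
    (hc : 1 ≤ critOrder α β P y) : ∃ a : AffineCurve α β, y = (a : Surface α β) ∧ a.1.2 ≠ 0 ∧
      1 ≤ M.ord P a.1.1 a.1.2 ∧ ∃ t : ℝ, 0 < t ∧ a.1.1 = t ∧ (M.crit P).eval t = 0 := by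
  rcases y with _ | a
  · exact absurd hc (hR.not_critical_infty hP)
  change (a : Surface α β) ∈ _ at hy
  change 1 ≤ critOrder α β P (a : Surface α β) at hc
  obtain ⟨t, ht, hat⟩ := coe_mem_oval_zero.1 hy
  have ha : a.1.2 ≠ 0 := by
    intro ha
    obtain ⟨e, he, h⟩ := hR.branch_real ha
    obtain rfl : t = e := Complex.ofReal_injective (hat.symm.trans he)
    rcases h with rfl | ⟨h, -⟩
    · exact ((hR.one_le_branch hP ha).1 hc).1 (by simpa using he)
    · exact absurd ht h.not_ge
  have ho := ((hR.one_le_regular hP ha).1 hc).2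
  have ht0 : 0 < t := by
    refine lt_of_le_of_ne ht fun h => hR.z_ne_zero ha ?_
    rw [hat, ← h]; simp
  refine ⟨a, rfl, ha, ho, t, ht0, hat, ?_⟩
  have := hR.eval_crit_of_ord hP ha ho
  rw [hat, eval_map_ofReal] at this
  exact_mod_cast this

/-- Over a positive point there is at most one critical point. -/
theorem w_unique {a b : AffineCurve α β} (ha : a.1.2 ≠ 0) (hb : b.1.2 ≠ 0) {t : ℝ} (ht : 0 < t)
    (hat : a.1.1 = t) (hbt : b.1.1 = t) (hoa : 1 ≤ M.ord P a.1.1 a.1.2)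
    (hob : 1 ≤ M.ord P b.1.1 b.1.2) : a = b := by
  have hne := M.crit_ne_zero (GapModel.square_ne hP)
  rw [M.one_le_ord_iff ha hR.w_sq hne, hat] at hoa
  rw [M.one_le_ord_iff hb hR.w_sq hne, hbt] at hob
  have hl : aeval (t : ℂ) (M.lin P.2) ≠ 0 := by
    rw [aeval_ofReal]; exact_mod_cast (lin_neg hP ht).ne
  exact Subtype.ext (Prod.ext (hat.trans hbt.symm) (mul_left_cancel₀ hl (hoa.trans hob.symm)))

/-- A positive zero carries one critical point, of the order of its multiplicity. -/
theorem exists_critical {t : ℝ} (ht : 0 < t) (h0 : (M.crit P).eval t = 0) :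
    ∃ a : AffineCurve α β, a.1.1 = t ∧ a.1.2 ≠ 0 ∧ a.1.1 ≠ 1 ∧
      M.ord P a.1.1 a.1.2 = (M.crit P).rootMultiplicity t := by
  have hne := M.crit_ne_zero (GapModel.square_ne hP)
  have hp : 0 < t * M.p1.eval t := mul_pos ht (M.p1_pos_of_nonneg ht.le)
  have hsq : (((√(t * M.p1.eval t) : ℝ) : ℂ)) ^ 2 = aeval (t : ℂ) (X * M.p1) := by
    rw [aeval_ofReal]
    norm_cast
    rw [Real.sq_sqrt hp.le]; simp
  have hw : ((√(t * M.p1.eval t) : ℝ) : ℂ) ≠ 0 := by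
    exact_mod_cast (Real.sqrt_pos.2 hp).ne'
  generalize ((√(t * M.p1.eval t) : ℝ) : ℂ) = w at hsq hw
  have hsum := M.ord_add_ord (P := P) hw hsq hne
  rw [← Complex.coe_algebraMap, ← eq_rootMultiplicity_map (algebraMap ℝ ℂ).injective t,
    Complex.coe_algebraMap] at hsum
  have hm := one_le_rootMultiplicity hne h0
  have ht1 : (t : ℂ) ≠ 1 := by
    intro h
    have : t = 1 := by exact_mod_cast h
    rw [this] at h0
    exact crit_one_ne hP h0
  have hl : aeval (t : ℂ) (M.lin P.2) ≠ 0 := by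
    rw [aeval_ofReal]; exact_mod_cast (lin_neg hP ht).ne
  have hw' := neg_ne_zero.2 hw
  have hsq' : (-w) ^ 2 = aeval (t : ℂ) (X * M.p1) := by rw [neg_sq, hsq]
  -- The linear factor is negative for t > 0, so the critical equation determines w and cannot hold
  -- for both w and -w.
  have hnot : ¬ (1 ≤ M.ord P t w ∧ 1 ≤ M.ord P t (-w)) := by
    rintro ⟨h1, h2⟩
    rw [M.one_le_ord_iff hw hsq hne] at h1
    rw [M.one_le_ord_iff hw' hsq' hne] at h2
    have h3 := mul_left_cancel₀ hl (h1.trans h2.symm)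
    exact hw (self_eq_neg.1 h3)
  by_cases h : 1 ≤ M.ord P t w
  · refine ⟨⟨(t, w), by rw [hR.p0_eq]; exact hsq⟩, rfl, hw, ht1, ?_⟩
    have : ¬ 1 ≤ M.ord P t (-w) := fun h' => hnot ⟨h, h'⟩
    simp only
    omega
  · refine ⟨⟨(t, -w), by rw [hR.p0_eq]; exact hsq'⟩, rfl, hw', ht1, ?_⟩
    simp only
    omega

end positive

/-- Distinct critical points on the outer oval project to distinct positive zeros. If `crit` were
nonnegative on the half line, both would be double, four zeros where two are possible. -/
theorem frozen_eq : frozen α β = M.outer := by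
  ext P
  constructor
  · rintro ⟨hP, h2⟩
    have h2' := Set.one_lt_encard_iff.1 (lt_of_lt_of_le (by norm_num) h2)
    obtain ⟨y, y', hy, hy', hne⟩ := h2'
    obtain ⟨a, rfl, ha, hoa, t, ht, hat, ht0⟩ := hR.exists_of_critical hP hy.2 hy.1
    obtain ⟨b, rfl, hb, hob, s, hs, hbs, hs0⟩ := hR.exists_of_critical hP hy'.2 hy'.1
    have hts : t ≠ s := by
      rintro rfl
      exact hne (congrArg _ (hR.w_unique hP ha hb ht hat hbs hoa hob))
    rcases M.noPos_or hP with h | h | h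
    · exact absurd ht0 (h.2 t ht).ne'
    · exact h
    · exfalso
      have hc := M.crit_ne_zero (GapModel.square_ne hP)
      have m : ∀ u : ℝ, 0 < u → (M.crit P).eval u = 0 → 2 ≤ (M.crit P).rootMultiplicity u :=
        fun u hu h0 => two_le_of_nonneg hc h0
          (by filter_upwards [Ioi_mem_nhds hu] with v hv using h.2.2 v hv)
      have h3 := sum_rootMultiplicity_le_cnt (M.crit P) (I := GapData.posC) {t, s} (by
        simp only [Finset.mem_insert, Finset.mem_singleton, GapData.ofReal_mem_posC]
        rintro u (rfl | rfl)
        · exact ht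
        · exact hs)
      rw [Finset.sum_pair hts] at h3
      have := m t ht ht0
      have := m s hs hs0
      have := M.cnt_rest_le_two hP
      omega
  · rintro ⟨hP, t, ht, hneg⟩
    refine ⟨hP, ?_⟩
    obtain ⟨r, s, hr, hrt, hts, hr0, hs0⟩ := M.exists_two_roots_crit hP ht hneg
    have hc := M.crit_ne_zero (GapModel.square_ne hP)
    obtain ⟨a, har, ha, ha1, hoa⟩ := hR.exists_critical hP hr hr0
    obtain ⟨b, hbs, hb, hb1, hob⟩ := hR.exists_critical hP (ht.trans hts) hs0
    have ma := one_le_rootMultiplicity hc hr0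
    have mb := one_le_rootMultiplicity hc hs0
    have hlt : (1 : ℕ∞) < (critPoints α β P ∩ oval α β 0).encard := by
      refine Set.one_lt_encard_iff.2 ⟨a, b, ⟨?_, ?_⟩, ⟨?_, ?_⟩, ?_⟩
      · exact (hR.one_le_regular hP ha).2 ⟨ha1, by omega⟩
      · exact coe_mem_oval_zero.2 ⟨r, hr.le, har⟩
      · exact (hR.one_le_regular hP hb).2 ⟨hb1, by omega⟩
      · exact coe_mem_oval_zero.2 ⟨s, (ht.trans hts).le, hbs⟩
      · intro h
        have := OnePoint.coe_injective h
        rw [this, hbs] at har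
        have : s = r := by exact_mod_cast har
        linarith
    exact Order.add_one_le_of_lt hlt

/-- A critical point of order two gives a double positive zero, and a negative value elsewhere would
produce a third. Conversely, a zero without sign change is at least double, and the count makes the
order exactly two. -/
theorem frozenRough_eq : frozenRough α β = M.outerEdge := by
  ext P
  constructor
  · rintro ⟨hP, y, hy, ho⟩
    obtain ⟨a, rfl, ha, hoa, t, ht, hat, ht0⟩ :=
      hR.exists_of_critical hP hy (by rw [ho]; decide)
    have h2 := ((hR.eq_two_regular hP ha).1 ho).2
    have hc := M.crit_ne_zero (GapModel.square_ne hP)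
    have hm : 2 ≤ (M.crit P).rootMultiplicity t := by
      rw [eq_rootMultiplicity_map (algebraMap ℝ ℂ).injective t, Complex.coe_algebraMap, ← hat,
        ← M.ord_add_ord ha hR.w_sq hc]
      omega
    rcases M.noPos_or hP with h | h | h
    · exact absurd ht0 (h.2 t ht).ne'
    · exfalso
      obtain ⟨-, u, hu, hneg⟩ := h
      obtain ⟨r, s, hr, hru, hus, hr0, hs0⟩ := M.exists_two_roots_crit hP hu hneg
      have hex : ∃ v : ℝ, 0 < v ∧ v ≠ t ∧ (M.crit P).eval v = 0 := by
        by_cases h : r = t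
        · exact ⟨s, hu.trans hus, by rw [← h]; exact (hru.trans hus).ne', hs0⟩
        · exact ⟨r, hr, h, hr0⟩
      obtain ⟨v, hv, hvt, hv0⟩ := hex
      have h3 := sum_rootMultiplicity_le_cnt (M.crit P) (I := GapData.posC) {v, t} (by
        simp only [Finset.mem_insert, Finset.mem_singleton, GapData.ofReal_mem_posC]
        rintro u (rfl | rfl)
        · exact hv
        · exact ht)
      rw [Finset.sum_pair hvt] at h3
      have := one_le_rootMultiplicity hc hv0
      have := M.cnt_rest_le_two hP
      omega
    · exact h
  · rintro ⟨hP, ⟨t, ht, h0⟩, hall⟩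
    have hc := M.crit_ne_zero (GapModel.square_ne hP)
    obtain ⟨a, hat, ha, ha1, hoa⟩ := hR.exists_critical hP ht h0
    refine ⟨hP, a, coe_mem_oval_zero.2 ⟨t, ht.le, hat⟩, (hR.eq_two_regular hP ha).2 ⟨ha1, ?_⟩⟩
    have hm := two_le_of_nonneg hc h0
      (by filter_upwards [Ioi_mem_nhds ht] with v hv using hall v hv)
    have h3 := sum_rootMultiplicity_le_cnt (M.crit P) (I := GapData.posC) {t} (by
      simpa [GapData.ofReal_mem_posC] using ht)
    rw [Finset.sum_singleton] at h3
    have := M.cnt_rest_le_two hP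
    omega

end Reduces
end

/-! ### Counting critical points over a gap -/

namespace GapModel
variable (M : GapModel)

/-- The critical points over a gap, as points of the curve. -/
def gapCrit (P : ℝ × ℝ) (l : ℕ) : Set (ℂ × ℂ) :=
  {p | p.1 ∈ M.gapC l ∧ p.2 ^ 2 = aeval p.1 (X * M.p1) ∧
    (p.2 ≠ 0 ∧ 1 ≤ M.ord P p.1 p.2 ∨ p.2 = 0 ∧ P.1 = 0)}

/-- The point over `t` on the sheet with sign `σ`. -/
noncomputable def lift (σ t : ℝ) : ℂ × ℂ := (t, ((σ * √(t * M.p1.eval t) : ℝ) : ℂ))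

theorem lift_inj {σ σ' t t' : ℝ} (h : M.lift σ t = M.lift σ' t') :
    t = t' ∧ σ * √(t * M.p1.eval t) = σ' * √(t' * M.p1.eval t') := by
  rw [lift, lift, Prod.mk.injEq] at h
  exact ⟨by exact_mod_cast h.1, by exact_mod_cast h.2⟩

section
variable {l : ℕ} (hl : l ∈ Finset.Icc 1 M.g)
include hl

theorem lift_ne_neg {σ t t' : ℝ} (hσ : σ = 1 ∨ σ = -1) (ht : t ∈ Set.Ioo (M.lo l) (M.hi l)) :
    M.lift σ t ≠ M.lift (-σ) t' := by
  intro h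
  obtain ⟨rfl, h⟩ := M.lift_inj h
  have := M.root_pos hl ht
  rcases hσ with rfl | rfl <;> linarith

theorem exists_lift {p : ℂ × ℂ} (h1 : p.1 ∈ M.gapC l) (h2 : p.2 ^ 2 = aeval p.1 (X * M.p1))
    (h3 : p.2 ≠ 0) : ∃ σ : ℝ, (σ = 1 ∨ σ = -1) ∧ ∃ t ∈ Set.Ioo (M.lo l) (M.hi l),
      p = M.lift σ t := by
  obtain ⟨z, w⟩ := p
  obtain ⟨t, ht, rfl⟩ := h1
  simp only at h2 h3
  rw [aeval_ofReal] at h2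
  have hp : M.p1.eval t ≠ 0 := by
    intro h
    rw [eval_mul, h, mul_zero] at h2
    exact h3 (by simpa using h2)
  have hio : t ∈ Set.Ioo (M.lo l) (M.hi l) := by
    refine ⟨lt_of_le_of_ne ht.1 ?_, lt_of_le_of_ne ht.2 ?_⟩
    · rintro h; exact hp (by rw [← h, M.p1_lo hl])
    · rintro h; exact hp (by rw [h, M.p1_hi hl])
  have hsq : ((√(t * M.p1.eval t) : ℝ) : ℂ) ^ 2 = w ^ 2 := by
    rw [h2]
    norm_cast
    rw [Real.sq_sqrt (M.rad_pos hl hio).le]; simp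
  rcases sq_eq_sq_iff_eq_or_eq_neg.1 hsq with h | h
  · exact ⟨1, Or.inl rfl, t, hio, by rw [lift, one_mul, h]⟩
  · refine ⟨-1, Or.inr rfl, t, hio, ?_⟩
    rw [lift, neg_one_mul, Complex.ofReal_neg, h, neg_neg]

variable {P : ℝ × ℝ} (hP : P ∈ square)
include hP

theorem lift_mem_gapCrit {σ t : ℝ} (hσ : σ = 1 ∨ σ = -1) (ht : t ∈ Set.Ioo (M.lo l) (M.hi l))
    (h : M.sheet P σ t = 0) : M.lift σ t ∈ M.gapCrit P l :=
  ⟨M.ofReal_mem_gapC.2 (Set.Ioo_subset_Icc_self ht), M.lift_sq hl ht hσ,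
    Or.inl ⟨M.lift_ne hl ht hσ, (M.one_le_ord_sheet hl ht (square_ne hP) hσ).2 h⟩⟩

theorem exists_of_mem_gapCrit {p : ℂ × ℂ} (h : p ∈ M.gapCrit P l) (hw : p.2 ≠ 0) :
    ∃ σ : ℝ, (σ = 1 ∨ σ = -1) ∧ ∃ t ∈ Set.Ioo (M.lo l) (M.hi l), p = M.lift σ t ∧
      M.sheet P σ t = 0 := by
  obtain ⟨h1, h2, h3⟩ := h
  obtain ⟨σ, hσ, t, ht, rfl⟩ := M.exists_lift hl h1 h2 hw
  rcases h3 with h3 | h3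
  · exact ⟨σ, hσ, t, ht, rfl, (M.one_le_ord_sheet hl ht (square_ne hP) hσ).1 h3.2⟩
  · exact absurd h3.1 hw

theorem four_le_gapCrit_of_alternating (hχ : P.1 ≠ 0) (h : P ∈ M.alternating l) :
    4 ≤ (M.gapCrit P l).encard := by
  obtain ⟨τ, hτ, hmono⟩ := M.exists_sign hl hχ
  obtain ⟨x, y, z, hxy, hyz, hT⟩ := M.three_zeros hl hP hmono (h.2 τ hτ)
  obtain ⟨v, hv, hv0⟩ := M.exists_sheet_zero hl hχ (sign_neg hτ)
  have hx := hT x (by simp)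
  have hy := hT y (by simp)
  have hz := hT z (by simp)
  have hne : ∀ s t, s ≠ t → M.lift τ s ≠ M.lift τ t := fun s t hst h => hst (M.lift_inj h).1
  classical
  set F : Finset (ℂ × ℂ) := {M.lift τ x, M.lift τ y, M.lift τ z, M.lift (-τ) v} with hF
  have hcard : F.card = 4 := by
    rw [hF, Finset.card_insert_of_notMem, Finset.card_insert_of_notMem, Finset.card_pair]
    · exact M.lift_ne_neg hl hτ hz.1
    · simp only [Finset.mem_insert, Finset.mem_singleton, not_or]
      exact ⟨hne y z hyz.ne, M.lift_ne_neg hl hτ hy.1⟩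
    · simp only [Finset.mem_insert, Finset.mem_singleton, not_or]
      exact ⟨hne x y hxy.ne, hne x z (hxy.trans hyz).ne, M.lift_ne_neg hl hτ hx.1⟩
  have hsub : (F : Set (ℂ × ℂ)) ⊆ M.gapCrit P l := by
    intro p hp
    rw [Finset.mem_coe, hF] at hp
    simp only [Finset.mem_insert, Finset.mem_singleton] at hp
    rcases hp with rfl | rfl | rfl | rfl
    · exact M.lift_mem_gapCrit hl hP hτ hx.1 hx.2
    · exact M.lift_mem_gapCrit hl hP hτ hy.1 hy.2
    · exact M.lift_mem_gapCrit hl hP hτ hz.1 hz.2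
    · exact M.lift_mem_gapCrit hl hP (sign_neg hτ) hv hv0
  have := Set.encard_le_encard hsub
  rw [Set.encard_coe_eq_coe_finsetCard, hcard] at this
  exact_mod_cast this

/-- At most one of the four points is on the monotone sheet, so three are on the other. Without
alternation all of them but the crossing have order at least two, which exceeds the count for the
gap. -/
theorem alternating_of_four_le_gapCrit (hχ : P.1 ≠ 0) (h : 4 ≤ (M.gapCrit P l).encard) :
    P ∈ M.alternating l := by
  obtain ⟨τ, hτ, hmono⟩ := M.exists_sign hl hχ
  by_contra hn
  rw [M.mem_alternating_iff hl hP hτ hmono hχ] at hn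
  obtain ⟨c, hc, hc0, hleft, hright⟩ := M.exists_crossing hl hP hmono hn
  set T : ℝ → Set ℝ := fun σ => {t | t ∈ Set.Ioo (M.lo l) (M.hi l) ∧ M.sheet P σ t = 0} with hT
  have hsub : M.gapCrit P l ⊆ M.lift τ '' T τ ∪ M.lift (-τ) '' T (-τ) := by
    intro p hp
    have hw : p.2 ≠ 0 := by
      intro h0
      rcases hp.2.2 with h' | h'
      · exact h'.1 h0
      · exact hχ h'.2
    obtain ⟨σ, hσ, t, ht, rfl, h0⟩ := M.exists_of_mem_gapCrit hl hP hp hw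
    have : σ = τ ∨ σ = -τ := by
      rcases hσ with rfl | rfl <;> rcases hτ with rfl | rfl <;> norm_num
    rcases this with rfl | rfl
    · exact Or.inl ⟨t, ⟨ht, h0⟩, rfl⟩
    · exact Or.inr ⟨t, ⟨ht, h0⟩, rfl⟩
  have hone : (T (-τ)).encard ≤ 1 := Set.encard_le_one_iff.2 fun a b ha hb =>
    (M.sheet_neg_strictMonoOn hl hmono).injOn ha.1 hb.1 (ha.2.trans hb.2.symm)
  have h3 : 3 ≤ (T τ).encard := by
    by_contra h3
    have h2 : (T τ).encard ≤ 2 := by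
      rw [not_le, show (3 : ℕ∞) = 2 + 1 by norm_num] at h3
      exact Order.le_of_lt_add_one h3
    have := calc (4 : ℕ∞) ≤ _ := h
      _ ≤ _ := Set.encard_le_encard hsub
      _ ≤ _ := Set.encard_union_le _ _
      _ ≤ _ := add_le_add ((Set.encard_image_le _ _).trans h2) ((Set.encard_image_le _ _).trans hone)
    exact absurd this (by norm_num)
  obtain ⟨S, hS, hS3⟩ := Set.exists_subset_encard_eq h3
  obtain ⟨x, y, z, hxy, hxz, hyz, rfl⟩ := Set.encard_eq_three.1 hS3
  have hx := hS (show x ∈ ({x, y, z} : Set ℝ) by simp)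
  have hy := hS (show y ∈ ({x, y, z} : Set ℝ) by simp)
  have hz := hS (show z ∈ ({x, y, z} : Set ℝ) by simp)
  have h1 : ∀ t ∈ T τ, 1 ≤ M.ord P t ((τ * √(t * M.p1.eval t) : ℝ) : ℂ) := fun t ht =>
    (M.one_le_ord_sheet hl ht.1 (square_ne hP) hτ).2 ht.2
  have h2 : ∀ t ∈ T τ, t ≠ c → 2 ≤ M.ord P t ((τ * √(t * M.p1.eval t) : ℝ) : ℂ) := fun t ht htc =>
    M.two_le_ord_of_ne_crossing hl hP hτ hleft hright ht.1 htc ht.2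
  have hsum := M.sum_ord_add_one_le hl hP hτ hχ {x, y, z} (by
    simp only [Finset.mem_insert, Finset.mem_singleton]
    rintro t (rfl | rfl | rfl)
    exacts [hx.1, hy.1, hz.1])
  rw [Finset.sum_insert (by simp [hxy, hxz]), Finset.sum_pair hyz] at hsum
  have hle := M.cnt_gap_le_four hP hl
  have x1 := h1 x hx
  have y1 := h1 y hy
  have z1 := h1 z hz
  by_cases hxc : x = c
  · have := h2 y hy fun h => hxy (hxc.trans h.symm)
    have := h2 z hz fun h => hxz (hxc.trans h.symm)
    omega
  · have := h2 x hx hxc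
    by_cases hyc : y = c
    · have := h2 z hz fun h => hyz (hyc.trans h.symm)
      omega
    · have := h2 y hy hyc
      omega

end

section axis
variable {η : ℝ} (hη : η ∈ Set.Ioo (-1 : ℝ) 1) {l : ℕ} (hl : l ∈ Finset.Icc 1 M.g)
include hη hl

omit hη in
theorem sheet_axis_zero {σ t : ℝ} (ht : t ∈ Set.Ioo (M.lo l) (M.hi l)) :
    M.sheet (0, η) σ t = 0 ↔ axisZero η = t := by
  rw [sheet_axis, sub_eq_zero]
  constructor
  · rintro rfl; exact axisZero_mob (M.lt_zero hl ht)
  · intro h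
    have h0 := M.lt_zero hl ht
    rw [← h] at h0 ⊢
    have h1 : η ≠ 1 := by rintro rfl; simp [axisZero] at h0
    have h2 : η - 1 ≠ 0 := sub_ne_zero.2 h1
    rw [mob, axisZero, eq_div_iff]
    · field_simp; ring
    · rw [axisZero] at h0; linarith

/-- For χ = 0 the four points are the two branch points over the ends and the two lifts of
`axisZero`, distinct because `axisZero` is interior. -/
theorem four_le_gapCrit_axis (h : axisZero η ∈ Set.Ioo (M.lo l) (M.hi l)) :
    4 ≤ (M.gapCrit (0, η) l).encard := by
  have hP : ((0, η) : ℝ × ℝ) ∈ square := ⟨⟨by norm_num, by norm_num⟩, hη⟩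
  have hlt := M.lo_lt_hi l hl
  classical
  set F : Finset (ℂ × ℂ) := {((M.lo l : ℂ), 0), ((M.hi l : ℂ), 0), M.lift 1 (axisZero η),
    M.lift (-1) (axisZero η)} with hF
  have hne : ∀ u : ℝ, u ≠ axisZero η → ∀ σ, ((u : ℂ), (0 : ℂ)) ≠ M.lift σ (axisZero η) := by
    intro u hu σ h'
    have := (Prod.mk.injEq _ _ _ _ ▸ h' : (u : ℂ) = (axisZero η : ℂ) ∧ _).1
    exact hu (by exact_mod_cast this)
  have hcard : F.card = 4 := by
    rw [hF, Finset.card_insert_of_notMem, Finset.card_insert_of_notMem, Finset.card_pair]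
    · exact M.lift_ne_neg hl (Or.inl rfl) h
    · simp only [Finset.mem_insert, Finset.mem_singleton, not_or]
      exact ⟨hne _ h.2.ne' 1, hne _ h.2.ne' (-1)⟩
    · simp only [Finset.mem_insert, Finset.mem_singleton, not_or]
      refine ⟨fun h' => hlt.ne ?_, hne _ h.1.ne 1, hne _ h.1.ne (-1)⟩
      have := (Prod.mk.inj h').1
      exact_mod_cast this
  have hend : ∀ u : ℝ, u ∈ Set.Icc (M.lo l) (M.hi l) → M.p1.eval u = 0 →
      ((u : ℂ), (0 : ℂ)) ∈ M.gapCrit (0, η) l := by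
    intro u hu h0
    refine ⟨M.ofReal_mem_gapC.2 hu, ?_, Or.inr ⟨rfl, rfl⟩⟩
    simp only
    rw [aeval_ofReal, eval_mul, h0]; simp
  have hsub : (F : Set (ℂ × ℂ)) ⊆ M.gapCrit (0, η) l := by
    intro p hp
    rw [Finset.mem_coe, hF] at hp
    simp only [Finset.mem_insert, Finset.mem_singleton] at hp
    rcases hp with rfl | rfl | rfl | rfl
    · exact hend _ ⟨le_rfl, hlt.le⟩ (M.p1_lo hl)
    · exact hend _ ⟨hlt.le, le_rfl⟩ (M.p1_hi hl)
    · exact M.lift_mem_gapCrit hl hP (Or.inl rfl) h ((M.sheet_axis_zero hl h).2 rfl)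
    · exact M.lift_mem_gapCrit hl hP (Or.inr rfl) h ((M.sheet_axis_zero hl h).2 rfl)
  have := Set.encard_le_encard hsub
  rw [Set.encard_coe_eq_coe_finsetCard, hcard] at this
  exact_mod_cast this

theorem axisZero_mem_of_four (h : 4 ≤ (M.gapCrit (0, η) l).encard) :
    axisZero η ∈ Set.Ioo (M.lo l) (M.hi l) := by
  have hP : ((0, η) : ℝ × ℝ) ∈ square := ⟨⟨by norm_num, by norm_num⟩, hη⟩
  by_contra hn
  have hsub : M.gapCrit (0, η) l ⊆ {((M.lo l : ℂ), 0), ((M.hi l : ℂ), 0)} := by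
    intro p hp
    by_cases hw : p.2 = 0
    · obtain ⟨⟨t, ht, h1⟩, h2, -⟩ := hp
      obtain ⟨z, w⟩ := p
      simp only at h1 h2 hw
      subst h1 hw
      rw [aeval_ofReal, eval_mul, eval_X] at h2
      have h3 : t * M.p1.eval t = 0 := by
        have : ((t * M.p1.eval t : ℝ) : ℂ) = 0 := by rw [← h2]; simp
        exact_mod_cast this
      have h4 : t = M.lo l ∨ t = M.hi l := by
        by_contra h5
        rw [not_or] at h5
        exact (M.rad_pos hl ⟨lt_of_le_of_ne ht.1 (Ne.symm h5.1), lt_of_le_of_ne ht.2 h5.2⟩).ne' h3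
      rcases h4 with rfl | rfl <;> simp
    · obtain ⟨σ, hσ, t, ht, rfl, h0⟩ := M.exists_of_mem_gapCrit hl hP hp hw
      exact absurd (((M.sheet_axis_zero hl ht).1 h0).symm ▸ ht) hn
  have := h.trans ((Set.encard_le_encard hsub).trans (Set.encard_insert_le _ _))
  rw [Set.encard_singleton] at this
  exact absurd this (by norm_num)

end axis

theorem alternating_iff_four_le {l : ℕ} (hl : l ∈ Finset.Icc 1 M.g) {P : ℝ × ℝ}
    (hP : P ∈ square) : P ∈ M.alternating l ↔ 4 ≤ (M.gapCrit P l).encard := by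
  by_cases hχ : P.1 = 0
  · obtain ⟨χ, η⟩ := P
    obtain rfl : χ = 0 := hχ
    rw [M.mem_alternating_axis hP.2 hl]
    exact ⟨M.four_le_gapCrit_axis hP.2 hl, M.axisZero_mem_of_four hP.2 hl⟩
  · exact ⟨M.four_le_gapCrit_of_alternating hl hP hχ, M.alternating_of_four_le_gapCrit hl hP hχ⟩

end GapModel

/-! ### Identification of the smooth region and the inner curves -/

section
variable {k : ℕ} {α β : Fin k → ℝ}

namespace Reduces
variable {M : GapModel} (hR : Reduces α β M)
include hR

section
variable {l : ℕ} (hl : l ∈ Finset.Icc 1 M.g)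
include hl

/-- The critical points on an inner oval. -/
theorem encard_critPoints {P : ℝ × ℝ} (hP : P ∈ square) :
    (critPoints α β P ∩ oval α β l).encard = (M.gapCrit P l).encard := by
  have hne : ∀ a : AffineCurve α β, a.1.1 ∈ M.gapC l → a.1.1 ≠ 0 ∧ a.1.1 ≠ 1 := by
    rintro a ⟨t, ht, h⟩
    have h0 := M.gap_neg hl ht
    rw [h]
    exact ⟨by exact_mod_cast h0.ne, by exact_mod_cast (h0.trans one_pos).ne⟩
  have hcrit : ∀ a : AffineCurve α β,
      (a : Surface α β) ∈ critPoints α β P ∩ oval α β l ↔ a.1 ∈ M.gapCrit P l := by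
    intro a
    rw [Set.mem_inter_iff, hR.coe_mem_oval_iff hl]
    constructor
    · rintro ⟨h1, h2⟩
      refine ⟨h2, hR.w_sq, ?_⟩
      by_cases hw : a.1.2 = 0
      · exact Or.inr ⟨hw, ((hR.one_le_branch hP hw).1 h1).2⟩
      · exact Or.inl ⟨hw, ((hR.one_le_regular hP hw).1 h1).2⟩
    · rintro ⟨h1, -, h2⟩
      refine ⟨?_, h1⟩
      rcases h2 with h2 | h2
      · exact (hR.one_le_regular hP h2.1).2 ⟨(hne a h1).2, h2.2⟩
      · exact (hR.one_le_branch hP h2.1).2 ⟨(hne a h1).1, h2.2⟩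
  have e1 : critPoints α β P ∩ oval α β l =
      (fun a : AffineCurve α β => (a : Surface α β)) '' (Subtype.val ⁻¹' M.gapCrit P l) := by
    ext y
    constructor
    · intro hy
      obtain ⟨a, rfl, -⟩ := (hR.mem_oval_iff hl).1 hy.2
      exact ⟨a, (hcrit a).1 hy, rfl⟩
    · rintro ⟨a, ha, rfl⟩
      exact (hcrit a).2 ha
  have e2 : Subtype.val '' (Subtype.val ⁻¹' M.gapCrit P l : Set (AffineCurve α β)) =
      M.gapCrit P l := by
    refine Set.image_preimage_eq_of_subset fun p hp => ?_
    have h : p.2 ^ 2 = aeval p.1 (p0 α β) := by rw [hR.p0_eq]; exact hp.2.1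
    exact ⟨⟨p, h⟩, rfl⟩
  rw [e1, OnePoint.coe_injective.encard_image, ← Subtype.val_injective.encard_image, e2]

theorem smoothPart_eq : smoothPart α β l = M.alternating l := by
  ext P
  constructor
  · rintro ⟨hP, h⟩
    rw [hR.encard_critPoints hl hP] at h
    exact (M.alternating_iff_four_le hl hP).2 h
  · intro h
    refine ⟨h.1, ?_⟩
    rw [hR.encard_critPoints hl h.1]
    exact (M.alternating_iff_four_le hl h.1).1 h

/-- A branch point over an end has order at least two only for χ = 0 with `axisZero` at that end. At
the other points χ ≠ 0, and the point lies on the non-monotone sheet. A higher-order zero there is a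
limit of alternating parameters but excludes alternation. -/
theorem roughSmooth_eq : roughSmooth α β l = M.innerEdge l := by
  have hlt := M.lo_lt_hi l hl
  ext P
  constructor
  · rintro ⟨hP, y, hy, h2⟩
    have hne := M.crit_ne_zero (GapModel.square_ne hP)
    obtain ⟨a, rfl, t, ht, hat⟩ := (hR.mem_oval_iff hl).1 hy
    have hg : a.1.1 ∈ M.gapC l := ⟨t, ht, hat⟩
    by_cases hw : a.1.2 = 0
    · obtain ⟨h3, hχ, hlin⟩ := (hR.two_le_branch hP hw hat).1 h2
      obtain ⟨χ, η⟩ := P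
      obtain rfl : χ = 0 := hχ
      have hη := hP.2
      have hp1 : M.p1.eval t = 0 := by
        obtain ⟨e, he, h⟩ := hR.branch_real hw
        obtain rfl : t = e := Complex.ofReal_injective (hat.symm.trans he)
        exact (h.resolve_left h3).2.1
      have hz : GapModel.axisZero η = t := by
        rw [M.lin_eval] at hlin
        have h5 := (mul_eq_zero.1 hlin).resolve_left M.κ_pos.ne'
        have h6 : η - 1 ≠ 0 := by linarith [hη.2]
        rw [GapModel.axisZero, div_eq_iff h6]
        simp only at h5
        linarith
      refine ⟨M.mem_inner_axis_of_mem hη hl (by rwa [hz]), ?_⟩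
      rw [M.mem_alternating_axis hη hl, hz]
      exact fun h => (M.p1_neg hl h).ne hp1
    · have h3 := ((hR.two_le_regular hP hw).1 h2).2
      by_cases hχ : P.1 = 0
      -- For χ = 0 and w ≠ 0 a double zero would make the linear factor vanish together with its
      -- derivative κ(η - 1), impossible in the square.
      · exfalso
        obtain ⟨e1, e2⟩ := (M.two_le_ord_iff hw hR.w_sq hne).1 h3
        rw [hχ] at e1 e2
        simp only [Complex.ofReal_zero, zero_mul, mul_eq_zero, hw, or_false] at e1
        rw [e1] at e2
        simp only [Complex.ofReal_zero, zero_mul, add_zero, mul_eq_zero, hw, or_false] at e2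
        simp only [GapModel.lin, derivative_mul, derivative_C, derivative_X, derivative_sub,
          zero_mul, zero_add, mul_one, sub_zero, map_mul, aeval_C, mul_eq_zero] at e2
        rcases e2 with e2 | e2
        · exact M.κ_pos.ne' (by simpa using e2)
        · have : P.2 - 1 = 0 := by
            have h5 : ((P.2 - 1 : ℝ) : ℂ) = 0 := e2
            exact_mod_cast h5
          linarith [hP.2.2]
      · obtain ⟨τ, hτ, hmono⟩ := M.exists_sign hl hχ
        obtain ⟨σ, hσ, u, hu, hpu⟩ := M.exists_lift hl hg hR.w_sq hw
        rw [hpu] at h3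
        have hστ : σ = τ := by
          by_contra hne'
          have : σ = -τ := by
            rcases hσ with rfl | rfl <;> rcases hτ with rfl | rfl <;> simp_all
          rw [this] at h3
          have := M.ord_neg_le_one hl hP hτ hmono hu
          simp only [GapModel.lift] at h3
          omega
        rw [hστ] at h3
        refine ⟨M.closure_alternating_subset hl
          (M.mem_closure_alternating hl hP hτ hmono hχ hu h3), fun h => ?_⟩
        have := M.ord_le_one_of_alternating hl hP hτ hmono hχ (h.2 τ hτ) hu
        simp only [GapModel.lift] at h3
        omega
  · intro h
    have hP := h.1.1
    refine ⟨hP, ?_⟩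
    by_cases hχ : P.1 = 0
    · obtain ⟨χ, η⟩ := P
      obtain rfl : χ = 0 := hχ
      have hend : ∀ e : ℝ, e ∈ Set.Icc (M.lo l) (M.hi l) → M.p1.eval e = 0 →
          η = GapModel.mob e → ∃ y ∈ oval α β l, 2 ≤ critOrder α β (0, η) y := by
        intro e he h0 hη
        let a : AffineCurve α β := ⟨((e : ℂ), 0), by
          rw [hR.p0_eq]
          simp only
          rw [aeval_ofReal, eval_mul, h0]; simp⟩
        have he0 := M.gap_neg hl he
        refine ⟨(a : Surface α β), (hR.coe_mem_oval_iff hl).2 ⟨e, he, rfl⟩,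
          (hR.two_le_branch (a := a) hP rfl rfl).2 ⟨he0.ne, rfl, ?_⟩⟩
        have h1 : e - 1 ≠ 0 := by linarith
        rw [M.lin_eval, hη, GapModel.mob]
        field_simp
        ring
      rcases M.innerEdge_axis hl h with h' | h'
      · exact hend _ ⟨le_rfl, hlt.le⟩ (M.p1_lo hl) h'
      · exact hend _ ⟨hlt.le, le_rfl⟩ (M.p1_hi hl) h'
    · obtain ⟨τ, hτ, hmono⟩ := M.exists_sign hl hχ
      obtain ⟨z, hz, h2⟩ := M.exists_two_le_ord hl hP hτ hmono hχ
        ((by norm_num : 3 ≤ 4).trans h.1.2) h.2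
      let a : AffineCurve α β := ⟨M.lift τ z, by
        rw [hR.p0_eq]; exact M.lift_sq hl hz hτ⟩
      have hz1 : a.1.1 ≠ 1 := by
        have h0 := M.lt_zero hl hz
        have : (z : ℂ) ≠ 1 := by exact_mod_cast (h0.trans one_pos).ne
        exact this
      exact ⟨(a : Surface α β), (hR.coe_mem_oval_iff hl).2
        ⟨z, Set.Ioo_subset_Icc_self hz, rfl⟩,
        (hR.two_le_regular (a := a) hP (M.lift_ne hl hz hτ)).2 ⟨hz1, h2⟩⟩

end

theorem frozenRoughCurve_eq : frozenRoughCurve α β = M.outerEdge ∪ M.corners := by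
  rw [frozenRoughCurve, hR.frozenRough_eq, GapModel.corners, hR.estar_eq]; rfl

theorem iUnion_congr {f : ℕ → Set (ℝ × ℝ)} {f' : ℕ → Set (ℝ × ℝ)}
    (h : ∀ l ∈ Finset.Icc 1 M.g, f l = f' l) :
    ⋃ l ∈ Set.Icc 1 (kPrime α β - 1), f l = ⋃ l ∈ Set.Icc 1 M.g, f' l := by
  rw [← hR.g_eq]
  exact Set.iUnion₂_congr fun l hl => h l (Finset.mem_Icc.2 hl)

/-- The behaviour of `crit` on the positive half line (negative somewhere, touching zero, positive)
decides between frozen, outer curve and the rest. In the last case `middle_iff` and the disjointness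
of the `inner` regions decide. -/
theorem existsUnique_phase {P : ℝ × ℝ} (hP : P ∈ square) :
    ∃! i : Phase (kPrime α β - 1), P ∈ phaseSet α β i := by
  have hmem : ∀ l : Set.Icc 1 (kPrime α β - 1), l.1 ∈ Finset.Icc 1 M.g := fun l => by
    rw [hR.g_eq]; exact Finset.mem_Icc.2 l.2
  have sF : P ∈ phaseSet α β .frozen ↔ P ∈ M.outer := by rw [phaseSet, hR.frozen_eq]
  have sR : P ∈ phaseSet α β .rough ↔ P ∈ M.middle := by rw [phaseSet, hR.rough_eq]
  have sE : P ∈ phaseSet α β .frozenRough ↔ P ∈ M.outerEdge := by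
    rw [phaseSet, hR.frozenRough_eq]
  have sS : P ∈ phaseSet α β .smooth ↔ ∃ l ∈ Finset.Icc 1 M.g, P ∈ M.alternating l := by
    rw [phaseSet, smooth, hR.iUnion_congr fun l hl => hR.smoothPart_eq hl]
    simp
  have sI : ∀ l, P ∈ phaseSet α β (.roughSmooth l) ↔ P ∈ M.innerEdge l.1 := fun l => by
    rw [phaseSet, hR.roughSmooth_eq (hmem l)]
  have nS : P ∈ phaseSet α β .smooth → P ∈ M.noPos := fun h => by
    obtain ⟨l, hl, h⟩ := sS.1 h
    exact M.inner_subset_noPos hl (M.alternating_subset_inner hl h)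
  have nI : ∀ l, P ∈ phaseSet α β (.roughSmooth l) → P ∈ M.noPos := fun l h =>
    M.inner_subset_noPos (hmem l) ((sI l).1 h).1
  have nR : P ∈ phaseSet α β .rough → P ∈ M.noPos := fun h => M.middle_subset_noPos (sR.1 h)
  have xRS : P ∈ M.middle → P ∉ phaseSet α β .smooth := fun h h' => by
    obtain ⟨l, hl, h'⟩ := sS.1 h'
    exact M.middle_disjoint_inner hl h (M.alternating_subset_inner hl h')
  have xRI : P ∈ M.middle → ∀ l, P ∉ phaseSet α β (.roughSmooth l) := fun h l h' =>
    M.middle_disjoint_inner (hmem l) h ((sI l).1 h').1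
  have xSI : P ∈ phaseSet α β .smooth → ∀ l, P ∉ phaseSet α β (.roughSmooth l) := fun h l h' => by
    obtain ⟨j, hj, h⟩ := sS.1 h
    exact M.innerEdge_disjoint_alternating (hmem l) hj ((sI l).1 h') h
  rcases M.noPos_or hP with hN | hF | hE
  · have xF : P ∉ phaseSet α β .frozen := fun h => M.noPos_disjoint_outer hN (sF.1 h)
    have xE : P ∉ phaseSet α β .frozenRough := fun h => M.noPos_disjoint_outerEdge hN (sE.1 h)
    by_cases hM : P ∈ M.middle
    · refine ⟨.rough, sR.2 hM, ?_⟩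
      rintro (_ | _ | _ | _ | l) h
      exacts [absurd h xF, rfl, absurd h (xRS hM), absurd h xE, absurd h (xRI hM l)]
    have xR : P ∉ phaseSet α β .rough := fun h => hM (sR.1 h)
    rw [M.middle_iff] at hM
    push Not at hM
    obtain ⟨l, hl, hin⟩ := hM hN
    by_cases ha : P ∈ M.alternating l
    · have hS := sS.2 ⟨l, hl, ha⟩
      refine ⟨.smooth, hS, ?_⟩
      rintro (_ | _ | _ | _ | j) h
      exacts [absurd h xF, absurd h xR, rfl, absurd h xE, absurd h (xSI hS j)]
    · have hl' : l ∈ Set.Icc 1 (kPrime α β - 1) := by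
        rw [← hR.g_eq]; exact Finset.mem_Icc.1 hl
      have hI : P ∈ phaseSet α β (.roughSmooth ⟨l, hl'⟩) := (sI ⟨l, hl'⟩).2 ⟨hin, ha⟩
      refine ⟨.roughSmooth ⟨l, hl'⟩, hI, ?_⟩
      rintro (_ | _ | _ | _ | j) h
      · exact absurd h xF
      · exact absurd h xR
      · exact absurd hI (xSI h _)
      · exact absurd h xE
      · congr 1
        by_contra hne
        have hjl : j.1 ≠ l := fun h' => hne (Subtype.ext h')
        exact M.inner_disjoint (hmem j) hl hjl ((sI j).1 h).1 hin
  · have xN : P ∉ M.noPos := fun h => M.noPos_disjoint_outer h hF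
    refine ⟨.frozen, sF.2 hF, ?_⟩
    rintro (_ | _ | _ | _ | l) h
    exacts [rfl, absurd (nR h) xN, absurd (nS h) xN,
      absurd (sE.1 h) (M.outer_disjoint_outerEdge hF), absurd (nI l h) xN]
  · have xN : P ∉ M.noPos := fun h => M.noPos_disjoint_outerEdge h hE
    refine ⟨.frozenRough, sE.2 hE, ?_⟩
    rintro (_ | _ | _ | _ | l) h
    exacts [absurd hE (M.outer_disjoint_outerEdge (sF.1 h)), absurd (nR h) xN,
      absurd (nS h) xN, rfl, absurd (nI l h) xN]

end Reduces

theorem exists_reduces (hk : 1 ≤ k) (hα : ∀ m, 0 < α m) (hβ : ∀ m, 0 < β m)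
    (hαβ : ∏ m, α m = ∏ m, β m) : ∃ M : GapModel, Reduces α β M := by
  have h := polyPhi_shape α β hα hβ hαβ
  obtain ⟨M, h1, h2, h3, h4, h5, h6, h7⟩ := exists_gapModel hk hα hβ h
  exact ⟨M, hk, hα, hβ, h, h1, h2, h3, h4, h5, h6, h7⟩

end

end AztecDiamond

theorem mainTheorem10 (k : ℕ) (hk : 1 ≤ k) (α β : Fin k → ℝ)
    (hα : ∀ m, 0 < α m) (hβ : ∀ m, 0 < β m) (hαβ : ∏ m, α m = ∏ m, β m) :
    -- the boundary of the rough region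
    frontier (AztecDiamond.rough α β) =
        AztecDiamond.frozenRoughCurve α β ∪
          ⋃ l ∈ Set.Icc 1 (AztecDiamond.kPrime α β - 1), AztecDiamond.roughSmooth α β l ∧
    -- the outer curve separates the rough and the frozen regions
    AztecDiamond.Separates (AztecDiamond.frozenRoughCurve α β)
      (AztecDiamond.rough α β) (AztecDiamond.frozen α β) ∧
    -- the inner curves, together and each one, separate the rough and the smooth regions
    AztecDiamond.Separates
      (⋃ l ∈ Set.Icc 1 (AztecDiamond.kPrime α β - 1), AztecDiamond.roughSmooth α β l)
      (AztecDiamond.rough α β) (AztecDiamond.smooth α β) ∧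
    (∀ l ∈ Set.Icc 1 (AztecDiamond.kPrime α β - 1),
      AztecDiamond.Separates (AztecDiamond.roughSmooth α β l)
        (AztecDiamond.rough α β) (AztecDiamond.smoothPart α β l)) ∧
    -- every point of the open square lies in exactly one of the sets
    (∀ P ∈ AztecDiamond.square,
      ∃! i : AztecDiamond.Phase (AztecDiamond.kPrime α β - 1),
        P ∈ AztecDiamond.phaseSet α β i) := by
  obtain ⟨M, hR⟩ := AztecDiamond.exists_reduces hk hα hβ hαβ
  have hmem : ∀ l ∈ Set.Icc 1 (AztecDiamond.kPrime α β - 1), l ∈ Finset.Icc 1 M.g :=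
    fun l hl => by rw [hR.g_eq]; exact Finset.mem_Icc.2 hl
  have hinner : (⋃ l ∈ Set.Icc 1 (AztecDiamond.kPrime α β - 1),
      AztecDiamond.roughSmooth α β l) = ⋃ l ∈ Set.Icc 1 M.g, M.innerEdge l :=
    hR.iUnion_congr fun l hl => hR.roughSmooth_eq hl
  have hsmooth : AztecDiamond.smooth α β = ⋃ l ∈ Set.Icc 1 M.g, M.alternating l :=
    hR.iUnion_congr fun l hl => hR.smoothPart_eq hl
  rw [hinner, hsmooth, hR.rough_eq, hR.frozen_eq, hR.frozenRoughCurve_eq]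
  refine ⟨M.frontier_middle, M.separates_outer, M.separates_inner le_rfl, fun l hl => ?_,
    fun P hP => hR.existsUnique_phase hP⟩
  rw [hR.roughSmooth_eq (hmem l hl), hR.smoothPart_eq (hmem l hl)]
  have h := M.separates_inner (s := {l})
    (Set.singleton_subset_iff.2 (Finset.mem_Icc.1 (hmem l hl)))
  simpa using h
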